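/- **Setting.** Let $\mathcal X$ be a compact Polish space, let $\mathcal Y\subset\mathbb R^m$ be Borel, and let $\Theta\subset\mathbb R^d$ be compact and connected. Assume moreover that there is a constant $C$ such that any two points $a,b\in\Theta$ can be joined inside $\Theta$ by a path of length at most $C|a-b|$, and that at every point of $\Theta$ the tangent directions of $\Theta$ span $\mathbb R^d$ (so that derivatives relative to $\Theta$ are unique; both conditions hold, for example, if $\Theta$ is convex with non-empty interior). All $\theta$-derivatives are taken relative to $\Theta$. Let $\mu$ be a finite measure on $\mathcal X$ and $\nu$ a measure on $\mathcal Y$ that is finite on bounded sets. For each $\theta\in\Theta$ let $\{X_k,Y_k\}_{k\ge0}$ be a hidden Markov model: $X$ is a homogeneous Markov chain on $\mathcal X$ with transition density $q_\theta(x,x')$ with respect to $\mu(dx')$; given the hidden chain and the other observations, $Y_k$ has density $g_\theta(\cdot\mid X_k)$ with respect to $\nu$; the densities are measurable in $(x,x')$ and in $(y,x)$. The joint chain has an invariant probability distribution $\pi_\theta$; $\overline{\mathbb P}_\theta$ denotes the law of the stationary process. Fix $\theta^*\in\Theta$ and assume: * (A1) $\theta^*$ lies in the interior of $\Theta$, and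 $\theta=\theta^*$ if and only if the observation process $(Y_k)$ has the same law under $\overline{\mathbb P}_\theta$ as under $\overline{\mathbb P}_{\theta^*}$. * (A2) For all $y\in\mathcal Y$, $x,x'\in\mathcal X$, the maps $\theta\mapsto q_\theta(x,x')$ and $\theta\mapsto g_\theta(y\mid x)$ are three times continuously differentiable on $\Theta$. * (A3) There are $\underline c_1,\overline c_1\in(0,\infty)$ with $\underline c_1\le q_\theta(x,x')\le\overline c_1$ and $g_\theta(y\mid x)\le\overline c_1$ for all $\theta\in\Theta$, $x,x'\in\mathcal X$, $y\in\mathcal Y$. * (A4) There is $\overline c_2\in(0,\infty)$ with $|\nabla_\theta\log q_\theta(x,x')|\le\overline c_2$ and $\|\nabla^2_\theta\log q_\theta(x,x')\|\le\overline c_2$ for all $\theta\in\Theta$, $x,x'\in\mathcal X$. * (A5) $0<\int_{\mathcal X}g_\theta(y\mid x)\,\mu(dx)<\infty$ for all $\theta\in\Theta$, $y\in\mathcal Y$. * (A6) For $(j,p)\in\{(1,3),(2,2),(3,1)\}$ and every $K>0$, $$\overline{\mathbb E}_{\theta^*}\Big[\sup_{\theta\in\Theta}\ \sup_{x\in\mathcal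 X}\ \sup_{y'\in\mathcal Y,\ |y'-Y_0|\le K}\big\|\nabla^j_\theta\log g_\theta(y'\mid x)\big\|^p\Big]<\infty,$$ where the supremum is over those arguments with $g_\theta(y'\mid x)>0$, and the expectation is an upper expectation if the supremum is not measurable. For $\varepsilon>0$ let $B^\varepsilon_y$ be the closed Euclidean ball and put $$g^\varepsilon_\theta(y\mid x)=\frac1{\nu(B^\varepsilon_y)}\int_{B^\varepsilon_y}g_\theta(y'\mid x)\,\nu(dy'),\qquad g^0_\theta=g_\theta .$$ For $\varepsilon\ge0$ let $$p^\varepsilon_\theta(y_1,\dots,y_n\mid X_0=x_0)=\int_{\mathcal X^n}\prod_{k=1}^n q_\theta(x_{k-1},x_k)\,g^\varepsilon_\theta(y_k\mid x_k)\;\mu(dx_1)\cdots\mu(dx_n)$$ be the likelihood of the perturbed model, and let $$L^\varepsilon_n(\theta;x)=\tfrac1n\big(\log p^\varepsilon_\theta(Y_1,\dots,Y_n\mid X_0=x)-\log p^\varepsilon_{\theta^*}(Y_1,\dots,Y_n\mid X_0=x)\big).$$ **Theorem 1.** For every $\varepsilon\ge0$ there is a twice continuously differentiable function $l^\varepsilon:\Theta\to\mathbb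 R$ such that for every $x\in\mathcal X$ the following holds $\overline{\mathbb P}_{\theta^*}$-almost surely: for all $n$ the likelihood $\theta\mapsto p^\varepsilon_\theta(Y_1,\dots,Y_n\mid X_0=x)$ is positive and twice continuously differentiable on $\Theta$, and, as $n\to\infty$, $$L^\varepsilon_n(\theta;x)\to l^\varepsilon(\theta),\qquad \nabla_\theta L^\varepsilon_n(\theta;x)\to\nabla_\theta l^\varepsilon(\theta),\qquad \nabla^2_\theta L^\varepsilon_n(\theta;x)\to\nabla^2_\theta l^\varepsilon(\theta),$$ uniformly in $\theta\in\Theta$. Moreover $l^\varepsilon\to l^0$, $\nabla_\theta l^\varepsilon\to\nabla_\theta l^0$ and $\nabla^2_\theta l^\varepsilon\to\nabla^2_\theta l^0$ as $\varepsilon\to0$, uniformly in $\theta\in\Theta$. -/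

import Mathlib

open MeasureTheory ProbabilityTheory Filter Topology
open scoped NNReal ENNReal

noncomputable section

/-- A family of hidden Markov models on the same state spaces, indexed by a parameter in
`Θ ⊆ ℝ^d`. The hidden states lie in `X`, the observations in `𝒴 ⊆ ℝ^m`. The transition kernel
has density `q θ x ·` with respect to the finite measure `μ`, and the conditional law of an
observation given the hidden state `x` has density `g θ · x` with respect to the measure `ν`,
which is concentrated on `𝒴` and finite on bounded sets. Values of `q` and `g` at parameters
outside `Θ`, and of `g` at observations outside `𝒴`, play no role. -/
structure HMMFamily (X : Type*) [TopologicalSpace X] [MeasurableSpace X] (d m : ℕ) where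
  /-- the parameter set -/
  Θ : Set (EuclideanSpace ℝ (Fin d))
  /-- the observation space -/
  𝒴 : Set (EuclideanSpace ℝ (Fin m))
  /-- the dominating measure for the hidden state -/
  μ : Measure X
  /-- the dominating measure for the observations -/
  ν : Measure (EuclideanSpace ℝ (Fin m))
  /-- the transition density `q θ x x'` from `x` to `x'` -/
  q : EuclideanSpace ℝ (Fin d) → X → X → ℝ
  /-- the conditional density `g θ y x` of the observation `y` given the hidden state `x` -/
  g : EuclideanSpace ℝ (Fin d) → EuclideanSpace ℝ (Fin m) → X → ℝ
  finite_μ : IsFiniteMeasure μ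
  finite_ν : IsFiniteMeasureOnCompacts ν
  measurableSet_obs : MeasurableSet 𝒴
  ν_compl_obs : ν 𝒴ᶜ = 0
  measurable_q : ∀ θ ∈ Θ, Measurable (Function.uncurry (q θ))
  measurable_g : ∀ θ ∈ Θ, Measurable (Function.uncurry (g θ))
  q_nonneg : ∀ θ ∈ Θ, ∀ x x', 0 ≤ q θ x x'
  g_nonneg : ∀ θ ∈ Θ, ∀ y ∈ 𝒴, ∀ x, 0 ≤ g θ y x
  lintegral_q : ∀ θ ∈ Θ, ∀ x, ∫⁻ x', ENNReal.ofReal (q θ x x') ∂μ = 1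
  lintegral_g : ∀ θ ∈ Θ, ∀ x, ∫⁻ y, ENNReal.ofReal (g θ y x) ∂ν = 1

namespace HMMFamily

variable {X : Type*} [TopologicalSpace X] [MeasurableSpace X] {d m : ℕ}

instance (M : HMMFamily X d m) : IsFiniteMeasure M.μ := M.finite_μ

instance (M : HMMFamily X d m) : IsFiniteMeasureOnCompacts M.ν := M.finite_ν

/-! ### The laws of the models -/

/-- The transition kernel `Q_θ(x, dx') = q_θ(x, x') μ(dx')` of the hidden chain. -/
def transition (M : HMMFamily X d m) (θ : M.Θ) : Kernel X X :=
  Kernel.withDensity (Kernel.const X M.μ) fun x x' => ENNReal.ofReal (M.q θ x x')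

/-- The conditional law `g_θ(y | x) ν(dy)` of the observation given the hidden state. -/
def emission (M : HMMFamily X d m) (θ : M.Θ) : Kernel X (EuclideanSpace ℝ (Fin m)) :=
  Kernel.withDensity (Kernel.const X M.ν) fun x y => ENNReal.ofReal (M.g θ y x)

instance (M : HMMFamily X d m) (θ : M.Θ) : IsMarkovKernel (M.transition θ) := by
  refine ⟨fun x => ⟨?_⟩⟩
  have h : Measurable (Function.uncurry fun x x' => ENNReal.ofReal (M.q θ x x')) :=
    (M.measurable_q θ θ.2).ennreal_ofReal
  rw [transition, Kernel.withDensity_apply' _ h, Measure.restrict_univ, Kernel.const_apply]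
  exact M.lintegral_q θ θ.2 x

instance (M : HMMFamily X d m) (θ : M.Θ) : IsMarkovKernel (M.emission θ) := by
  refine ⟨fun x => ⟨?_⟩⟩
  have h : Measurable (Function.uncurry fun x y => ENNReal.ofReal (M.g θ y x)) :=
    ((M.measurable_g θ θ.2).comp measurable_swap).ennreal_ofReal
  rw [emission, Kernel.withDensity_apply' _ h, Measure.restrict_univ, Kernel.const_apply]
  exact M.lintegral_g θ θ.2 x

/-- The transition kernel of the joint chain `(X_k, Y_k)`: from `(x, y)` draw
`x' ∼ Q_θ(x, ·)` and then `y'` from the conditional law given `x'`. -/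
def joint (M : HMMFamily X d m) (θ : M.Θ) :
    Kernel (X × EuclideanSpace ℝ (Fin m)) (X × EuclideanSpace ℝ (Fin m)) :=
  (M.transition θ ⊗ₖ Kernel.prodMkLeft X (M.emission θ)).comap Prod.fst measurable_fst

instance (M : HMMFamily X d m) (θ : M.Θ) : IsMarkovKernel (M.joint θ) := by
  unfold joint; infer_instance

/-- The law of the sequence `(X_k, Y_k)_{k ≥ 0}` under the parameter `θ` when `(X_0, Y_0)` has
law `ρ`. If `ρ` is the invariant distribution of the joint chain, this is the stationary law. -/
def pathLaw (M : HMMFamily X d m) (θ : M.Θ) (ρ : Measure (X × EuclideanSpace ℝ (Fin m))) :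
    Measure (ℕ → X × EuclideanSpace ℝ (Fin m)) :=
  Kernel.trajMeasure (X := fun _ => X × EuclideanSpace ℝ (Fin m)) ρ fun n =>
    (M.joint θ).comap (fun h => h ⟨n, Finset.mem_Iic.2 le_rfl⟩) (measurable_pi_apply _)

/-- The law of the observation sequence `(Y_k)_{k ≥ 0}`. For stationary processes, equality of
these laws is the same as equality of the laws of the doubly infinite observation sequences. -/
def obsLaw (M : HMMFamily X d m) (θ : M.Θ) (ρ : Measure (X × EuclideanSpace ℝ (Fin m))) :
    Measure (ℕ → EuclideanSpace ℝ (Fin m)) :=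
  (M.pathLaw θ ρ).map fun ω k => (ω k).2

/-- `π θ` is an invariant probability distribution of the joint chain, for every `θ ∈ Θ`. -/
def IsStationary (M : HMMFamily X d m)
    (π : M.Θ → Measure (X × EuclideanSpace ℝ (Fin m))) : Prop :=
  ∀ θ, IsProbabilityMeasure (π θ) ∧ Kernel.Invariant (M.joint θ) (π θ)

/-! ### The perturbed likelihood -/

/-- The conditional density `g^ε_θ(y | x)` of the perturbed model: the `ν`-average of
`g_θ(· | x)` over the closed ball of radius `ε` around `y`; for `ε = 0` it is `g_θ(y | x)`. -/
def gPert (M : HMMFamily X d m) (ε : ℝ) (θ : EuclideanSpace ℝ (Fin d))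
    (y : EuclideanSpace ℝ (Fin m)) (x : X) : ℝ :=
  if ε = 0 then M.g θ y x else ⨍ y' in Metric.closedBall y ε, M.g θ y' x ∂M.ν

/-- The likelihood `p^ε_θ(y_1, …, y_n | X_0 = x₀)` of the perturbed model, that is the integral
of `∏_{k=1}^n q_θ(x_{k-1}, x_k) g^ε_θ(y_k | x_k)` against `μ(dx_1) ⋯ μ(dx_n)`. Here
`Fin.cons x₀ x = (x₀, x_1, …, x_n)`, and `k : Fin n` stands for the time `k + 1`. -/
def likelihood (M : HMMFamily X d m) (ε : ℝ) (n : ℕ) (y : ℕ → EuclideanSpace ℝ (Fin m))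
    (x₀ : X) (θ : EuclideanSpace ℝ (Fin d)) : ℝ :=
  ∫ x : Fin n → X,
    ∏ k : Fin n, M.q θ ((Fin.cons x₀ x : Fin (n + 1) → X) k.castSucc) (x k) *
      M.gPert ε θ (y ((k : ℕ) + 1)) (x k) ∂Measure.pi fun _ => M.μ

/-- The normalized relative log-likelihood
`(1/n) (log p^ε_θ(y_1, …, y_n | X_0 = x₀) - log p^ε_{θ*}(y_1, …, y_n | X_0 = x₀))`. -/
def relLogLik (M : HMMFamily X d m) (θs : EuclideanSpace ℝ (Fin d)) (ε : ℝ) (n : ℕ)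
    (y : ℕ → EuclideanSpace ℝ (Fin m)) (x₀ : X) (θ : EuclideanSpace ℝ (Fin d)) : ℝ :=
  (1 / (n : ℝ)) * (Real.log (M.likelihood ε n y x₀ θ) - Real.log (M.likelihood ε n y x₀ θs))

/-! ### Assumptions -/

/-- Regularity of the parameter set: it is compact, derivatives relative to it are unique at
all its points, and any two of its points `a`, `b` can be joined inside it by a path of length
at most `C |a - b|`; in particular it is connected. -/
structure RegularParam (M : HMMFamily X d m) : Prop where
  compact : IsCompact M.Θ
  uniqueDiff : UniqueDiffOn ℝ M.Θ
  quasiconvex : ∃ C : ℝ≥0, ∀ a ∈ M.Θ, ∀ b ∈ M.Θ, ∃ γ : ℝ → EuclideanSpace ℝ (Fin d),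
    γ 0 = a ∧ γ 1 = b ∧ Set.MapsTo γ (Set.Icc 0 1) M.Θ ∧
      LipschitzOnWith (C * nndist a b) γ (Set.Icc 0 1)

/-- The true parameter is interior and is identified by the stationary law of the
observations. -/
def A1 (M : HMMFamily X d m) (π : M.Θ → Measure (X × EuclideanSpace ℝ (Fin m)))
    (θs : M.Θ) : Prop :=
  (θs : EuclideanSpace ℝ (Fin d)) ∈ interior M.Θ ∧
    ∀ θ : M.Θ, θ = θs ↔ M.obsLaw θ (π θ) = M.obsLaw θs (π θs)

/-- The densities are three times continuously differentiable in the parameter. -/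
def A2 (M : HMMFamily X d m) : Prop :=
  (∀ x x', ContDiffOn ℝ 3 (fun θ => M.q θ x x') M.Θ) ∧
    ∀ y ∈ M.𝒴, ∀ x, ContDiffOn ℝ 3 (fun θ => M.g θ y x) M.Θ

/-- The transition density is bounded above and away from zero, and the conditional density of
the observations is bounded above. -/
def A3 (M : HMMFamily X d m) : Prop :=
  ∃ c₁ C₁ : ℝ, 0 < c₁ ∧ 0 < C₁ ∧ ∀ θ ∈ M.Θ, ∀ x x', ∀ y ∈ M.𝒴,
    c₁ ≤ M.q θ x x' ∧ M.q θ x x' ≤ C₁ ∧ M.g θ y x ≤ C₁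

/-- The first two derivatives of `log q` in the parameter are bounded. -/
def A4 (M : HMMFamily X d m) : Prop :=
  ∃ C₂ : ℝ, 0 < C₂ ∧ ∀ θ ∈ M.Θ, ∀ x x',
    ‖iteratedFDerivWithin ℝ 1 (fun τ => Real.log (M.q τ x x')) M.Θ θ‖ ≤ C₂ ∧
      ‖iteratedFDerivWithin ℝ 2 (fun τ => Real.log (M.q τ x x')) M.Θ θ‖ ≤ C₂

/-- `0 < ∫ g_θ(y | x) μ(dx) < ∞`. -/
def A5 (M : HMMFamily X d m) : Prop :=
  ∀ θ ∈ M.Θ, ∀ y ∈ M.𝒴, Integrable (fun x => M.g θ y x) M.μ ∧ 0 < ∫ x, M.g θ y x ∂M.μ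

/-- For a random observation `Y` with law `L`, the random variable
`sup_θ sup_x sup_{y' ∈ 𝒴, |y' - Y| ≤ K} ‖∇_θ^j log g_θ(y' | x)‖` has a finite `p`-th moment. The
supremum need not be measurable, so this is expressed by a measurable upper bound; it extends
over the arguments for which `log g_θ(y' | x)` is defined. -/
def LogDerivMoment (M : HMMFamily X d m) (L : Measure (EuclideanSpace ℝ (Fin m)))
    (K : ℝ) (j p : ℕ) : Prop :=
  ∃ G : EuclideanSpace ℝ (Fin m) → ℝ≥0, Measurable G ∧
    ∫⁻ y, (G y : ℝ≥0∞) ^ p ∂L < ∞ ∧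
    ∀ᵐ y ∂L, ∀ θ ∈ M.Θ, ∀ x, ∀ y' ∈ M.𝒴, dist y' y ≤ K → 0 < M.g θ y' x →
      ‖iteratedFDerivWithin ℝ j (fun τ => Real.log (M.g τ y' x)) M.Θ θ‖ ≤ G y

/-- Moment bounds for the first three derivatives of `log g` in the parameter, with respect to
the stationary law of an observation under the true parameter. -/
def A6 (M : HMMFamily X d m) (π : M.Θ → Measure (X × EuclideanSpace ℝ (Fin m)))
    (θs : M.Θ) : Prop :=
  ∀ K : ℝ, 0 < K →
    M.LogDerivMoment ((π θs).map Prod.snd) K 1 3 ∧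
    M.LogDerivMoment ((π θs).map Prod.snd) K 2 2 ∧
    M.LogDerivMoment ((π θs).map Prod.snd) K 3 1

end HMMFamily

/-- The functions `F i`, their first derivatives and their second derivatives converge to those
of `f`, uniformly on `S`; all derivatives are taken relative to `S`. -/
def TendstoC2On {ι : Type*} {d : ℕ} (F : ι → EuclideanSpace ℝ (Fin d) → ℝ)
    (f : EuclideanSpace ℝ (Fin d) → ℝ) (l : Filter ι) (S : Set (EuclideanSpace ℝ (Fin d))) :
    Prop :=
  TendstoUniformlyOn F f l S ∧
    TendstoUniformlyOn (fun i => fderivWithin ℝ (F i) S) (fderivWithin ℝ f S) l S ∧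
    TendstoUniformlyOn (fun i => iteratedFDerivWithin ℝ 2 (F i) S)
      (iteratedFDerivWithin ℝ 2 f S) l S

end

/-! Let `iterInt μ K m j θ x` be the likelihood of the observations at times `j+1, …, j+m` given
`X_j = x`. Its logarithmic derivative obeys a backward recursion in the horizon `m`: the score over
`m+1` observations at `x` is the mean, under the conditional density of the next state given `x` and
these observations, of the one-step score plus the score over the remaining `m` observations. The
second derivative obeys the same recursion with an additional covariance of the scores.

Because `c₁ ≤ q ≤ C₁`, the conditional densities from different `x` are comparable with factor `α²`,
`α = c₁/C₁`, and extending the horizon beyond `b` further observations changes them by a relative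
amount of order `λ^(4b)`, where `1 - λ⁴ ≤ α²`. Doeblin contraction then bounds the oscillations in
`x`. It also shows that the increment (horizon `m+1` at time `j`) minus (horizon `m` at time `j+1`)
is bounded by a stationary variable `H`, and changes by at most `λ^b H` when any horizon beyond `b`
replaces `b`. This is `ForgettingArray`.

No lower bound on `g` is available. It is replaced by `Tame`: the first two derivatives of `f` are
bounded by multiples of `f` itself. Bounds on the derivatives of `log g` where `g > 0` imply it, and
it survives products and integrals, so the ball averages inherit the bounds of `g`. The random
constants are summed geometrically along the orbit; keeping squared oscillations makes a square
integrable first-order bound and an integrable second-order bound yield an integrable `H`.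

Telescoping writes the score as a sum of increments along the orbit, each replaced by its version
with fixed horizon `b`. The joint chain is minorized, so the one-sided shift is ergodic, and an
ergodic theorem uniform over the compact `Θ` gives the limits of both derivatives
(`Ergodic.exists_tendstoUniformlyOn_forgettingArray`). The normalized log-likelihood vanishes at
`θ*`, so the mean value inequality along paths of controlled length recovers its own limit from
those of its derivatives (`Regular.exists_limit`).

For `ε → 0`, the same `λ` and `H` serve all `ε ≤ 1`, so the derivatives of `l^ε` are within `λ^b ∫
H` of means of increments of horizon `b`, uniformly in `ε`. For fixed `b` these means converge by
domination by `H`, because `g^ε` and its derivatives converge at almost every observation by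
Lebesgue differentiation along balls (`Regular.ae_tendsto_gPert`). Joint convergence in `(ε, θ)` and
compactness give uniformity. -/

noncomputable section

set_option maxSynthPendingDepth 3

/-! ### The pointwise ergodic theorem -/

section Birkhoff

variable {Ω : Type*}

/-- The maximum of the Birkhoff sums `S_0, …, S_n`. -/
def birkhoffMax (T : Ω → Ω) (f : Ω → ℝ) : ℕ → Ω → ℝ
  | 0, _ => 0
  | n + 1, ω => max 0 (f ω + birkhoffMax T f n (T ω))

variable {T : Ω → Ω} {f : Ω → ℝ}

lemma birkhoffMax_nonneg (n : ℕ) (ω : Ω) : 0 ≤ birkhoffMax T f n ω := by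
  cases n with
  | zero => exact le_rfl
  | succ n => exact le_max_left _ _

lemma birkhoffMax_le_succ (n : ℕ) (ω : Ω) : birkhoffMax T f n ω ≤ birkhoffMax T f (n + 1) ω := by
  induction n generalizing ω with
  | zero => exact le_max_left _ _
  | succ n ih => exact max_le_max le_rfl (by gcongr; exact ih (T ω))

lemma birkhoffMax_mono (ω : Ω) : Monotone fun n => birkhoffMax T f n ω :=
  monotone_nat_of_le_succ fun n => birkhoffMax_le_succ n ω

lemma birkhoffSum_le_birkhoffMax (n : ℕ) (ω : Ω) : birkhoffSum T f n ω ≤ birkhoffMax T f n ω := by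
  induction n generalizing ω with
  | zero => simp [birkhoffMax]
  | succ n ih =>
    rw [birkhoffSum_succ']
    exact le_max_of_le_right (by gcongr; exact ih (T ω))

variable [MeasurableSpace Ω] {P : Measure Ω}

lemma measurable_birkhoffMax (hT : Measurable T) (hf : Measurable f) (n : ℕ) :
    Measurable (birkhoffMax T f n) := by
  induction n with
  | zero => exact measurable_const
  | succ n ih => exact measurable_const.max (hf.add (ih.comp hT))

lemma integrable_birkhoffMax (hT : MeasurePreserving T P P) [IsFiniteMeasure P]
    (hf : Integrable f P) (n : ℕ) : Integrable (birkhoffMax T f n) P := by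
  induction n with
  | zero => exact integrable_const 0
  | succ n ih =>
    exact (integrable_const 0).sup (hf.add (hT.integrable_comp_of_integrable ih))

/-- If `∫ f < 0` and `T` is ergodic then the Birkhoff sums of `f` are almost surely bounded
above. -/
lemma Ergodic.ae_bddAbove_birkhoffMax (hT : Ergodic T P) [IsProbabilityMeasure P]
    (hfm : Measurable f) (hf : Integrable f P) (hneg : ∫ ω, f ω ∂P < 0) :
    ∀ᵐ ω ∂P, ∃ N : ℕ, ∀ n, birkhoffMax T f n ω ≤ N := by
  -- Boundedness of the maxima is invariant under `T`, so it holds almost surely or almost never.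
  -- The second case is excluded below.
  set A : Set Ω := {ω | ∃ N : ℕ, ∀ n, birkhoffMax T f n ω ≤ N} with hA
  have hAm : MeasurableSet A := by
    rw [hA]
    simp only [Set.ofPred_exists, Set.ofPred_forall]
    exact MeasurableSet.iUnion fun N => MeasurableSet.iInter fun n =>
      measurableSet_le (measurable_birkhoffMax hT.measurable hfm n) measurable_const
  have hAT : T ⁻¹' A = A := by
    ext ω
    constructor
    · rintro ⟨N, hN⟩
      obtain ⟨N', hN'⟩ := exists_nat_ge (max 0 (f ω + N))
      refine ⟨N', fun n => (birkhoffMax_le_succ n ω).trans (le_trans ?_ hN')⟩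
      exact max_le_max le_rfl (by gcongr; exact hN n)
    · rintro ⟨N, hN⟩
      obtain ⟨N', hN'⟩ := exists_nat_ge (N - f ω)
      refine ⟨N', fun n => le_trans ?_ hN'⟩
      have := (le_max_right 0 (f ω + birkhoffMax T f n (T ω))).trans (hN (n + 1))
      linarith
  rcases hT.toPreErgodic.ae_mem_or_ae_notMem hAm hAT with h | h
  · exact h
  exfalso
  -- If the maxima are unbounded at `T ω`, then eventually `f ω` plus the maximum exceeds zero and
  -- the recursion gives exactly `f ω` for this difference. It is always dominated by `|f|`.
  have hlim : Tendsto (fun n => ∫ ω, (birkhoffMax T f (n + 1) ω - birkhoffMax T f n (T ω)) ∂P)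
      atTop (𝓝 (∫ ω, f ω ∂P)) := by
    refine tendsto_integral_of_dominated_convergence (fun ω => |f ω|) (fun n => ?_) hf.abs
      (fun n => .of_forall fun ω => ?_) ?_
    · exact ((measurable_birkhoffMax hT.measurable hfm _).sub
        ((measurable_birkhoffMax hT.measurable hfm _).comp hT.measurable)).aestronglyMeasurable
    · have h0 := birkhoffMax_nonneg (T := T) (f := f) n (T ω)
      rw [birkhoffMax, Real.norm_eq_abs]
      rcases max_cases 0 (f ω + birkhoffMax T f n (T ω)) with ⟨h1, h2⟩ | ⟨h1, h2⟩ <;> rw [h1]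
      · rw [abs_of_nonpos (by linarith)]
        have := neg_abs_le (f ω)
        linarith
      · rw [add_sub_cancel_right]
    · filter_upwards [h] with ω hω
      have hω' : T ω ∉ A := fun h => hω (hAT ▸ h)
      obtain ⟨n₀, hn₀⟩ : ∃ n₀, -f ω ≤ birkhoffMax T f n₀ (T ω) := by
        by_contra! hcon
        obtain ⟨N, hN⟩ := exists_nat_ge (-f ω)
        exact hω' ⟨N, fun n => (hcon n).le.trans hN⟩
      refine tendsto_const_nhds.congr' ?_
      filter_upwards [eventually_ge_atTop n₀] with n hn
      have := birkhoffMax_mono (T := T) (f := f) (T ω) hn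
      simp only at this
      rw [birkhoffMax, max_eq_right (by linarith)]
      ring
  -- By invariance of `P` the integrals in the limit equal `∫ (M_{n+1} - M_n) ≥ 0` for the maxima
  -- `M_n`, which contradicts `∫ f < 0`.
  refine hneg.not_ge (ge_of_tendsto' hlim fun n => ?_)
  have hi := integrable_birkhoffMax hT.toMeasurePreserving hf
  have hcomp : ∫ ω, birkhoffMax T f n (T ω) ∂P = ∫ ω, birkhoffMax T f n ω ∂P := by
    have := integral_map (μ := P) hT.measurable.aemeasurable
      (f := birkhoffMax T f n) (by rw [hT.map_eq]; exact (hi n).1)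
    rw [← this, hT.map_eq]
  have hi' : Integrable (fun ω => birkhoffMax T f n (T ω)) P :=
    hT.toMeasurePreserving.integrable_comp_of_integrable (hi n)
  rw [integral_sub (hi _) hi', hcomp,
    sub_nonneg]
  exact integral_mono (hi _) (hi _) fun ω => birkhoffMax_le_succ n ω

/-- Subtracting `∫ f + δ/2` makes the integral negative, so the centred sums stay below some `N`.
Division by `n ≥ 2N/δ` turns this bound into the other `δ/2`. -/
lemma Ergodic.ae_eventually_birkhoffSum_le (hT : Ergodic T P) [IsProbabilityMeasure P]
    (hfm : Measurable f) (hf : Integrable f P) (δ : ℝ) (hδ : 0 < δ) :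
    ∀ᵐ ω ∂P, ∀ᶠ n : ℕ in atTop, (1 / (n : ℝ)) * birkhoffSum T f n ω ≤ ∫ ω, f ω ∂P + δ := by
  set c := ∫ ω, f ω ∂P + δ / 2 with hc
  have hneg : ∫ ω, (f ω - c) ∂P < 0 := by
    rw [integral_sub hf (integrable_const c)]
    simp only [integral_const, probReal_univ, one_smul, hc]
    linarith
  filter_upwards [hT.ae_bddAbove_birkhoffMax (hfm.sub_const c) (hf.sub (integrable_const c)) hneg]
    with ω ⟨N, hN⟩
  obtain ⟨n₀, hn₀⟩ := exists_nat_ge (2 * N / δ)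
  filter_upwards [eventually_ge_atTop n₀, eventually_gt_atTop 0] with n hn hn0
  have hn' : (0 : ℝ) < n := by exact_mod_cast hn0
  have h1 := (birkhoffSum_le_birkhoffMax n ω).trans (hN n)
  have h2 : birkhoffSum T (fun ω => f ω - c) n ω = birkhoffSum T f n ω - n * c := by
    simp [birkhoffSum, Finset.sum_sub_distrib]
  rw [h2] at h1
  have h3 : 2 * N / δ ≤ n := hn₀.trans (by exact_mod_cast hn)
  rw [div_le_iff₀ hδ] at h3
  rw [one_div, inv_mul_le_iff₀ hn']
  have : c = ∫ ω, f ω ∂P + δ / 2 := hc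
  nlinarith

/-- The pointwise ergodic theorem for an ergodic transformation of a probability space. -/
theorem Ergodic.ae_tendsto_birkhoffSum (hT : Ergodic T P) [IsProbabilityMeasure P]
    (hf : Integrable f P) :
    ∀ᵐ ω ∂P, Tendsto (fun n : ℕ => (1 / (n : ℝ)) * birkhoffSum T f n ω) atTop
      (𝓝 (∫ ω, f ω ∂P)) := by
  wlog hfm : Measurable f generalizing f
  · obtain ⟨g, hg, hfg⟩ := hf.1.aemeasurable
    have h := this (hf.congr hfg) hg
    have hall : ∀ᵐ ω ∂P, ∀ k : ℕ, f (T^[k] ω) = g (T^[k] ω) :=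
      ae_all_iff.2 fun k =>
        (hT.toMeasurePreserving.iterate k).quasiMeasurePreserving.ae hfg
    filter_upwards [h, hall] with ω h1 h2
    rw [integral_congr_ae hfg]
    simpa [birkhoffSum, h2] using h1
  have hpos : ∀ k : ℕ, (0 : ℝ) < 1 / ((k : ℝ) + 1) := fun k => Nat.one_div_pos_of_nat
  have hup := ae_all_iff.2 fun k : ℕ =>
    hT.ae_eventually_birkhoffSum_le hfm hf (1 / ((k : ℝ) + 1)) (hpos k)
  have hlo := ae_all_iff.2 fun k : ℕ =>
    hT.ae_eventually_birkhoffSum_le hfm.neg hf.neg (1 / ((k : ℝ) + 1)) (hpos k)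
  filter_upwards [hup, hlo] with ω h1 h2
  rw [Metric.tendsto_nhds]
  intro δ hδ
  obtain ⟨k, hk⟩ := exists_nat_one_div_lt hδ
  filter_upwards [h1 k, h2 k] with n hn1 hn2
  have h3 : birkhoffSum T (-f) n ω = - birkhoffSum T f n ω := by
    simp [birkhoffSum]
  have h4 : ∫ ω, (-f) ω ∂P = - ∫ ω, f ω ∂P := integral_neg f
  rw [h3, h4, mul_neg] at hn2
  rw [Real.dist_eq, abs_lt]
  constructor <;> linarith

end Birkhoff

/-! ### Ergodicity of Markov chains with a minorized transition kernel -/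

namespace MarkovChain

variable {S : Type*}

/-- Append a point to a finite history. -/
def snoc (a : ℕ) (p : ((i : Finset.Iic a) → S) × S) : (i : Finset.Iic (a + 1)) → S :=
  fun i => if h : i.1 ≤ a then p.1 ⟨i.1, Finset.mem_Iic.2 h⟩ else p.2

lemma snoc_frestrictLe (a : ℕ) (ω : ℕ → S) :
    snoc a (Preorder.frestrictLe a ω, ω (a + 1)) = Preorder.frestrictLe (a + 1) ω := by
  funext i
  unfold snoc
  split_ifs with h
  · rfl
  · have := Finset.mem_Iic.1 i.2
    have h2 : i.1 = a + 1 := by omega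
    simp only [Preorder.frestrictLe_apply, h2]

variable [MeasurableSpace S]

/-- The kernels of the homogeneous chain with transition kernel `K`, as functions of the past. -/
def step (K : Kernel S S) (n : ℕ) : Kernel ((i : Finset.Iic n) → S) S :=
  K.comap (fun h => h ⟨n, Finset.mem_Iic.2 le_rfl⟩) (measurable_pi_apply _)

instance (K : Kernel S S) [IsMarkovKernel K] (n : ℕ) : IsMarkovKernel (step K n) := by
  unfold step; infer_instance

/-- The event `A` is determined by the coordinates up to time `a`. -/
def DeterminedBy (a : ℕ) (A : Set (ℕ → S)) : Prop :=
  ∃ U : Set ((i : Finset.Iic a) → S), MeasurableSet U ∧ A = Preorder.frestrictLe a ⁻¹' U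

lemma DeterminedBy.measurableSet {a : ℕ} {A : Set (ℕ → S)} (h : DeterminedBy a A) :
    MeasurableSet A := by
  obtain ⟨U, hU, rfl⟩ := h
  exact hU.preimage (Preorder.measurable_frestrictLe a)

lemma DeterminedBy.inter {a : ℕ} {A B : Set (ℕ → S)} (h : DeterminedBy a A)
    (h' : DeterminedBy a B) : DeterminedBy a (A ∩ B) := by
  obtain ⟨U, hU, rfl⟩ := h
  obtain ⟨V, hV, rfl⟩ := h'
  exact ⟨U ∩ V, hU.inter hV, rfl⟩

lemma DeterminedBy.mono {a b : ℕ} (hab : a ≤ b) {A : Set (ℕ → S)} (h : DeterminedBy a A) :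
    DeterminedBy b A := by
  obtain ⟨U, hU, rfl⟩ := h
  exact ⟨Preorder.frestrictLe₂ (π := fun _ => S) hab ⁻¹' U,
    hU.preimage (Preorder.measurable_frestrictLe₂ (X := fun _ => S) hab), rfl⟩

/-- The shift on the path space. -/
def shift (ω : ℕ → S) : ℕ → S := fun k => ω (k + 1)

omit [MeasurableSpace S] in
lemma shift_iterate (n k : ℕ) (ω : ℕ → S) : shift^[n] ω k = ω (k + n) := by
  induction n generalizing ω with
  | zero => rfl
  | succ n ih => rw [Function.iterate_succ_apply, ih, shift, add_assoc]

lemma measurable_shift : Measurable (shift : (ℕ → S) → ℕ → S) :=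
  measurable_pi_lambda _ fun _ => measurable_pi_apply _

lemma DeterminedBy.preimage_shift {a : ℕ} {A : Set (ℕ → S)} (h : DeterminedBy a A) :
    DeterminedBy (a + 1) (shift ⁻¹' A) := by
  obtain ⟨U, hU, rfl⟩ := h
  refine ⟨(fun (x : (i : Finset.Iic (a + 1)) → S) (i : Finset.Iic a) =>
    x ⟨i.1 + 1, by have := Finset.mem_Iic.1 i.2; exact Finset.mem_Iic.2 (by omega)⟩) ⁻¹' U,
    hU.preimage (measurable_pi_lambda _ fun _ => measurable_pi_apply _), rfl⟩

/-- From time `n` on, `Q` is the law of a Markov chain with transition kernel `K`. -/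
def IsChainFrom (K : Kernel S S) (n : ℕ) (Q : Measure (ℕ → S)) : Prop :=
  ∀ a, n ≤ a → ∀ A, DeterminedBy a A → ∀ V, MeasurableSet V →
    Q (A ∩ (fun ω => ω (a + 1)) ⁻¹' V) = ∫⁻ ω in A, K (ω a) V ∂Q

variable {K : Kernel S S}

lemma IsChainFrom.map_shift {n : ℕ} {Q : Measure (ℕ → S)} (h : IsChainFrom K (n + 1) Q) :
    IsChainFrom K n (Q.map shift) := by
  intro a ha A hA V hV
  rw [Measure.map_apply measurable_shift
    (hA.measurableSet.inter (hV.preimage (measurable_pi_apply _))),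
    setLIntegral_map (f := fun ω : ℕ → S => K (ω a) V) hA.measurableSet
      ((Kernel.measurable_coe K hV).comp (measurable_pi_apply a)) measurable_shift]
  exact h (a + 1) (by omega) _ hA.preimage_shift V hV

lemma IsChainFrom.mono {n m : ℕ} (hnm : n ≤ m) {Q : Measure (ℕ → S)} (h : IsChainFrom K n Q) :
    IsChainFrom K m Q := fun a ha => h a (hnm.trans ha)

lemma IsChainFrom.map_shift_iterate {n : ℕ} {Q : Measure (ℕ → S)} (h : IsChainFrom K n Q) :
    IsChainFrom K 0 (Q.map shift^[n]) := by
  induction n generalizing Q with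
  | zero => simpa using h
  | succ n ih =>
    have := ih h.map_shift
    rwa [Measure.map_map (measurable_shift.iterate n) measurable_shift,
      ← Function.iterate_succ] at this

/-- Conditioning on the past up to time `n` leaves the dynamics after `n` unchanged. This makes an
invariant event independent of the past in the proof of ergodicity. -/
lemma IsChainFrom.restrict {n : ℕ} {Q : Measure (ℕ → S)} (h : IsChainFrom K n Q)
    {B : Set (ℕ → S)} (hB : DeterminedBy n B) : IsChainFrom K n (Q.restrict B) := by
  intro a ha A hA V hV
  rw [Measure.restrict_apply (hA.measurableSet.inter (hV.preimage (measurable_pi_apply _))),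
    Measure.restrict_restrict hA.measurableSet, Set.inter_right_comm]
  exact h a ha _ (hA.inter (hB.mono ha)) V hV

lemma measurable_snoc (a : ℕ) : Measurable (snoc (S := S) a) := by
  refine measurable_pi_lambda _ fun i => ?_
  unfold snoc
  split_ifs
  · exact (measurable_pi_apply _).comp measurable_fst
  · exact measurable_snd

/-- A Markov chain law is determined by the transition kernel and the initial law. -/
lemma IsChainFrom.ext {Q Q' : Measure (ℕ → S)} [IsFiniteMeasure Q] [IsFiniteMeasure Q']
    (h : IsChainFrom K 0 Q) (h' : IsChainFrom K 0 Q')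
    (h0 : Q.map (fun ω => ω 0) = Q'.map (fun ω => ω 0)) : Q = Q' := by
  -- Induction on the length of the history: the Markov property prescribes the joint law of a
  -- history and the next state on rectangles.
  have hm : ∀ a, Q.map (Preorder.frestrictLe a) = Q'.map (Preorder.frestrictLe a) := by
    intro a
    induction a with
    | zero =>
      have : (Preorder.frestrictLe (π := fun _ => S) 0) =
          (fun (s : S) (_ : Finset.Iic 0) => s) ∘ fun ω : ℕ → S => ω 0 := by
        funext ω i
        have := Finset.mem_Iic.1 i.2
        have h2 : i.1 = 0 := by omega
        simp [Preorder.frestrictLe_apply, h2]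
      rw [this, ← Measure.map_map (by fun_prop) (by fun_prop), h0,
        Measure.map_map (by fun_prop) (by fun_prop)]
    | succ a ih =>
      have hmeas : Measurable fun ω : ℕ → S => (Preorder.frestrictLe (π := fun _ => S) a ω, ω (a + 1)) := by
        fun_prop
      have hpair : Q.map (fun ω => (Preorder.frestrictLe (π := fun _ => S) a ω, ω (a + 1))) =
          Q'.map (fun ω => (Preorder.frestrictLe (π := fun _ => S) a ω, ω (a + 1))) := by
        refine Measure.ext_prod fun {U V} hU hV => ?_
        rw [Measure.map_apply hmeas (hU.prod hV), Measure.map_apply hmeas (hU.prod hV)]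
        have e := h a (Nat.zero_le a) (Preorder.frestrictLe a ⁻¹' U) ⟨U, hU, rfl⟩ V hV
        have e' := h' a (Nat.zero_le a) (Preorder.frestrictLe a ⁻¹' U) ⟨U, hU, rfl⟩ V hV
        have hg : Measurable fun x : (i : Finset.Iic a) → S =>
            K (x ⟨a, Finset.mem_Iic.2 le_rfl⟩) V :=
          (Kernel.measurable_coe K hV).comp (measurable_pi_apply _)
        have k := setLIntegral_map (μ := Q) hU hg (Preorder.measurable_frestrictLe a)
        have k' := setLIntegral_map (μ := Q') hU hg (Preorder.measurable_frestrictLe a)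
        refine (e.trans ?_).trans e'.symm
        refine k.symm.trans (Eq.trans ?_ k')
        rw [ih]
      have hcomp : (Preorder.frestrictLe (π := fun _ => S) (a + 1)) = snoc a ∘ fun ω : ℕ → S =>
          (Preorder.frestrictLe (π := fun _ => S) a ω, ω (a + 1)) := by
        funext ω
        exact (snoc_frestrictLe a ω).symm
      rw [hcomp, ← Measure.map_map (measurable_snoc a) hmeas, hpair,
        Measure.map_map (measurable_snoc a) hmeas]
  refine IsProjectiveLimit.unique (α := fun _ => S) (P := fun I => Q'.map I.restrict) ?_ fun I => rfl
  intro I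
  let a := I.sup id
  have hI : I ⊆ Finset.Iic a := fun i hi => Finset.mem_Iic.2 (Finset.le_sup (f := id) hi)
  have : I.restrict (π := fun _ => S) =
      Finset.restrict₂ (π := fun _ => S) hI ∘ Preorder.frestrictLe a := rfl
  have hr := Finset.measurable_restrict₂ (X := fun _ => S) hI
  rw [this, ← Measure.map_map hr (by fun_prop), hm, Measure.map_map hr (by fun_prop)]
  rfl

lemma IsChainFrom.map_one {Q : Measure (ℕ → S)} (h : IsChainFrom K 0 Q) :
    Q.map (fun ω => ω 1) = (Q.map fun ω => ω 0).bind K := by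
  ext V hV
  have h0 := h 0 le_rfl Set.univ ⟨Set.univ, .univ, rfl⟩ V hV
  rw [Set.univ_inter, Measure.restrict_univ] at h0
  rw [Measure.map_apply (measurable_pi_apply _) hV, Measure.bind_apply hV (Kernel.aemeasurable _),
    lintegral_map (Kernel.measurable_coe K hV) (measurable_pi_apply _)]
  exact h0

variable [IsMarkovKernel K]

/-- The law of the chain started at `z`. -/
def pathKernel (K : Kernel S S) [IsMarkovKernel K] : Kernel S (ℕ → S) :=
  (Kernel.traj (X := fun _ => S) (step K) 0).comap (fun z _ => z) (by fun_prop)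

instance : IsMarkovKernel (pathKernel K) := by
  unfold pathKernel; infer_instance

lemma isChainFrom_traj (u : (i : Finset.Iic 0) → S) :
    IsChainFrom K 0 (Kernel.traj (X := fun _ => S) (step K) 0 u) := by
  rintro a - A ⟨U, hU, rfl⟩ V hV
  have h := Kernel.partialTraj_compProd_eq_map_traj (X := fun _ => S) (κ := step K)
    (Nat.zero_le a) (x₀ := u)
  have hmeas : Measurable fun ω : ℕ → S => (Preorder.frestrictLe (π := fun _ => S) a ω, ω (a + 1)) := by
    fun_prop
  have h1 : _ = _ := congrArg (fun m => m (U ×ˢ V)) h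
  rw [Measure.map_apply hmeas (hU.prod hV), Measure.compProd_apply_prod hU hV,
    ← Kernel.traj_map_frestrictLe_apply,
    setLIntegral_map hU (Kernel.measurable_coe _ hV) (by fun_prop)] at h1
  exact h1.symm

lemma pathKernel_map_zero (z : S) :
    (pathKernel K z).map (fun ω => ω 0) = Measure.dirac z := by
  have h := Kernel.traj_map_frestrictLe_apply (X := fun _ => S) (κ := step K) 0 0 (fun _ => z)
  have : (fun ω : ℕ → S => ω 0) = (fun u : (i : Finset.Iic 0) → S => u ⟨0, Finset.mem_Iic.2 le_rfl⟩) ∘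
    Preorder.frestrictLe (π := fun _ => S) 0 := rfl
  rw [this, ← Measure.map_map (by fun_prop) (by fun_prop), pathKernel, Kernel.comap_apply, h,
    Kernel.partialTraj_self, Kernel.id_apply,
    Measure.map_dirac' (by fun_prop)]

lemma isChainFrom_bind (ρ : Measure S) : IsChainFrom K 0 (ρ.bind (pathKernel K)) := by
  intro a ha A hA V hV
  rw [Measure.bind_apply (hA.measurableSet.inter (hV.preimage (measurable_pi_apply _)))
    (Kernel.aemeasurable _), ← lintegral_indicator hA.measurableSet,
    Measure.lintegral_bind (f := A.indicator fun ω => K (ω a) V) (Kernel.aemeasurable _)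
    (((Kernel.measurable_coe K hV).comp (measurable_pi_apply a)).indicator
      hA.measurableSet).aemeasurable]
  refine lintegral_congr fun z => ?_
  rw [lintegral_indicator hA.measurableSet]
  exact isChainFrom_traj (fun _ => z) a ha A hA V hV

lemma bind_pathKernel_map_zero (ρ : Measure S) :
    (ρ.bind (pathKernel K)).map (fun ω => ω 0) = ρ := by
  ext s hs
  have hm : Measurable fun ω : ℕ → S => ω 0 := measurable_pi_apply 0
  rw [Measure.map_apply hm hs, Measure.bind_apply (hs.preimage hm) (Kernel.aemeasurable _),
    ← lintegral_indicator_one hs]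
  refine lintegral_congr fun z => ?_
  rw [← Measure.map_apply hm hs, pathKernel_map_zero, Measure.dirac_apply' _ hs]

lemma trajMeasure_eq_bind (ρ : Measure S) :
    Kernel.trajMeasure (X := fun _ => S) ρ (step K) = ρ.bind (pathKernel K) := by
  ext s hs
  rw [Kernel.trajMeasure, Measure.bind_apply hs (Kernel.aemeasurable _),
    Measure.bind_apply hs (Kernel.aemeasurable _),
    lintegral_map (Kernel.measurable_coe _ hs) (by fun_prop)]
  rfl

/-- Applied to shifted and restricted path laws, which are chain laws with other initial measures,
possibly of mass different from one. -/
lemma IsChainFrom.eq_bind {Q : Measure (ℕ → S)} [IsFiniteMeasure Q] (h : IsChainFrom K 0 Q) :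
    Q = (Q.map fun ω => ω 0).bind (pathKernel K) :=
  h.ext (isChainFrom_bind _) (bind_pathKernel_map_zero _).symm

/-- The path law of a chain started from an invariant distribution is shift invariant. -/
lemma measurePreserving_shift {ρ : Measure S} [IsProbabilityMeasure ρ] (hρ : K.Invariant ρ) :
    MeasurePreserving shift (ρ.bind (pathKernel K)) (ρ.bind (pathKernel K)) := by
  refine ⟨measurable_shift, ?_⟩
  have h := isChainFrom_bind (K := K) ρ
  refine (h.mono (Nat.zero_le 1)).map_shift.ext h ?_
  rw [Measure.map_map (measurable_pi_apply 0) measurable_shift]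
  have : (fun ω : ℕ → S => ω 0) ∘ shift = fun ω => ω 1 := rfl
  rw [this, h.map_one, bind_pathKernel_map_zero]
  exact hρ

/-- A bounded function that is harmonic for a minorized kernel is constant. -/
lemma eq_iInf_of_harmonic {α : ℝ≥0∞} (hα : α ≠ 0) (hK : ∀ z z', α • K z' ≤ K z)
    {φ : S → ℝ≥0∞} (hle : ∀ z, φ z ≤ 1) (hh : ∀ z, ∫⁻ z', φ z' ∂K z = φ z)
    (z' : S) : φ z' = ⨅ z, φ z := by
  obtain ⟨lo, hlo⟩ : ∃ lo, lo = ⨅ z, φ z := ⟨_, rfl⟩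
  have hle' : ∀ z, lo ≤ φ z := fun z => hlo ▸ iInf_le φ z
  rw [← hlo]
  have hlo1 : lo ≠ ∞ := ((hle' z').trans (hle z')).trans_lt ENNReal.one_lt_top |>.ne
  have hsub : ∀ z, ∫⁻ w, (φ w - lo) ∂K z = φ z - lo := fun z => by
    rw [lintegral_sub measurable_const (by simpa using hlo1)
      (.of_forall hle'), hh]
    simp
  -- Harmonicity writes both excesses over the infimum as integrals, and the minorization compares
  -- them. Taking the infimum over `z` then forces `φ z' = lo`.
  have key : ∀ z, α * (φ z' - lo) ≤ φ z - lo := fun z => by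
    rw [← hsub z, ← hsub z', ← smul_eq_mul, ← lintegral_smul_measure]
    exact lintegral_mono' (hK z z') le_rfl
  have h0 : α * (φ z' - lo) = 0 := by
    refine le_antisymm ?_ zero_le
    have h1 : lo + α * (φ z' - lo) ≤ lo := by
      conv_rhs => rw [hlo]
      refine le_iInf fun z => ?_
      calc lo + α * (φ z' - lo) ≤ lo + (φ z - lo) := by gcongr; exact key z
        _ = φ z := add_tsub_cancel_of_le (hle' z)
    exact (ENNReal.add_le_add_iff_left hlo1).1 (by simpa using h1)
  exact le_antisymm (tsub_eq_zero_iff_le.1 ((mul_eq_zero.1 h0).resolve_left hα)) (hle' z')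

/-- The shift is ergodic for the stationary path law of a chain with minorized kernel. -/
theorem ergodic_shift {ρ : Measure S} [IsProbabilityMeasure ρ] (hρ : K.Invariant ρ)
    {α : ℝ≥0∞} (hα : α ≠ 0) (hK : ∀ z z', α • K z' ≤ K z) :
    Ergodic shift (ρ.bind (pathKernel K)) := by
  set P := ρ.bind (pathKernel K) with hP
  have hPc : IsChainFrom K 0 P := isChainFrom_bind ρ
  refine ⟨measurePreserving_shift hρ, ⟨fun A hA hAT => ?_⟩⟩
  have hm0 : Measurable fun ω : ℕ → S => ω 0 := measurable_pi_apply 0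
  set c := ⨅ z, pathKernel K z A with hc
  -- For a shift invariant `A` the probability of `A` as a function of the starting point is
  -- harmonic: run one step, then restart the chain.
  have hconst : ∀ z, pathKernel K z A = c := by
    refine eq_iInf_of_harmonic hα hK (fun z => prob_le_one)
      fun z => ?_
    have h1 : IsChainFrom K 0 (pathKernel K z) := isChainFrom_traj _
    have h2 := (h1.mono (Nat.zero_le 1)).map_shift
    have h3 := h2.eq_bind
    rw [Measure.map_map hm0 measurable_shift] at h3
    have h4 : (fun ω : ℕ → S => ω 0) ∘ shift = fun ω => ω 1 := rfl
    rw [h4, h1.map_one, pathKernel_map_zero, Measure.dirac_bind (Kernel.measurable _)] at h3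
    rw [← Measure.bind_apply hA (Kernel.aemeasurable _), ← h3,
      Measure.map_apply measurable_shift hA, hAT]
  have hval : ∀ Q : Measure (ℕ → S), IsFiniteMeasure Q → IsChainFrom K 0 Q →
      Q A = c * Q Set.univ := fun Q _ hQ => by
    conv_lhs => rw [hQ.eq_bind]
    rw [Measure.bind_apply hA (Kernel.aemeasurable _)]
    simp only [hconst, lintegral_const]
    rw [Measure.map_apply hm0 .univ, Set.preimage_univ]
  have hiter : ∀ n, shift^[n] ⁻¹' A = A := fun n => by
    induction n with
    | zero => rfl
    | succ n ih => rw [Function.iterate_succ, Set.preimage_comp, ih, hAT]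
  -- `A` can be read off from the path after time `n`, which under the restriction to `B` is again a
  -- chain, with initial mass `P B`.
  have hmul : ∀ n B, DeterminedBy n B → P (A ∩ B) = c * P B := fun n B hB => by
    have h1 := hval _ inferInstance ((hPc.mono (Nat.zero_le n)).restrict hB).map_shift_iterate
    rwa [Measure.map_apply (measurable_shift.iterate n) hA, hiter,
      Measure.map_apply (measurable_shift.iterate n) .univ, Set.preimage_univ,
      Measure.restrict_apply hA, Measure.restrict_apply .univ, Set.univ_inter] at h1
  have hc1 : c ≤ 1 := by
    obtain ⟨z⟩ : Nonempty S := nonempty_of_isProbabilityMeasure ρ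
    exact (iInf_le _ z).trans prob_le_one
  -- `A` is independent of all cylinders, hence of every event. Evaluation at `Aᶜ` gives `c * P Aᶜ =
  -- 0`, which is the zero-one law.
  have hind : P.restrict A = c • P := by
    have : IsFiniteMeasure (c • P) := ⟨by
      rw [Measure.smul_apply, smul_eq_mul]
      exact ENNReal.mul_lt_top (hc1.trans_lt ENNReal.one_lt_top) (measure_lt_top _ _)⟩
    refine IsProjectiveLimit.unique (α := fun _ => S)
      (P := fun I => (c • P).map I.restrict) ?_ fun I => rfl
    intro I
    ext U hU
    have hr : Measurable (I.restrict (π := fun _ => S)) := by fun_prop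
    rw [Measure.map_apply hr hU, Measure.map_apply hr hU, Measure.restrict_apply (hU.preimage hr),
      Measure.smul_apply, smul_eq_mul, Set.inter_comm]
    let a := I.sup id
    have hI : I ⊆ Finset.Iic a := fun i hi => Finset.mem_Iic.2 (Finset.le_sup (f := id) hi)
    exact hmul a _ ⟨Finset.restrict₂ (π := fun _ => S) hI ⁻¹' U,
      hU.preimage (Finset.measurable_restrict₂ (X := fun _ => S) hI), rfl⟩
  have h1 : c * P Aᶜ = 0 := by
    have := congrArg (fun m => m Aᶜ) hind
    simp only [Measure.restrict_apply hA.compl, Set.compl_inter_self, measure_empty,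
      Measure.smul_apply, smul_eq_mul] at this
    exact this.symm
  have h2 : P A = c * P Set.univ := hval P inferInstance hPc
  rw [eventuallyConst_set']
  rcases mul_eq_zero.1 h1 with h | h
  · left
    rw [h, zero_mul] at h2
    exact ae_eq_empty.2 h2
  · right
    exact ae_eq_univ.2 h

end MarkovChain

/-! ### Calculus relative to a quasiconvex set -/

/-- Any two points `a`, `b` of `S` can be joined inside `S` by a path of length at most
`C |a - b|`. -/
def QuasiconvexWith {E : Type*} [NormedAddCommGroup E] (C : ℝ≥0) (S : Set E) : Prop :=
  ∀ a ∈ S, ∀ b ∈ S, ∃ γ : ℝ → E, γ 0 = a ∧ γ 1 = b ∧ Set.MapsTo γ (Set.Icc 0 1) S ∧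
    LipschitzOnWith (C * nndist a b) γ (Set.Icc 0 1)

section Calculus

variable {E F : Type*} [NormedAddCommGroup E] [NormedSpace ℝ E] [NormedAddCommGroup F]
  [NormedSpace ℝ F] {S : Set E} {C : ℝ≥0}

/-- The increments along a Lipschitz path of a function that is differentiable relative to a set
containing the path. -/
lemma eventually_norm_sub_le_of_lipschitz_path {f : E → F} {L : ℝ≥0} {γ : ℝ → E}
    (hγ : Set.MapsTo γ (Set.Icc 0 1) S) (hL : LipschitzOnWith L γ (Set.Icc 0 1)) {t : ℝ}
    (ht : t ∈ Set.Ico (0 : ℝ) 1) {f' : E →L[ℝ] F} (hf : HasFDerivWithinAt f f' S (γ t)) {r : ℝ}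
    (hr : ‖f'‖ * L < r) : ∀ᶠ z in 𝓝[>] t, ‖f (γ z) - f (γ t)‖ < r * (z - t) := by
  have hI : Set.Icc (0 : ℝ) 1 ∈ 𝓝[>] t :=
    mem_of_superset (Ioc_mem_nhdsGT ht.2) fun z hz => ⟨ht.1.trans hz.1.le, hz.2⟩
  have htI : t ∈ Set.Icc (0 : ℝ) 1 := ⟨ht.1, ht.2.le⟩
  have hlim : Tendsto γ (𝓝[>] t) (𝓝[S] (γ t)) := by
    refine tendsto_nhdsWithin_iff.2 ⟨?_, mem_of_superset hI fun z hz => hγ hz⟩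
    have := (hL.continuousOn t htI).mono_left (nhdsWithin_le_of_mem hI)
    exact this
  -- The slack in `‖f'‖ * L < r` absorbs the remainder of the first order expansion.
  obtain ⟨η, hη, hηr⟩ : ∃ η : ℝ, 0 < η ∧ (‖f'‖ + η) * L < r := by
    refine ⟨(r - ‖f'‖ * L) / (L + 1), by have := sub_pos.2 hr; positivity, ?_⟩
    have h1 : (r - ‖f'‖ * L) / (L + 1) * L < r - ‖f'‖ * L := by
      rw [div_mul_eq_mul_div, div_lt_iff₀ (by positivity)]
      have := sub_pos.2 hr
      nlinarith
    linarith
  have h1 := hlim.eventually ((hasFDerivWithinAt_iff_isLittleO.1 hf).bound hη)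
  filter_upwards [h1, hI, self_mem_nhdsWithin] with z hz hzI hzt
  have hzt' : 0 < z - t := sub_pos.2 hzt
  have h2 : ‖γ z - γ t‖ ≤ L * (z - t) := by
    have := hL.dist_le_mul z hzI t htI
    rwa [dist_eq_norm, Real.dist_eq, abs_of_pos hzt'] at this
  calc ‖f (γ z) - f (γ t)‖
      ≤ ‖f (γ z) - f (γ t) - f' (γ z - γ t)‖ + ‖f' (γ z - γ t)‖ := by
        simpa using norm_add_le (f (γ z) - f (γ t) - f' (γ z - γ t)) (f' (γ z - γ t))
    _ ≤ η * ‖γ z - γ t‖ + ‖f'‖ * ‖γ z - γ t‖ := add_le_add hz (f'.le_opNorm _)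
    _ = (‖f'‖ + η) * ‖γ z - γ t‖ := by ring
    _ ≤ (‖f'‖ + η) * (L * (z - t)) := by gcongr
    _ < r * (z - t) := by
        rw [← mul_assoc]
        exact mul_lt_mul_of_pos_right hηr hzt'

/-- The mean value inequality on a quasiconvex set. -/
theorem QuasiconvexWith.norm_image_sub_le (hS : QuasiconvexWith C S) {f : E → F} {f' : E → E →L[ℝ] F}
    (hf : ∀ x ∈ S, HasFDerivWithinAt f (f' x) S x) {B : ℝ} (hB : ∀ x ∈ S, ‖f' x‖ ≤ B)
    {a b : E} (ha : a ∈ S) (hb : b ∈ S) : ‖f b - f a‖ ≤ C * B * ‖b - a‖ := by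
  obtain ⟨γ, h0, h1, hγ, hL⟩ := hS a ha b hb
  set L : ℝ≥0 := C * nndist a b with hLdef
  have hcont : ContinuousOn (fun t => f (γ t)) (Set.Icc 0 1) := fun t ht =>
    (hf _ (hγ ht)).continuousWithinAt.comp (hL.continuousOn t ht) hγ
  -- The path is merely Lipschitz, so `f ∘ γ` need not be differentiable. Grönwall's inequality with
  -- growth rate zero needs only a bound on right difference quotients.
  have key := le_gronwallBound_of_liminf_deriv_right_le
    (f := fun t => ‖f (γ t) - f (γ 0)‖) (f' := fun _ => B * L) (δ := 0) (K := 0) (ε := B * L)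
    (a := 0) (b := 1) (hcont.sub continuousOn_const).norm
    (fun t ht r hr => Eventually.frequently ?_) (by simp) (fun t _ => by simp) 1 (by simp)
  · rw [gronwallBound_K0, h0, h1] at key
    have : (L : ℝ) = C * ‖b - a‖ := by
      rw [hLdef, NNReal.coe_mul, coe_nndist, dist_eq_norm, norm_sub_rev]
    simp only [this] at key
    calc _ ≤ _ := key
      _ = _ := by ring
  · have htI : t ∈ Set.Icc (0 : ℝ) 1 := ⟨ht.1, ht.2.le⟩
    have hr' : ‖f' (γ t)‖ * L < r :=
      (mul_le_mul_of_nonneg_right (hB _ (hγ htI)) L.2).trans_lt hr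
    filter_upwards [eventually_norm_sub_le_of_lipschitz_path hγ hL ht (hf _ (hγ htI)) hr',
      self_mem_nhdsWithin] with z hz hzt
    rw [inv_mul_lt_iff₀ (sub_pos.2 hzt), mul_comm]
    refine lt_of_le_of_lt ?_ hz
    have := norm_sub_norm_le (f (γ z) - f (γ 0)) (f (γ t) - f (γ 0))
    rwa [sub_sub_sub_cancel_right] at this

/-- If `‖Df‖ ≤ G ‖f‖` on a quasiconvex set then `f` vanishes identically as soon as it has a
zero. -/
theorem QuasiconvexWith.eq_zero_of_norm_deriv_le (hS : QuasiconvexWith C S) {f : E → F}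
    {f' : E → E →L[ℝ] F} (hf : ∀ x ∈ S, HasFDerivWithinAt f (f' x) S x) {G : ℝ}
    (hG : ∀ x ∈ S, ‖f' x‖ ≤ G * ‖f x‖) {a b : E} (ha : a ∈ S) (hb : b ∈ S) (h : f a = 0) :
    f b = 0 := by
  obtain ⟨γ, h0, h1, hγ, hL⟩ := hS a ha b hb
  set L : ℝ≥0 := C * nndist a b with hLdef
  have hcont : ContinuousOn (fun t => f (γ t)) (Set.Icc 0 1) := fun t ht =>
    (hf _ (hγ ht)).continuousWithinAt.comp (hL.continuousOn t ht) hγ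
  -- Now the growth rate is `G * L` and the initial value is zero, so the Grönwall bound vanishes.
  have key := le_gronwallBound_of_liminf_deriv_right_le
    (f := fun t => ‖f (γ t)‖) (f' := fun t => ‖f' (γ t)‖ * L) (δ := 0) (K := G * L) (ε := 0)
    (a := 0) (b := 1) hcont.norm
    (fun t ht r hr => Eventually.frequently ?_) (by simp [h0, h]) (fun t ht => ?_) 1 (by simp)
  · rw [gronwallBound_ε0_δ0, h1] at key
    exact norm_le_zero_iff.1 key
  · have htI : t ∈ Set.Icc (0 : ℝ) 1 := ⟨ht.1, ht.2.le⟩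
    filter_upwards [eventually_norm_sub_le_of_lipschitz_path hγ hL ht (hf _ (hγ htI)) hr,
      self_mem_nhdsWithin] with z hz hzt
    rw [inv_mul_lt_iff₀ (sub_pos.2 hzt), mul_comm]
    exact (norm_sub_norm_le _ _).trans_lt hz
  · have htI : t ∈ Set.Icc (0 : ℝ) 1 := ⟨ht.1, ht.2.le⟩
    have := mul_le_mul_of_nonneg_right (hG _ (hγ htI)) L.2
    simp only [NNReal.val_eq_coe] at this
    linarith

/-- Exchange of limit and derivative relative to a quasiconvex set. -/
theorem QuasiconvexWith.hasFDerivWithinAt_of_tendsto (hS : QuasiconvexWith C S) {ι : Type*}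
    {l : Filter ι} [l.NeBot] {f : ι → E → F} {f' : ι → E → E →L[ℝ] F} {g : E → F}
    {g' : E → E →L[ℝ] F} (hf : ∀ i, ∀ x ∈ S, HasFDerivWithinAt (f i) (f' i x) S x)
    (hf' : TendstoUniformlyOn f' g' l S) (hfg : ∀ x ∈ S, Tendsto (fun i => f i x) l (𝓝 (g x)))
    {a : E} (ha : a ∈ S) : HasFDerivWithinAt g (g' a) S a := by
  rw [hasFDerivWithinAt_iff_isLittleO, Asymptotics.isLittleO_iff]
  intro c hc
  -- The share `2C` pays for the increment of `g - f i`; the other two for the expansion of `f i`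
  -- and for `g' - f' i` at `a`.
  obtain ⟨η, hη, hηc⟩ : ∃ η : ℝ, 0 < η ∧ (2 * C + 2) * η ≤ c :=
    ⟨c / (2 * C + 2), by positivity, by rw [mul_div_cancel₀]; positivity⟩
  have hev : ∀ᶠ i in l, ∀ x ∈ S, ‖g' x - f' i x‖ < η := by
    simpa [dist_eq_norm] using Metric.tendstoUniformlyOn_iff.1 hf' η hη
  obtain ⟨i, hi⟩ := hev.exists
  -- The mean value inequality is applied to `f j - f i`, and then `j` passes to the limit.
  have hdiff : ∀ b ∈ S, ‖(g b - f i b) - (g a - f i a)‖ ≤ C * (2 * η) * ‖b - a‖ := fun b hb => by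
    refine le_of_tendsto (((hfg b hb).sub_const _).sub ((hfg a ha).sub_const _)).norm ?_
    filter_upwards [hev] with j hj
    refine hS.norm_image_sub_le (f := fun x => f j x - f i x) (f' := fun x => f' j x - f' i x)
      (fun x hx => (hf j x hx).sub (hf i x hx)) (fun x hx => ?_) ha hb
    calc ‖f' j x - f' i x‖ = ‖(g' x - f' i x) - (g' x - f' j x)‖ := by congr 1; abel
      _ ≤ η + η := (norm_sub_le _ _).trans (add_le_add (hi x hx).le (hj x hx).le)
      _ = 2 * η := by ring
  filter_upwards [(hasFDerivWithinAt_iff_isLittleO.1 (hf i a ha)).bound hη, self_mem_nhdsWithin]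
    with b hb hbS
  have h1 := hdiff b hbS
  have h2 : ‖(g' a - f' i a) (b - a)‖ ≤ η * ‖b - a‖ :=
    ((g' a - f' i a).le_opNorm _).trans (by gcongr; exact (hi a ha).le)
  calc ‖g b - g a - g' a (b - a)‖
      = ‖((g b - f i b) - (g a - f i a)) + (f i b - f i a - f' i a (b - a))
          - (g' a - f' i a) (b - a)‖ := by
        congr 1; simp only [_root_.sub_apply]; abel
    _ ≤ (C * (2 * η) * ‖b - a‖ + η * ‖b - a‖) + η * ‖b - a‖ :=
        (norm_sub_le _ _).trans (add_le_add ((norm_add_le _ _).trans (add_le_add h1 hb)) h2)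
    _ = (2 * C + 2) * η * ‖b - a‖ := by ring
    _ ≤ c * ‖b - a‖ := by gcongr

/-- Uniform convergence of the derivatives, together with convergence at one point, gives uniform
convergence on a bounded quasiconvex set. -/
theorem QuasiconvexWith.tendstoUniformlyOn_of_deriv (hS : QuasiconvexWith C S)
    (hbdd : Bornology.IsBounded S) {ι : Type*}
    {l : Filter ι} {f : ι → E → F} {f' : ι → E → E →L[ℝ] F} {g : E → F}
    {g' : E → E →L[ℝ] F} (hf : ∀ᶠ i in l, ∀ x ∈ S, HasFDerivWithinAt (f i) (f' i x) S x)
    (hg : ∀ x ∈ S, HasFDerivWithinAt g (g' x) S x)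
    (hf' : TendstoUniformlyOn f' g' l S) {a : E} (ha : a ∈ S) (hfg : ∀ᶠ i in l, f i a = g a) :
    TendstoUniformlyOn f g l S := by
  obtain ⟨R, hR0, hR⟩ : ∃ R : ℝ, 0 < R ∧ ∀ x ∈ S, ‖x - a‖ ≤ R := by
    obtain ⟨R, hR⟩ := (Metric.isBounded_iff_subset_closedBall a).1 hbdd
    exact ⟨max R 1, by positivity, fun x hx =>
      (mem_closedBall_iff_norm.1 (hR hx)).trans (le_max_left _ _)⟩
  rw [Metric.tendstoUniformlyOn_iff] at hf' ⊢
  intro δ hδ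
  -- `C + 1` in place of `C` keeps the denominator positive when `C = 0`.
  have hη : 0 < δ / (2 * (C + 1) * R) := by positivity
  filter_upwards [hf, hfg, hf' _ hη] with i h1 h2 h3 x hx
  have h4 := hS.norm_image_sub_le (f := fun x => g x - f i x) (f' := fun x => g' x - f' i x)
    (fun x hx => (hg x hx).sub (h1 x hx))
    (fun x hx => by simpa [dist_eq_norm] using (h3 x hx).le) ha hx
  simp only [h2, sub_self, sub_zero] at h4
  rw [dist_eq_norm]
  calc _ ≤ _ := h4
    _ ≤ (C + 1) * (δ / (2 * (C + 1) * R)) * R := by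
        gcongr
        · linarith
        · exact hR x hx
    _ = δ / 2 := by field_simp
    _ < δ := by linarith

/-- Differentiation under the integral sign relative to a quasiconvex set. -/
theorem QuasiconvexWith.hasFDerivWithinAt_integral (hS : QuasiconvexWith C S) {Z : Type*}
    [MeasurableSpace Z] {μ : Measure Z} {f : E → Z → F} {f' : E → Z → E →L[ℝ] F} {a : E}
    (ha : a ∈ S) (hfm : ∀ θ ∈ S, AEStronglyMeasurable (f θ) μ)
    (hfi : ∀ θ ∈ S, Integrable (f θ) μ) (hf'm : AEStronglyMeasurable (f' a) μ)
    (hd : ∀ᵐ z ∂μ, ∀ θ ∈ S, HasFDerivWithinAt (fun τ => f τ z) (f' θ z) S θ)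
    {B : Z → ℝ} (hB : ∀ᵐ z ∂μ, ∀ θ ∈ S, ‖f' θ z‖ ≤ B z) (hBi : Integrable B μ) :
    HasFDerivWithinAt (fun θ => ∫ z, f θ z ∂μ) (∫ z, f' a z ∂μ) S a := by
  have hf'i : Integrable (f' a) μ := hBi.mono' hf'm (hB.mono fun z hz => hz a ha)
  rw [hasFDerivWithinAt_iff_tendsto]
  have hev : ∀ᶠ b in 𝓝[S] a, b ∈ S := self_mem_nhdsWithin
  refine squeeze_zero' (g := fun b => ∫ z, ‖b - a‖⁻¹ * ‖f b z - f a z - f' a z (b - a)‖ ∂μ)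
    (.of_forall fun b => by positivity) ?_ ?_
  · filter_upwards [hev] with b hb
    rw [integral_const_mul]
    gcongr
    have hi : Integrable (fun z => f' a z (b - a)) μ := hf'i.apply_continuousLinearMap _
    have hi2 : Integrable (fun z => f b z - f a z) μ := (hfi b hb).sub (hfi a ha)
    rw [ContinuousLinearMap.integral_apply hf'i, ← integral_sub (hfi b hb) (hfi a ha),
      ← integral_sub hi2 hi]
    exact norm_integral_le_integral_norm _
  · rw [← integral_zero Z ℝ (μ := μ)]
    -- The difference quotient of the remainder is dominated by `C * B`, from the mean value
    -- inequality, plus `B`, from the linear term.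
    refine tendsto_integral_filter_of_dominated_convergence (fun z => (C + 1) * B z) ?_ ?_
      (hBi.const_mul _) ?_
    · filter_upwards [hev] with b hb
      exact ((((hfm b hb).sub (hfm a ha)).sub
        (hf'm.apply_continuousLinearMap _)).norm).const_mul _
    · filter_upwards [hev] with b hb
      filter_upwards [hB, hd] with z hz hdz
      rw [norm_mul, norm_inv, norm_norm, norm_norm]
      have hB0 : 0 ≤ B z := (norm_nonneg _).trans (hz a ha)
      by_cases hba : ‖b - a‖ = 0
      · rw [hba, inv_zero, zero_mul]
        positivity
      have h1 := hS.norm_image_sub_le hdz hz ha hb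
      have h2 : ‖f' a z (b - a)‖ ≤ B z * ‖b - a‖ :=
        ((f' a z).le_opNorm _).trans (by gcongr; exact hz a ha)
      have h3 := (norm_sub_le (f b z - f a z) (f' a z (b - a))).trans (add_le_add h1 h2)
      rw [inv_mul_le_iff₀ (lt_of_le_of_ne (norm_nonneg _) (Ne.symm hba))]
      linarith
    · filter_upwards [hd] with z hz
      exact hasFDerivWithinAt_iff_tendsto.1 (hz a ha)

/-- Derivatives relative to `S` of a family of measurable functions are measurable. -/
theorem aestronglyMeasurable_fderivWithin [FiniteDimensional ℝ E] {Z : Type*} [MeasurableSpace Z]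
    {μ : Measure Z} {f : E → Z → F} {a : E} (hu : UniqueDiffWithinAt ℝ S a) (ha : a ∈ S)
    (hfm : ∀ θ ∈ S, AEStronglyMeasurable (f θ) μ)
    (hd : ∀ᵐ z ∂μ, DifferentiableWithinAt ℝ (fun τ => f τ z) S a) :
    AEStronglyMeasurable (fun z => fderivWithin ℝ (fun τ => f τ z) S a) μ := by
  set D : Z → E →L[ℝ] F := fun z => fderivWithin ℝ (fun τ => f τ z) S a with hD
  -- In a tangent direction the derivative is a limit of difference quotients between points of `S`,
  -- hence measurable in `z`.
  have hcone : ∀ u ∈ tangentConeAt ℝ S a, AEStronglyMeasurable (fun z => D z u) μ := by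
    intro u hu'
    obtain ⟨c, e, he0, heS, hce⟩ := mem_tangentConeAt_iff_exists_seq.1 hu'
    obtain ⟨N, hN⟩ := eventually_atTop.1 heS
    refine aestronglyMeasurable_of_tendsto_ae atTop
      (f := fun n z => c (n + N) • (f (a + e (n + N)) z - f a z)) (fun n => ?_) ?_
    · exact ((hfm _ (hN _ (Nat.le_add_left _ _))).sub (hfm _ ha)).const_smul _
    · filter_upwards [hd] with z hz
      exact (hz.hasFDerivWithinAt.lim he0 heS hce).comp (tendsto_add_atTop_nat N)
  -- The directions with measurable derivative form a subspace, closed because the dimension is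
  -- finite. It contains the tangent cone, whose span is dense by unique differentiability.
  let M : Submodule ℝ E :=
    { carrier := {u | AEStronglyMeasurable (fun z => D z u) μ}
      add_mem' := fun {u v} h1 h2 => by
        simp only [Set.mem_ofPred, map_add] at *
        exact h1.add h2
      zero_mem' := by simpa using aestronglyMeasurable_const
      smul_mem' := fun c u h => by
        simp only [Set.mem_ofPred, map_smul] at *
        exact h.const_smul c }
  have hM : M = ⊤ := by
    rw [eq_top_iff]
    intro u _
    have h1 : Submodule.span ℝ (tangentConeAt ℝ S a) ≤ M := Submodule.span_le.2 hcone
    have h2 : closure (M : Set E) = M := M.closed_of_finiteDimensional.closure_eq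
    have h3 := (hu.dense_tangentConeAt.mono h1) u
    rwa [h2] at h3
  have hall : ∀ u, AEStronglyMeasurable (fun z => D z u) μ := fun u => by
    have : u ∈ M := hM ▸ Submodule.mem_top
    exact this
  let b := Module.finBasis ℝ E
  have hrep : D = fun z => ∑ i, ContinuousLinearMap.smulRightL ℝ E F
      (LinearMap.toContinuousLinearMap (b.coord i)) (D z (b i)) := by
    funext z
    ext u
    conv_lhs => rw [← b.sum_repr u, map_sum]
    simp
  rw [hrep]
  refine Finset.aestronglyMeasurable_fun_sum _ fun i _ => ?_
  exact (ContinuousLinearMap.continuous _).comp_aestronglyMeasurable (hall (b i))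

end Calculus

/-! ### Second derivatives relative to a set, and functions that dominate their derivatives -/

section SecondOrder

variable {E : Type*} [NormedAddCommGroup E] [NormedSpace ℝ E] {S : Set E} {C : ℝ≥0}

/-- The second derivative relative to `S`. -/
def fderivWithin₂ (f : E → ℝ) (S : Set E) (θ : E) : E →L[ℝ] E →L[ℝ] ℝ :=
  fderivWithin ℝ (fderivWithin ℝ f S) S θ

variable {f g : E → ℝ} {θ : E}

lemma contDiffOn_two_iff (hu : UniqueDiffOn ℝ S) : ContDiffOn ℝ 2 f S ↔
    (∀ θ ∈ S, HasFDerivWithinAt f (fderivWithin ℝ f S θ) S θ) ∧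
    (∀ θ ∈ S, HasFDerivWithinAt (fderivWithin ℝ f S) (fderivWithin₂ f S θ) S θ) ∧
    ContinuousOn (fderivWithin₂ f S) S := by
  have h2 : (2 : WithTop ℕ∞) = 1 + 1 := by norm_num
  have h1 : (1 : WithTop ℕ∞) = 0 + 1 := by norm_num
  rw [h2, contDiffOn_succ_iff_fderivWithin hu, h1, contDiffOn_succ_iff_fderivWithin hu,
    contDiffOn_zero]
  constructor
  · rintro ⟨a, -, b, -, c⟩
    exact ⟨fun θ hθ => (a θ hθ).hasFDerivWithinAt, fun θ hθ => (b θ hθ).hasFDerivWithinAt, c⟩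
  · rintro ⟨a, b, c⟩
    exact ⟨fun θ hθ => (a θ hθ).differentiableWithinAt, by simp,
      fun θ hθ => (b θ hθ).differentiableWithinAt, by simp, c⟩

/-- Twice continuous differentiability from explicit derivatives. -/
lemma contDiffOn_two_of_hasFDerivWithinAt (hu : UniqueDiffOn ℝ S) {f1 : E → E →L[ℝ] ℝ}
    {f2 : E → E →L[ℝ] E →L[ℝ] ℝ} (h1 : ∀ θ ∈ S, HasFDerivWithinAt f (f1 θ) S θ)
    (h2 : ∀ θ ∈ S, HasFDerivWithinAt f1 (f2 θ) S θ) (hc : ContinuousOn f2 S) :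
    ContDiffOn ℝ 2 f S ∧ Set.EqOn (fderivWithin ℝ f S) f1 S ∧
      Set.EqOn (fderivWithin₂ f S) f2 S := by
  have e1 : Set.EqOn (fderivWithin ℝ f S) f1 S := fun θ hθ => (h1 θ hθ).fderivWithin (hu θ hθ)
  have h2' : ∀ θ ∈ S, HasFDerivWithinAt (fderivWithin ℝ f S) (f2 θ) S θ := fun θ hθ =>
    (h2 θ hθ).congr e1 (e1 hθ)
  have e2 : Set.EqOn (fderivWithin₂ f S) f2 S := fun θ hθ => (h2' θ hθ).fderivWithin (hu θ hθ)
  refine ⟨(contDiffOn_two_iff hu).2 ⟨fun θ hθ => ?_, fun θ hθ => ?_, hc.congr e2⟩, e1, e2⟩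
  · rw [e1 hθ]; exact h1 θ hθ
  · rw [e2 hθ]; exact h2' θ hθ

lemma fderivWithin_mul_of_contDiffOn (hu : UniqueDiffOn ℝ S) (hf : ContDiffOn ℝ 2 f S)
    (hg : ContDiffOn ℝ 2 g S) (hθ : θ ∈ S) :
    fderivWithin ℝ (fun τ => f τ * g τ) S θ =
      f θ • fderivWithin ℝ g S θ + g θ • fderivWithin ℝ f S θ :=
  ((((contDiffOn_two_iff hu).1 hf).1 θ hθ).mul (((contDiffOn_two_iff hu).1 hg).1 θ hθ)).fderivWithin
    (hu θ hθ)

lemma fderivWithin₂_mul_of_contDiffOn (hu : UniqueDiffOn ℝ S) (hf : ContDiffOn ℝ 2 f S)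
    (hg : ContDiffOn ℝ 2 g S) (hθ : θ ∈ S) :
    fderivWithin₂ (fun τ => f τ * g τ) S θ =
      (f θ • fderivWithin₂ g S θ + (fderivWithin ℝ f S θ).smulRight (fderivWithin ℝ g S θ)) +
      (g θ • fderivWithin₂ f S θ + (fderivWithin ℝ g S θ).smulRight (fderivWithin ℝ f S θ)) := by
  obtain ⟨f1, f2, -⟩ := (contDiffOn_two_iff hu).1 hf
  obtain ⟨g1, g2, -⟩ := (contDiffOn_two_iff hu).1 hg
  have h := ((f1 θ hθ).smul (g2 θ hθ)).add ((g1 θ hθ).smul (f2 θ hθ))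
  refine HasFDerivWithinAt.fderivWithin (h.congr (fun τ hτ => ?_) ?_) (hu θ hθ)
  · exact fderivWithin_mul_of_contDiffOn hu hf hg hτ
  · exact fderivWithin_mul_of_contDiffOn hu hf hg hθ

lemma fderivWithin_log_of_contDiffOn (hu : UniqueDiffOn ℝ S) (hf : ContDiffOn ℝ 2 f S)
    (hθ : θ ∈ S) (h0 : f θ ≠ 0) :
    fderivWithin ℝ (fun τ => Real.log (f τ)) S θ = (f θ)⁻¹ • fderivWithin ℝ f S θ :=
  ((((contDiffOn_two_iff hu).1 hf).1 θ hθ).log h0).fderivWithin (hu θ hθ)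

lemma hasFDerivWithinAt_fderivWithin_log (hu : UniqueDiffOn ℝ S) (hf : ContDiffOn ℝ 2 f S)
    (hθ : θ ∈ S) (h0 : f θ ≠ 0) :
    HasFDerivWithinAt (fderivWithin ℝ (fun τ => Real.log (f τ)) S)
      ((f θ)⁻¹ • fderivWithin₂ f S θ -
      (f θ ^ 2)⁻¹ • (fderivWithin ℝ f S θ).smulRight (fderivWithin ℝ f S θ)) S θ := by
  obtain ⟨f1, f2, -⟩ := (contDiffOn_two_iff hu).1 hf
  have hinv : HasFDerivWithinAt (fun τ => (f τ)⁻¹) (-(f θ ^ 2)⁻¹ • fderivWithin ℝ f S θ) S θ :=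
    (hasDerivAt_inv h0).comp_hasFDerivWithinAt θ (f1 θ hθ)
  have h := hinv.smul (f2 θ hθ)
  have hev : ∀ᶠ τ in 𝓝[S] θ, fderivWithin ℝ (fun τ => Real.log (f τ)) S τ =
      (f τ)⁻¹ • fderivWithin ℝ f S τ := by
    filter_upwards [(f1 θ hθ).continuousWithinAt.eventually_ne h0, self_mem_nhdsWithin]
      with τ hτ hτS
    exact fderivWithin_log_of_contDiffOn hu hf hτS hτ
  have h' := h.congr_of_eventuallyEq hev (fderivWithin_log_of_contDiffOn hu hf hθ h0)
  have e : (f θ)⁻¹ • fderivWithin₂ f S θ -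
      (f θ ^ 2)⁻¹ • (fderivWithin ℝ f S θ).smulRight (fderivWithin ℝ f S θ) =
      (f θ)⁻¹ • fderivWithin₂ f S θ +
      (-(f θ ^ 2)⁻¹ • fderivWithin ℝ f S θ).smulRight (fderivWithin ℝ f S θ) := by
    ext u v
    simp [mul_assoc]
    ring
  rw [e]
  exact h'

lemma fderivWithin₂_log_of_contDiffOn (hu : UniqueDiffOn ℝ S) (hf : ContDiffOn ℝ 2 f S)
    (hθ : θ ∈ S) (h0 : f θ ≠ 0) :
    fderivWithin₂ (fun τ => Real.log (f τ)) S θ = (f θ)⁻¹ • fderivWithin₂ f S θ -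
      (f θ ^ 2)⁻¹ • (fderivWithin ℝ f S θ).smulRight (fderivWithin ℝ f S θ) :=
  (hasFDerivWithinAt_fderivWithin_log hu hf hθ h0).fderivWithin (hu θ hθ)

lemma norm_smulRight_self_le (L M : E →L[ℝ] ℝ) : ‖L.smulRight M‖ ≤ ‖L‖ * ‖M‖ :=
  (ContinuousLinearMap.norm_smulRight_apply L M).le

/-- A nonnegative function, twice continuously differentiable on `S`, whose first two derivatives
are bounded by multiples of the function itself. -/
structure Tame (S : Set E) (b₁ b₂ : ℝ) (f : E → ℝ) : Prop where
  contDiffOn : ContDiffOn ℝ 2 f S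
  nonneg : ∀ θ ∈ S, 0 ≤ f θ
  norm_fderivWithin_le : ∀ θ ∈ S, ‖fderivWithin ℝ f S θ‖ ≤ b₁ * f θ
  norm_fderivWithin₂_le : ∀ θ ∈ S, ‖fderivWithin₂ f S θ‖ ≤ b₂ * f θ

/-- The constants come from the product rule. The factor 2 counts the two mixed terms of the second
derivative. -/
lemma Tame.mul (hu : UniqueDiffOn ℝ S) {b₁ b₂ b₁' b₂' : ℝ} (hf : Tame S b₁ b₂ f)
    (hg : Tame S b₁' b₂' g) :
    Tame S (b₁ + b₁') (b₂ + 2 * (b₁ * b₁') + b₂') fun θ => f θ * g θ := by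
  refine ⟨hf.contDiffOn.mul hg.contDiffOn, fun θ hθ => mul_nonneg (hf.nonneg θ hθ) (hg.nonneg θ hθ),
    fun θ hθ => ?_, fun θ hθ => ?_⟩
  all_goals
    have hf0 := hf.nonneg θ hθ
    have hg0 := hg.nonneg θ hθ
    have hf1 := hf.norm_fderivWithin_le θ hθ
    have hg1 := hg.norm_fderivWithin_le θ hθ
    have hf2 := hf.norm_fderivWithin₂_le θ hθ
    have hg2 := hg.norm_fderivWithin₂_le θ hθ
  · rw [fderivWithin_mul_of_contDiffOn hu hf.contDiffOn hg.contDiffOn hθ]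
    calc _ ≤ f θ * (b₁' * g θ) + g θ * (b₁ * f θ) := by
          refine (norm_add_le _ _).trans ?_
          rw [norm_smul, norm_smul, Real.norm_of_nonneg hf0, Real.norm_of_nonneg hg0]
          gcongr
      _ = _ := by ring
  · rw [fderivWithin₂_mul_of_contDiffOn hu hf.contDiffOn hg.contDiffOn hθ]
    have hb : ‖fderivWithin ℝ f S θ‖ * ‖fderivWithin ℝ g S θ‖ ≤ (b₁ * f θ) * (b₁' * g θ) :=
      mul_le_mul hf1 hg1 (norm_nonneg _) ((norm_nonneg _).trans hf1)
    have e1 := norm_smulRight_self_le (fderivWithin ℝ f S θ) (fderivWithin ℝ g S θ)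
    have e2 := norm_smulRight_self_le (fderivWithin ℝ g S θ) (fderivWithin ℝ f S θ)
    have e3 : ‖f θ • fderivWithin₂ g S θ‖ ≤ f θ * (b₂' * g θ) := by
      rw [norm_smul, Real.norm_of_nonneg hf0]; gcongr
    have e4 : ‖g θ • fderivWithin₂ f S θ‖ ≤ g θ * (b₂ * f θ) := by
      rw [norm_smul, Real.norm_of_nonneg hg0]; gcongr
    refine (norm_add_le _ _).trans ((add_le_add (norm_add_le _ _) (norm_add_le _ _)).trans ?_)
    rw [mul_comm] at e2
    linarith

/-- Bounds on the first two derivatives of `log f`, where it is defined, make `f` tame. -/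
lemma tame_of_log (hu : UniqueDiffOn ℝ S) (hf : ContDiffOn ℝ 2 f S) (h0 : ∀ θ ∈ S, 0 ≤ f θ)
    {G₁ G₂ : ℝ} (h1 : ∀ θ ∈ S, 0 < f θ → ‖fderivWithin ℝ (fun τ => Real.log (f τ)) S θ‖ ≤ G₁)
    (h2 : ∀ θ ∈ S, 0 < f θ → ‖fderivWithin₂ (fun τ => Real.log (f τ)) S θ‖ ≤ G₂) :
    Tame S G₁ (G₂ + G₁ ^ 2) f := by
  -- Where `f > 0` one has `∇f = f ∇log f` and `∇²f = f (∇²log f + ∇log f ⊗ ∇log f)`.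
  have hpos : ∀ θ ∈ S, 0 < f θ → ‖fderivWithin ℝ f S θ‖ ≤ G₁ * f θ ∧
      ‖fderivWithin₂ f S θ‖ ≤ (G₂ + G₁ ^ 2) * f θ := by
    intro θ hθ hp
    have k1 := h1 θ hθ hp
    have k2 := h2 θ hθ hp
    have e1 := fderivWithin_log_of_contDiffOn hu hf hθ hp.ne'
    have e2 := fderivWithin₂_log_of_contDiffOn hu hf hθ hp.ne'
    set L := fderivWithin ℝ (fun τ => Real.log (f τ)) S θ
    have r1 : fderivWithin ℝ f S θ = f θ • L := by rw [e1, smul_inv_smul₀ hp.ne']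
    have r2 : fderivWithin₂ f S θ =
        f θ • (fderivWithin₂ (fun τ => Real.log (f τ)) S θ + L.smulRight L) := by
      rw [e2, r1]
      ext u v
      simp
      field_simp
      ring
    constructor
    · rw [r1, norm_smul, Real.norm_of_nonneg hp.le, mul_comm]
      gcongr
    · rw [r2, norm_smul, Real.norm_of_nonneg hp.le, mul_comm]
      gcongr
      refine (norm_add_le _ _).trans (add_le_add k2 ((norm_smulRight_self_le L L).trans ?_))
      nlinarith [norm_nonneg L]
  obtain ⟨c1, c2, c3⟩ := (contDiffOn_two_iff hu).1 hf
  set U := {θ | θ ∈ S ∧ 0 < f θ} with hU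
  have hUS : U ⊆ S := fun θ h => h.1
  have hall : ∀ θ ∈ S, ‖fderivWithin ℝ f S θ‖ ≤ G₁ * f θ ∧
      ‖fderivWithin₂ f S θ‖ ≤ (G₂ + G₁ ^ 2) * f θ := by
    intro θ hθ
    -- At a limit of points with `f > 0` the inequalities persist by continuity. Elsewhere `f`
    -- vanishes near `θ` within `S`, and so do both derivatives.
    by_cases hcl : θ ∈ closure U
    · have k0 := (c1 θ hθ).continuousWithinAt.mono hUS
      have k1 := (c2 θ hθ).continuousWithinAt.mono hUS
      have k2 := (c3 θ hθ).mono hUS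
      exact ⟨ContinuousWithinAt.closure_le hcl k1.norm (k0.const_mul _)
          fun y hy => (hpos y hy.1 hy.2).1,
        ContinuousWithinAt.closure_le hcl k2.norm (k0.const_mul _)
          fun y hy => (hpos y hy.1 hy.2).2⟩
    · have hzero : ∀ᶠ τ in 𝓝[S] θ, f τ = 0 := by
        filter_upwards [mem_nhdsWithin_of_mem_nhds (isClosed_closure.isOpen_compl.mem_nhds hcl),
          self_mem_nhdsWithin] with τ hτ hτS
        by_contra hne
        exact hτ (subset_closure ⟨hτS, lt_of_le_of_ne (h0 τ hτS) (Ne.symm hne)⟩)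
      have e0 : f =ᶠ[𝓝[S] θ] fun _ => 0 := hzero
      have e1 : fderivWithin ℝ f S =ᶠ[𝓝[S] θ] fun _ => 0 := by
        refine (EventuallyEq.fderivWithin (𝕜 := ℝ) e0).trans (.of_forall fun τ => ?_)
        simp
      have hθ1 : fderivWithin ℝ f S θ = 0 := e1.self_of_nhdsWithin hθ
      have hθ2 : fderivWithin₂ f S θ = 0 := by
        have := EventuallyEq.fderivWithin_eq (𝕜 := ℝ) e1 hθ1
        simpa [fderivWithin₂] using this
      rw [hθ1, hθ2, hzero.self_of_nhdsWithin hθ]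
      simp
  exact ⟨hf, h0, fun θ hθ => (hall θ hθ).1, fun θ hθ => (hall θ hθ).2⟩

/-- Integrals of tame functions are tame. -/
theorem Tame.integral [FiniteDimensional ℝ E] (hS : QuasiconvexWith C S) (hu : UniqueDiffOn ℝ S)
    {Z : Type*} [MeasurableSpace Z] {μ : Measure Z} {f : E → Z → ℝ} {b₁ b₂ : ℝ}
    (hm : ∀ θ ∈ S, AEStronglyMeasurable (f θ) μ)
    (ht : ∀ᵐ z ∂μ, Tame S b₁ b₂ fun θ => f θ z) {B : Z → ℝ}
    (hB : ∀ᵐ z ∂μ, ∀ θ ∈ S, f θ z ≤ B z) (hBi : Integrable B μ) (hb₁ : 0 ≤ b₁) (hb₂ : 0 ≤ b₂) :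
    Tame S b₁ b₂ (fun θ => ∫ z, f θ z ∂μ) ∧
    (∀ θ ∈ S, fderivWithin ℝ (fun θ => ∫ z, f θ z ∂μ) S θ =
      ∫ z, fderivWithin ℝ (fun θ => f θ z) S θ ∂μ) ∧
    (∀ θ ∈ S, fderivWithin₂ (fun θ => ∫ z, f θ z ∂μ) S θ =
      ∫ z, fderivWithin₂ (fun θ => f θ z) S θ ∂μ) ∧
    (∀ θ ∈ S, Integrable (f θ) μ ∧ Integrable (fun z => fderivWithin ℝ (fun θ => f θ z) S θ) μ ∧
      Integrable (fun z => fderivWithin₂ (fun θ => f θ z) S θ) μ) := by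
  have hm1 : ∀ θ ∈ S, AEStronglyMeasurable (fun z => fderivWithin ℝ (fun θ => f θ z) S θ) μ :=
    fun θ hθ => aestronglyMeasurable_fderivWithin (hu θ hθ) hθ hm
      (ht.mono fun z hz => (((contDiffOn_two_iff hu).1 hz.contDiffOn).1 θ hθ).differentiableWithinAt)
  have hm2 : ∀ θ ∈ S, AEStronglyMeasurable (fun z => fderivWithin₂ (fun θ => f θ z) S θ) μ :=
    fun θ hθ => aestronglyMeasurable_fderivWithin (hu θ hθ) hθ hm1
      (ht.mono fun z hz =>
        (((contDiffOn_two_iff hu).1 hz.contDiffOn).2.1 θ hθ).differentiableWithinAt)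
  -- Tameness turns a dominating function for `f` into dominating functions for its derivatives, as
  -- needed for differentiation under the integral.
  have hn1 : ∀ᵐ z ∂μ, ∀ θ ∈ S, ‖fderivWithin ℝ (fun θ => f θ z) S θ‖ ≤ b₁ * B z := by
    filter_upwards [ht, hB] with z h1 h2 θ hθ
    exact (h1.norm_fderivWithin_le θ hθ).trans (mul_le_mul_of_nonneg_left (h2 θ hθ) hb₁)
  have hn2 : ∀ᵐ z ∂μ, ∀ θ ∈ S, ‖fderivWithin₂ (fun θ => f θ z) S θ‖ ≤ b₂ * B z := by
    filter_upwards [ht, hB] with z h1 h2 θ hθ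
    exact (h1.norm_fderivWithin₂_le θ hθ).trans (mul_le_mul_of_nonneg_left (h2 θ hθ) hb₂)
  have hi0 : ∀ θ ∈ S, Integrable (f θ) μ := fun θ hθ => hBi.mono' (hm θ hθ) (by
    filter_upwards [ht, hB] with z h1 h2
    rw [Real.norm_of_nonneg (h1.nonneg θ hθ)]
    exact h2 θ hθ)
  have hi1 : ∀ θ ∈ S, Integrable (fun z => fderivWithin ℝ (fun θ => f θ z) S θ) μ := fun θ hθ =>
    (hBi.const_mul b₁).mono' (hm1 θ hθ) (hn1.mono fun z hz => hz θ hθ)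
  have hi2 : ∀ θ ∈ S, Integrable (fun z => fderivWithin₂ (fun θ => f θ z) S θ) μ := fun θ hθ =>
    (hBi.const_mul b₂).mono' (hm2 θ hθ) (hn2.mono fun z hz => hz θ hθ)
  have d1 : ∀ θ ∈ S, HasFDerivWithinAt (fun θ => ∫ z, f θ z ∂μ)
      (∫ z, fderivWithin ℝ (fun θ => f θ z) S θ ∂μ) S θ := fun θ hθ =>
    hS.hasFDerivWithinAt_integral (f' := fun θ z => fderivWithin ℝ (fun θ => f θ z) S θ) hθ hm
      hi0 (hm1 θ hθ) (ht.mono fun z hz => ((contDiffOn_two_iff hu).1 hz.contDiffOn).1) hn1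
      (hBi.const_mul _)
  have d2 : ∀ θ ∈ S, HasFDerivWithinAt (fun θ => ∫ z, fderivWithin ℝ (fun θ => f θ z) S θ ∂μ)
      (∫ z, fderivWithin₂ (fun θ => f θ z) S θ ∂μ) S θ := fun θ hθ =>
    hS.hasFDerivWithinAt_integral (f := fun θ z => fderivWithin ℝ (fun θ => f θ z) S θ)
      (f' := fun θ z => fderivWithin₂ (fun θ => f θ z) S θ) hθ hm1 hi1 (hm2 θ hθ)
      (ht.mono fun z hz => ((contDiffOn_two_iff hu).1 hz.contDiffOn).2.1) hn2 (hBi.const_mul _)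
  have hc : ContinuousOn (fun θ => ∫ z, fderivWithin₂ (fun θ => f θ z) S θ ∂μ) S := by
    intro θ hθ
    refine continuousWithinAt_of_dominated (bound := fun z => b₂ * B z) ?_ ?_ (hBi.const_mul _)
      (ht.mono fun z hz => ((contDiffOn_two_iff hu).1 hz.contDiffOn).2.2 θ hθ)
    · filter_upwards [self_mem_nhdsWithin] with τ hτ using hm2 τ hτ
    · filter_upwards [self_mem_nhdsWithin] with τ hτ
      filter_upwards [hn2] with z hz using hz τ hτ
  obtain ⟨e0, e1, e2⟩ := contDiffOn_two_of_hasFDerivWithinAt hu d1 d2 hc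
  refine ⟨⟨e0, fun θ hθ => integral_nonneg_of_ae (ht.mono fun z hz => hz.nonneg θ hθ),
    fun θ hθ => ?_, fun θ hθ => ?_⟩, fun θ hθ => e1 hθ, fun θ hθ => e2 hθ,
    fun θ hθ => ⟨hi0 θ hθ, hi1 θ hθ, hi2 θ hθ⟩⟩
  -- The bounds are linear in `f`, so they integrate with the same constants.
  · rw [e1 hθ, ← integral_const_mul]
    exact norm_integral_le_of_norm_le ((hi0 θ hθ).const_mul _)
      (ht.mono fun z hz => hz.norm_fderivWithin_le θ hθ)
  · rw [e2 hθ, ← integral_const_mul]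
    exact norm_integral_le_of_norm_le ((hi0 θ hθ).const_mul _)
      (ht.mono fun z hz => hz.norm_fderivWithin₂_le θ hθ)

/-- The two forms of the second derivative differ by currying, a linear isometry. Convergence proved
for `fderivWithin₂` thus transfers to `iteratedFDerivWithin`. -/
lemma norm_iteratedFDerivWithin_two_sub (hu : UniqueDiffOn ℝ S) (hθ : θ ∈ S) :
    ‖iteratedFDerivWithin ℝ 2 f S θ - iteratedFDerivWithin ℝ 2 g S θ‖ =
      ‖fderivWithin₂ f S θ - fderivWithin₂ g S θ‖ := by
  have key : ∀ f : E → ℝ, iteratedFDerivWithin ℝ 2 f S θ =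
      (continuousMultilinearCurryRightEquiv' ℝ 1 E ℝ).symm
        (iteratedFDerivWithin ℝ 1 (fderivWithin ℝ f S) S θ) := fun f =>
    iteratedFDerivWithin_succ_eq_comp_right hu hθ
  have key1 : ∀ f : E → E →L[ℝ] ℝ, iteratedFDerivWithin ℝ 1 f S θ =
      (continuousMultilinearCurryRightEquiv' ℝ 0 E (E →L[ℝ] ℝ)).symm
        ((continuousMultilinearCurryFin0 ℝ E (E →L[ℝ] E →L[ℝ] ℝ)).symm (fderivWithin ℝ f S θ)) :=
    fun f => iteratedFDerivWithin_succ_eq_comp_right hu hθ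
  rw [key f, key g, key1, key1, ← map_sub, ← map_sub, ← map_sub]
  simp only [LinearIsometryEquiv.norm_map]
  rfl

lemma norm_iteratedFDerivWithin_two (hu : UniqueDiffOn ℝ S) (hθ : θ ∈ S) :
    ‖iteratedFDerivWithin ℝ 2 f S θ‖ = ‖fderivWithin₂ f S θ‖ := by
  rw [← norm_iteratedFDerivWithin_fderivWithin hu hθ, norm_iteratedFDerivWithin_one _ (hu θ hθ)]
  rfl

lemma norm_iteratedFDerivWithin_three (hu : UniqueDiffOn ℝ S) (hθ : θ ∈ S) :
    ‖iteratedFDerivWithin ℝ 3 f S θ‖ = ‖fderivWithin ℝ (fderivWithin₂ f S) S θ‖ := by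
  rw [← norm_iteratedFDerivWithin_fderivWithin hu hθ,
    ← norm_iteratedFDerivWithin_fderivWithin hu hθ, norm_iteratedFDerivWithin_one _ (hu θ hθ)]
  rfl

end SecondOrder

/-! ### Means and covariances under comparable probability densities -/

section Densities

variable {Z : Type*}

/-- The oscillation of `f` is at most `R`. -/
def OscLE (f : Z → ℝ) (R : ℝ) : Prop := ∀ z z', |f z - f z'| ≤ R

lemma OscLE.add {f g : Z → ℝ} {R R' : ℝ} (hf : OscLE f R) (hg : OscLE g R') :
    OscLE (fun z => f z + g z) (R + R') := fun z z' => by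
  have := (abs_add_le (f z - f z') (g z - g z')).trans (add_le_add (hf z z') (hg z z'))
  rwa [show f z - f z' + (g z - g z') = f z + g z - (f z' + g z') by ring] at this

lemma oscLE_of_abs_le {f : Z → ℝ} {R : ℝ} (h : ∀ z, |f z| ≤ R) : OscLE f (2 * R) := fun z z' => by
  have := (abs_sub (f z) (f z')).trans (add_le_add (h z) (h z'))
  linarith

variable [MeasurableSpace Z]

/-- `w` is a probability density with respect to `μ`. -/
structure IsDensity (μ : Measure Z) (w : Z → ℝ) : Prop where
  integrable : Integrable w μ
  nonneg : ∀ z, 0 ≤ w z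
  integral_eq_one : ∫ z, w z ∂μ = 1

/-- `f` is bounded and almost everywhere strongly measurable. -/
def IsBdd (μ : Measure Z) (f : Z → ℝ) : Prop :=
  AEStronglyMeasurable f μ ∧ ∃ B, ∀ z, |f z| ≤ B

/-- The mean of `f` under the density `w`. -/
def densMean (μ : Measure Z) (w f : Z → ℝ) : ℝ := ∫ z, w z * f z ∂μ

/-- The covariance of `f` and `g` under the density `w`. -/
def densCov (μ : Measure Z) (w f g : Z → ℝ) : ℝ :=
  densMean μ w (fun z => f z * g z) - densMean μ w f * densMean μ w g

variable {μ : Measure Z} {w w' f g : Z → ℝ}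

lemma IsBdd.add (hf : IsBdd μ f) (hg : IsBdd μ g) : IsBdd μ fun z => f z + g z := by
  obtain ⟨hfm, B, hB⟩ := hf
  obtain ⟨hgm, B', hB'⟩ := hg
  exact ⟨hfm.add hgm, B + B', fun z => (abs_add_le _ _).trans (add_le_add (hB z) (hB' z))⟩

lemma IsBdd.sub (hf : IsBdd μ f) (hg : IsBdd μ g) : IsBdd μ fun z => f z - g z := by
  obtain ⟨hfm, B, hB⟩ := hf
  obtain ⟨hgm, B', hB'⟩ := hg
  exact ⟨hfm.sub hgm, B + B', fun z => (abs_sub _ _).trans (add_le_add (hB z) (hB' z))⟩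

lemma IsBdd.mul (hf : IsBdd μ f) (hg : IsBdd μ g) : IsBdd μ fun z => f z * g z := by
  obtain ⟨hfm, B, hB⟩ := hf
  obtain ⟨hgm, B', hB'⟩ := hg
  exact ⟨hfm.mul hgm, B * B', fun z => by
    rw [abs_mul]
    exact mul_le_mul (hB z) (hB' z) (abs_nonneg _) ((abs_nonneg _).trans (hB z))⟩

lemma isBdd_const (c : ℝ) : IsBdd μ fun _ => c :=
  ⟨aestronglyMeasurable_const, |c|, fun _ => le_rfl⟩

lemma integrable_mul_isBdd (hw : Integrable w μ) (hf : IsBdd μ f) :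
    Integrable (fun z => w z * f z) μ := by
  obtain ⟨hfm, B, hB⟩ := hf
  exact hw.mul_bdd (c := B) hfm (.of_forall hB)

lemma densMean_add (hw : IsDensity μ w) (hf : IsBdd μ f) (hg : IsBdd μ g) :
    densMean μ w (fun z => f z + g z) = densMean μ w f + densMean μ w g := by
  simp only [densMean, mul_add]
  exact integral_add (integrable_mul_isBdd hw.integrable hf) (integrable_mul_isBdd hw.integrable hg)

lemma densMean_sub (hw : IsDensity μ w) (hf : IsBdd μ f) (hg : IsBdd μ g) :
    densMean μ w (fun z => f z - g z) = densMean μ w f - densMean μ w g := by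
  simp only [densMean, mul_sub]
  exact integral_sub (integrable_mul_isBdd hw.integrable hf) (integrable_mul_isBdd hw.integrable hg)

lemma densMean_const (hw : IsDensity μ w) (c : ℝ) : densMean μ w (fun _ => c) = c := by
  simp [densMean, integral_mul_const, hw.integral_eq_one]

lemma densMean_const_mul (c : ℝ) : densMean μ w (fun z => c * f z) = c * densMean μ w f := by
  simp only [densMean, mul_left_comm _ c, integral_const_mul]

lemma abs_densMean_sub_le (hw : IsDensity μ w) (hf : IsBdd μ f) {c R : ℝ}
    (h : ∀ z, |f z - c| ≤ R) : |densMean μ w f - c| ≤ R := by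
  have e : densMean μ w f - c = ∫ z, w z * (f z - c) ∂μ := by
    conv_lhs => rw [← densMean_const hw c, ← densMean_sub hw hf (isBdd_const c)]
    rfl
  have e2 : R = ∫ z, w z * R ∂μ := by rw [integral_mul_const, hw.integral_eq_one, one_mul]
  rw [e, e2]
  rw [← Real.norm_eq_abs]
  refine norm_integral_le_of_norm_le (hw.integrable.mul_const R) (.of_forall fun z => ?_)
  rw [norm_mul, Real.norm_of_nonneg (hw.nonneg z)]
  exact mul_le_mul_of_nonneg_left (h z) (hw.nonneg z)

lemma abs_densMean_le (hw : IsDensity μ w) (hf : IsBdd μ f) {R : ℝ} (h : ∀ z, |f z| ≤ R) :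
    |densMean μ w f| ≤ R := by
  simpa using abs_densMean_sub_le hw hf (c := 0) (by simpa using h)

lemma abs_sub_densMean_le (hw : IsDensity μ w) (hf : IsBdd μ f) {R : ℝ} (h : OscLE f R) (z : Z) :
    |f z - densMean μ w f| ≤ R := by
  rw [abs_sub_comm]
  exact abs_densMean_sub_le hw hf fun z' => h z' z

lemma IsDensity.nonempty (hw : IsDensity μ w) : Nonempty Z := by
  by_contra h
  rw [not_nonempty_iff] at h
  have := hw.integral_eq_one
  simp [Subsingleton.elim μ 0] at this

/-- Doeblin contraction: comparable densities give means that are closer than the oscillation. -/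
lemma abs_densMean_sub_densMean_le (hw : IsDensity μ w) (hw' : IsDensity μ w') {α : ℝ}
    (hα : ∀ z, α * w' z ≤ w z) (hf : IsBdd μ f) {R : ℝ} (h : OscLE f R) :
    |densMean μ w f - densMean μ w' f| ≤ (1 - α) * R := by
  -- The excess `w - α w'` is nonnegative with mass `1 - α`, and the remaining part `α w'` is common
  -- to both means.
  have hdi : Integrable (fun z => w z - α * w' z) μ := hw.integrable.sub (hw'.integrable.const_mul α)
  have hd1 : ∫ z, (w z - α * w' z) ∂μ = 1 - α := by
    rw [integral_sub hw.integrable (hw'.integrable.const_mul α), integral_const_mul,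
      hw.integral_eq_one, hw'.integral_eq_one, mul_one]
  have e : densMean μ w f = α * densMean μ w' f + ∫ z, (w z - α * w' z) * f z ∂μ := by
    rw [densMean, densMean, ← integral_const_mul, ← integral_add
      ((integrable_mul_isBdd hw'.integrable hf).const_mul α) (integrable_mul_isBdd hdi hf)]
    congr 1
    funext z
    ring
  have h1 : ∀ z', |(1 - α) * f z' - ∫ z, (w z - α * w' z) * f z ∂μ| ≤ (1 - α) * R := fun z' => by
    have e2 : (1 - α) * f z' - ∫ z, (w z - α * w' z) * f z ∂μ =
        ∫ z, (w z - α * w' z) * (f z' - f z) ∂μ := by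
      simp only [mul_sub]
      rw [integral_sub (hdi.mul_const _) (integrable_mul_isBdd hdi hf), integral_mul_const, hd1]
    rw [e2, ← hd1, ← integral_mul_const, ← Real.norm_eq_abs]
    refine norm_integral_le_of_norm_le (hdi.mul_const R) (.of_forall fun z => ?_)
    rw [norm_mul, Real.norm_of_nonneg (sub_nonneg.2 (hα z))]
    exact mul_le_mul_of_nonneg_left (h z' z) (sub_nonneg.2 (hα z))
  have h2 := abs_densMean_sub_le hw' ((isBdd_const (1 - α)).mul hf) h1
  rw [densMean_const_mul, abs_sub_comm] at h2
  rw [e]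
  convert h2 using 2
  ring

/-- Means under densities whose ratio is close to one. -/
lemma abs_densMean_sub_densMean_le_of_ratio (hw : IsDensity μ w) (hw' : IsDensity μ w') {e : ℝ}
    (he : ∀ z, |w z - w' z| ≤ e * w' z) (hf : IsBdd μ f) {R : ℝ} (h : OscLE f R) :
    |densMean μ w f - densMean μ w' f| ≤ e * R := by
  obtain ⟨z₀⟩ := hw.nonempty
  have hR : 0 ≤ R := (abs_nonneg _).trans (h z₀ z₀)
  -- Both densities have mass one, so `f` may be replaced by `f - f z₀`, which is bounded by the
  -- oscillation.
  have e1 : densMean μ w f - densMean μ w' f = ∫ z, (w z - w' z) * (f z - f z₀) ∂μ := by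
    have hd : Integrable (fun z => w z - w' z) μ := hw.integrable.sub hw'.integrable
    simp only [mul_sub]
    rw [integral_sub (integrable_mul_isBdd hd hf) (hd.mul_const _), integral_mul_const,
      integral_sub hw.integrable hw'.integrable, hw.integral_eq_one, hw'.integral_eq_one, sub_self,
      zero_mul, sub_zero]
    simp only [sub_mul]
    rw [integral_sub (integrable_mul_isBdd hw.integrable hf)
      (integrable_mul_isBdd hw'.integrable hf)]
    rfl
  have e2 : e * R = ∫ z, e * w' z * R ∂μ := by
    rw [integral_mul_const, integral_const_mul, hw'.integral_eq_one, mul_one]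
  rw [e1, e2]
  rw [← Real.norm_eq_abs]
  refine norm_integral_le_of_norm_le ((hw'.integrable.const_mul e).mul_const R)
    (.of_forall fun z => ?_)
  rw [norm_mul]
  exact mul_le_mul (he z) (h z z₀) (norm_nonneg _) ((abs_nonneg _).trans (he z))

/-- Centring at arbitrary constants adds the product of the two biases. This permits centring under
one density while averaging under another. -/
lemma densMean_centered (hw : IsDensity μ w) (hf : IsBdd μ f) (hg : IsBdd μ g) (c d : ℝ) :
    densMean μ w (fun z => (f z - c) * (g z - d)) =
      densCov μ w f g + (densMean μ w f - c) * (densMean μ w g - d) := by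
  have e : (fun z => (f z - c) * (g z - d)) =
      fun z => (f z * g z - c * g z) - (d * f z - c * d) := by funext z; ring
  have b1 := (isBdd_const (μ := μ) c).mul hg
  have b2 := (isBdd_const (μ := μ) d).mul hf
  rw [e, densMean_sub hw ((hf.mul hg).sub b1) (b2.sub (isBdd_const _)),
    densMean_sub hw (hf.mul hg) b1, densMean_sub hw b2 (isBdd_const _), densMean_const_mul,
    densMean_const_mul, densMean_const hw, densCov]
  ring

lemma abs_densCov_le (hw : IsDensity μ w) (hf : IsBdd μ f) (hg : IsBdd μ g) {R R' : ℝ}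
    (h : OscLE f R) (h' : OscLE g R') : |densCov μ w f g| ≤ R * R' := by
  have e := densMean_centered hw hf hg (densMean μ w f) (densMean μ w g)
  rw [sub_self, zero_mul, add_zero] at e
  rw [← e]
  refine abs_densMean_le hw ((hf.sub (isBdd_const _)).mul (hg.sub (isBdd_const _))) fun z => ?_
  rw [abs_mul]
  exact mul_le_mul (abs_sub_densMean_le hw hf h z) (abs_sub_densMean_le hw hg h' z)
    (abs_nonneg _) ((abs_nonneg _).trans (h z z))

lemma densCov_sub_densCov (hw : IsDensity μ w) {f' g' : Z → ℝ} (hf : IsBdd μ f) (hg : IsBdd μ g)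
    (hf' : IsBdd μ f') (hg' : IsBdd μ g') : densCov μ w f g - densCov μ w f' g' =
      densCov μ w (fun z => f z - f' z) g + densCov μ w f' (fun z => g z - g' z) := by
  have e1 : (fun z => (f z - f' z) * g z) = fun z => f z * g z - f' z * g z := by funext z; ring
  have e2 : (fun z => f' z * (g z - g' z)) = fun z => f' z * g z - f' z * g' z := by
    funext z; ring
  simp only [densCov]
  rw [e1, e2, densMean_sub hw (hf.mul hg) (hf'.mul hg), densMean_sub hw (hf'.mul hg) (hf'.mul hg'),
    densMean_sub hw hf hf', densMean_sub hw hg hg']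
  ring

lemma abs_densCov_sub_densCov_le (hw : IsDensity μ w) {f' g' : Z → ℝ} (hf : IsBdd μ f)
    (hg : IsBdd μ g) (hf' : IsBdd μ f') (hg' : IsBdd μ g') {d V : ℝ}
    (hfd : OscLE (fun z => f z - f' z) d) (hgd : OscLE (fun z => g z - g' z) d)
    (hgV : OscLE g V) (hfV : OscLE f' V) :
    |densCov μ w f g - densCov μ w f' g'| ≤ 2 * (d * V) := by
  rw [densCov_sub_densCov hw hf hg hf' hg']
  have h1 := abs_densCov_le hw (hf.sub hf') hg hfd hgV
  have h2 := abs_densCov_le hw hf' (hg.sub hg') hfV hgd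
  have := (abs_add_le _ _).trans (add_le_add h1 h2)
  linarith

/-- Centre at the means under `w'`. The centred product has oscillation at most `2V²`, so its means
differ by at most `2eV²`; the bias product under `w` adds at most `eV · V`. -/
lemma abs_densCov_sub_densCov_le_of_ratio (hw : IsDensity μ w) (hw' : IsDensity μ w') {e : ℝ}
    (he : ∀ z, |w z - w' z| ≤ e * w' z) (hf : IsBdd μ f) (hg : IsBdd μ g) {V : ℝ}
    (h : OscLE f V) (h' : OscLE g V) :
    |densCov μ w f g - densCov μ w' f g| ≤ 3 * e * V ^ 2 := by
  set c := densMean μ w' f with hc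
  set d := densMean μ w' g with hd
  have hbd := (hf.sub (isBdd_const c)).mul (hg.sub (isBdd_const d))
  have e1 := densMean_centered hw hf hg c d
  have e2 := densMean_centered hw' hf hg c d
  rw [← hc, sub_self, zero_mul, add_zero] at e2
  have hV := abs_sub_densMean_le hw' hf h
  have hV' := abs_sub_densMean_le hw' hg h'
  obtain ⟨z₀⟩ := hw.nonempty
  have hV0 : 0 ≤ V := (abs_nonneg _).trans (h z₀ z₀)
  have hosc : OscLE (fun z => (f z - c) * (g z - d)) (2 * (V * V)) :=
    oscLE_of_abs_le fun z => by
      rw [abs_mul]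
      exact mul_le_mul (hV z) (hV' z) (abs_nonneg _) hV0
  have h1 := abs_densMean_sub_densMean_le_of_ratio hw hw' he hbd hosc
  have h2 := abs_densMean_sub_densMean_le_of_ratio hw hw' he hf h
  have h3 : |densMean μ w g - d| ≤ V := abs_densMean_sub_le hw hg hV'
  have h4 : |(densMean μ w f - c) * (densMean μ w g - d)| ≤ e * V * V := by
    rw [abs_mul]
    exact mul_le_mul h2 h3 (abs_nonneg _) ((abs_nonneg _).trans h2)
  have e3 : densCov μ w f g - densCov μ w' f g =
      (densMean μ w (fun z => (f z - c) * (g z - d)) -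
        densMean μ w' (fun z => (f z - c) * (g z - d))) -
      (densMean μ w f - c) * (densMean μ w g - d) := by
    rw [e1, e2]; ring
  rw [e3]
  have := (abs_sub _ _).trans (add_le_add h1 h4)
  linarith

end Densities

/-! ### Forgetting for recursions driven by comparable densities -/

section Forgetting

/-- Convexity of the square applied to `t p + (1 - t) (q / (1 - t))`. A contraction for oscillations
becomes a linear recursion for their squares, which integrable geometric sums can dominate. -/
lemma add_sq_le_of_lt_one {t p q : ℝ} (ht0 : 0 ≤ t) (ht : t < 1) :
    (t * p + q) ^ 2 ≤ t * p ^ 2 + q ^ 2 / (1 - t) := by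
  have h1 : 0 < 1 - t := sub_pos.2 ht
  rw [← sub_nonneg]
  have : t * p ^ 2 + q ^ 2 / (1 - t) - (t * p + q) ^ 2 = t * ((1 - t) * p - q) ^ 2 / (1 - t) := by
    field_simp
    ring
  rw [this]
  positivity

lemma le_sqrt_of_contraction {t p q N N' x : ℝ} (ht0 : 0 ≤ t) (ht : t < 1) (hp : 0 ≤ N')
    (hpN : p ≤ √N') (hx : x ≤ t * p + q) (hN : t * N' + q ^ 2 / (1 - t) ≤ N) :
    x ≤ √N := by
  refine Real.le_sqrt_of_sq_le ?_ |> (hx.trans <| (add_le_add_left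
    (mul_le_mul_of_nonneg_left hpN ht0) q).trans ·)
  have := add_sq_le_of_lt_one (p := √N') (q := q) ht0 ht
  rw [Real.sq_sqrt hp] at this
  exact this.trans hN

variable {Z : Type*} [MeasurableSpace Z] {μ : Measure Z}

/-- A sequence of families of probability densities indexed by a horizon `m`, a time `j` and a
point, which are mutually comparable and which forget the horizon geometrically. -/
structure ForgettingDensities (μ : Measure Z) (w : ℕ → ℕ → Z → Z → ℝ) (lam e₀ : ℝ) : Prop where
  lam_pos : 0 < lam
  lam_lt_one : lam < 1
  e₀_nonneg : 0 ≤ e₀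
  isDensity : ∀ m j x, IsDensity μ (w m j x)
  -- One step contracts by `lam ^ 4`. One factor `lam` of this is spent on the decay in the horizon,
  -- and the remaining `lam ^ 3` still contracts.
  comparable : ∀ m j x x' z, (1 - lam ^ 4) * w m j x' z ≤ w m j x z
  ratio : ∀ b n j x z, |w (b + n) j x z - w b j x z| ≤ e₀ * lam ^ (4 * b) * w b j x z

variable {w : ℕ → ℕ → Z → Z → ℝ} {lam e₀ : ℝ}

/-- The bound on the oscillations of the integrands. -/
def oscBound (k₁ W : ℕ → ℝ) (j : ℕ) : ℝ := 2 * k₁ j + √(W (j + 1))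

/-- The first order recursion. -/
structure FirstOrder (μ : Measure Z) (w : ℕ → ℕ → Z → Z → ℝ) (k₁ : ℕ → ℝ)
    (φ : ℕ → Z → Z → ℝ) (a : ℕ → ℕ → Z → ℝ) : Prop where
  isBdd_φ : ∀ j x, IsBdd μ (φ j x)
  isBdd_a : ∀ m j, IsBdd μ (a m j)
  abs_φ_le : ∀ j x z, |φ j x z| ≤ k₁ j
  zero : ∀ j x, a 0 j x = 0
  succ : ∀ m j x, a (m + 1) j x = densMean μ (w m j x) fun z => φ j x z + a m (j + 1) z

variable {k₁ : ℕ → ℝ} {φ φ' : ℕ → Z → Z → ℝ} {a a' : ℕ → ℕ → Z → ℝ}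

section

variable {W N : ℕ → ℝ} (hF : ForgettingDensities μ w lam e₀) (hW0 : ∀ j, 0 ≤ W j)
  (hW : ∀ j, lam ^ 4 * W (j + 1) + (2 * k₁ j) ^ 2 / (1 - lam ^ 4) ≤ W j)

include hF hW0 hW

/-- In the recursion the oscillation of `a` at the next time contracts by `lam ^ 4`, while `φ`
contributes at most `2 k₁`. The hypothesis on `W` is this recursion in squared form, so the bound
does not depend on the horizon. -/
lemma FirstOrder.oscLE (h : FirstOrder μ w k₁ φ a) (m j : ℕ) : OscLE (a m j) √(W j) := by
  have hl4 : lam ^ 4 < 1 := pow_lt_one₀ hF.lam_pos.le hF.lam_lt_one (by norm_num)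
  induction m generalizing j with
  | zero =>
    intro x x'
    simp [h.zero]
  | succ m ih =>
    intro x x'
    refine le_sqrt_of_contraction (by have := hF.lam_pos; positivity) hl4 (hW0 (j + 1)) le_rfl ?_
      (hW j)
    rw [h.succ, h.succ, densMean_add (hF.isDensity m j x) (h.isBdd_φ j x) (h.isBdd_a m _),
      densMean_add (hF.isDensity m j x') (h.isBdd_φ j x') (h.isBdd_a m _)]
    have h1 := abs_densMean_sub_densMean_le (hF.isDensity m j x) (hF.isDensity m j x')
      (hF.comparable m j x x') (h.isBdd_a m (j + 1)) (ih (j + 1))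
    rw [sub_sub_cancel] at h1
    have h2 := abs_densMean_le (hF.isDensity m j x) (h.isBdd_φ j x) (h.abs_φ_le j x)
    have h3 := abs_densMean_le (hF.isDensity m j x') (h.isBdd_φ j x') (h.abs_φ_le j x')
    rw [abs_le] at *
    constructor <;> linarith

lemma FirstOrder.oscLE_integrand (h : FirstOrder μ w k₁ φ a) (m j : ℕ) (x : Z) :
    OscLE (fun z => φ j x z + a m (j + 1) z) (oscBound k₁ W j) :=
  (oscLE_of_abs_le (h.abs_φ_le j x)).add (h.oscLE hF hW0 hW m (j + 1))

lemma FirstOrder.abs_succ_sub_le (h : FirstOrder μ w k₁ φ a) (m j : ℕ) (x x₀ : Z) :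
    |a (m + 1) j x - a m (j + 1) x₀| ≤ oscBound k₁ W j := by
  rw [h.succ]
  refine abs_densMean_sub_le (hF.isDensity m j x) ((h.isBdd_φ j x).add (h.isBdd_a m _)) fun z => ?_
  have h1 := h.abs_φ_le j x z
  have h2 := h.oscLE hF hW0 hW m (j + 1) z x₀
  have h3 : 0 ≤ k₁ j := (abs_nonneg _).trans h1
  have := (abs_add_le _ _).trans (add_le_add h1 h2)
  rw [oscBound, show φ j x z + a m (j + 1) z - a m (j + 1) x₀ =
    φ j x z + (a m (j + 1) z - a m (j + 1) x₀) by ring]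
  linarith

/-- The effect of one step on the difference of two horizons. -/
lemma FirstOrder.abs_succ_sub_succ_sub_le (h : FirstOrder μ w k₁ φ a) (b n j : ℕ) {d : ℝ}
    (hd : OscLE (fun z => a (b + n) (j + 1) z - a b (j + 1) z) d) (x x₀ : Z) :
    |(a (b + n + 1) j x - a (b + 1) j x) - (a (b + n) (j + 1) x₀ - a b (j + 1) x₀)| ≤
      d + e₀ * lam ^ (4 * b) * oscBound k₁ W j := by
  have hb1 := (h.isBdd_φ j x).add (h.isBdd_a (b + n) (j + 1))
  have hb2 := (h.isBdd_φ j x).add (h.isBdd_a b (j + 1))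
  have hdiff := (h.isBdd_a (b + n) (j + 1)).sub (h.isBdd_a b (j + 1))
  -- The change of horizon is split in two: first the integrand changes under the longer-horizon
  -- density, then the density changes under the fixed integrand.
  have e1 : a (b + n + 1) j x = densMean μ (w (b + n) j x)
      (fun z => a (b + n) (j + 1) z - a b (j + 1) z) +
      densMean μ (w (b + n) j x) fun z => φ j x z + a b (j + 1) z := by
    rw [h.succ, ← densMean_add (hF.isDensity _ j x) hdiff hb2]
    congr 1
    funext z
    ring
  have h1 := abs_densMean_sub_le (hF.isDensity (b + n) j x) hdiff
    (c := a (b + n) (j + 1) x₀ - a b (j + 1) x₀) fun z => hd z x₀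
  have h2 := abs_densMean_sub_densMean_le_of_ratio (hF.isDensity (b + n) j x)
    (hF.isDensity b j x) (hF.ratio b n j x) hb2 (h.oscLE_integrand hF hW0 hW b j x)
  rw [← h.succ b j x] at h2
  rw [e1]
  rw [abs_le] at *
  constructor <;> linarith

/-- Induction on the shorter horizon `b`. For `b = 0` the difference is `a n j` itself. In the step
the previous difference contracts, and the change of density costs `e₀ lam^(4b)` times the
oscillation of the integrand, once at `x` and once at `x'`. -/
lemma FirstOrder.oscLE_sub (h : FirstOrder μ w k₁ φ a) (hN0 : ∀ j, 0 ≤ N j)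
    (hWN : ∀ j, W j ≤ N j)
    (hN : ∀ j, lam ^ 3 * N (j + 1) +
      (2 * e₀ / lam * oscBound k₁ W j) ^ 2 / (1 - lam ^ 3) ≤ N j) (b n j : ℕ) :
    OscLE (fun z => a (b + n) j z - a b j z) (lam ^ b * √(N j)) := by
  have hl := hF.lam_pos
  have hl3 : lam ^ 3 < 1 := pow_lt_one₀ hF.lam_pos.le hF.lam_lt_one (by norm_num)
  induction b generalizing j with
  | zero =>
    intro x x'
    simp only [h.zero, sub_zero, pow_zero, one_mul, zero_add]
    exact (h.oscLE hF hW0 hW n j x x').trans (Real.sqrt_le_sqrt (hWN j))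
  | succ b ih =>
    intro x x'
    set δ : Z → ℝ := fun z => a (b + n) (j + 1) z - a b (j + 1) z with hδ
    have hdiff : IsBdd μ δ := (h.isBdd_a (b + n) (j + 1)).sub (h.isBdd_a b (j + 1))
    have hb2 := fun x => (h.isBdd_φ j x).add (h.isBdd_a b (j + 1))
    have e1 : ∀ x, a (b + n + 1) j x = densMean μ (w (b + n) j x) δ +
        densMean μ (w (b + n) j x) fun z => φ j x z + a b (j + 1) z := fun x => by
      rw [h.succ, ← densMean_add (hF.isDensity _ j x) hdiff (hb2 x)]
      congr 1
      funext z
      rw [hδ]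
      ring
    have h0 := abs_densMean_sub_densMean_le (hF.isDensity (b + n) j x)
      (hF.isDensity (b + n) j x') (hF.comparable _ j x x') hdiff (ih (j + 1))
    have h2 := fun x => abs_densMean_sub_densMean_le_of_ratio (hF.isDensity (b + n) j x)
      (hF.isDensity b j x) (hF.ratio b n j x) (hb2 x) (h.oscLE_integrand hF hW0 hW b j x)
    have h3 := h2 x
    have h3' := h2 x'
    rw [← h.succ b j] at h3 h3'
    rw [sub_sub_cancel] at h0
    have hV : 0 ≤ oscBound k₁ W j := (abs_nonneg _).trans (h.oscLE_integrand hF hW0 hW b j x x x)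
    have hle : lam ^ (4 * b) ≤ lam ^ b :=
      pow_le_pow_of_le_one hl.le hF.lam_lt_one.le (by omega)
    have h4 : e₀ * lam ^ (4 * b) * oscBound k₁ W j ≤ lam ^ b * (e₀ * oscBound k₁ W j) := by
      have := mul_le_mul_of_nonneg_right hle (mul_nonneg hF.e₀_nonneg hV)
      linarith
    have key : |(a (b + n + 1) j x - a (b + 1) j x) - (a (b + n + 1) j x' - a (b + 1) j x')| ≤
        lam ^ (b + 1) * (lam ^ 3 * √(N (j + 1)) + 2 * e₀ / lam * oscBound k₁ W j) := by
      -- Factoring out `lam ^ (b + 1)` leaves the contraction `lam ^ 3` and produces the division by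
      -- `lam` in the hypothesis on `N`.
      have e2 : lam ^ (b + 1) * (lam ^ 3 * √(N (j + 1)) + 2 * e₀ / lam * oscBound k₁ W j) =
          lam ^ 4 * (lam ^ b * √(N (j + 1))) + 2 * (lam ^ b * (e₀ * oscBound k₁ W j)) := by
        field_simp
        ring
      rw [e2, e1 x, e1 x']
      rw [abs_le] at *
      constructor <;> linarith
    have e3 : b + 1 + n = b + n + 1 := by ring
    simp only [e3]
    refine key.trans (mul_le_mul_of_nonneg_left ?_ (by positivity))
    exact le_sqrt_of_contraction (by positivity) hl3 (hN0 (j + 1)) le_rfl le_rfl (hN j)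

end

/-- The second order recursion. -/
structure SecondOrder (μ : Measure Z) (w : ℕ → ℕ → Z → Z → ℝ) (k₂ : ℕ → ℝ)
    (φ φ' : ℕ → Z → Z → ℝ) (a a' : ℕ → ℕ → Z → ℝ) (χ : ℕ → Z → Z → ℝ) (h : ℕ → ℕ → Z → ℝ) :
    Prop where
  isBdd_χ : ∀ j x, IsBdd μ (χ j x)
  isBdd_h : ∀ m j, IsBdd μ (h m j)
  abs_χ_le : ∀ j x z, |χ j x z| ≤ k₂ j
  zero : ∀ j x, h 0 j x = 0
  -- The second derivative of the logarithm of an integral is the mean of the second logarithmic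
  -- derivatives of the integrand plus the covariance of the first ones.
  succ : ∀ m j x, h (m + 1) j x = densMean μ (w m j x) (fun z => χ j x z + h m (j + 1) z) +
    densCov μ (w m j x) (fun z => φ j x z + a m (j + 1) z) fun z => φ' j x z + a' m (j + 1) z

section

variable {k₂ : ℕ → ℝ} {χ : ℕ → Z → Z → ℝ} {h : ℕ → ℕ → Z → ℝ}
  {W N U M : ℕ → ℝ} (hF : ForgettingDensities μ w lam e₀) (hW0 : ∀ j, 0 ≤ W j)
  (hW : ∀ j, lam ^ 4 * W (j + 1) + (2 * k₁ j) ^ 2 / (1 - lam ^ 4) ≤ W j)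
  (h₁ : FirstOrder μ w k₁ φ a) (h₁' : FirstOrder μ w k₁ φ' a')
  (h₂ : SecondOrder μ w k₂ φ φ' a a' χ h)
  (hU : ∀ j, lam ^ 4 * U (j + 1) + (2 * k₂ j + 2 * oscBound k₁ W j ^ 2) ≤ U j)
  (hU0 : ∀ j, 0 ≤ U j)

include hF hW0 hW h₁ h₁'

lemma FirstOrder.abs_densCov_le (m j : ℕ) (x : Z) :
    |densCov μ (w m j x) (fun z => φ j x z + a m (j + 1) z) fun z => φ' j x z + a' m (j + 1) z| ≤
      oscBound k₁ W j ^ 2 := by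
  rw [sq]
  exact _root_.abs_densCov_le (hF.isDensity m j x) ((h₁.isBdd_φ j x).add (h₁.isBdd_a m _))
    ((h₁'.isBdd_φ j x).add (h₁'.isBdd_a m _)) (h₁.oscLE_integrand hF hW0 hW m j x)
    (h₁'.oscLE_integrand hF hW0 hW m j x)

include h₂ hU hU0

/-- The covariance is at most the squared oscillation at every point, so it enters the contraction
as an additive error, counted at `x` and at `x'`. -/
lemma SecondOrder.oscLE (m j : ℕ) : OscLE (h m j) (U j) := by
  induction m generalizing j with
  | zero =>
    intro x x'
    simpa [h₂.zero] using hU0 j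
  | succ m ih =>
    intro x x'
    rw [h₂.succ, h₂.succ, densMean_add (hF.isDensity m j x) (h₂.isBdd_χ j x) (h₂.isBdd_h m _),
      densMean_add (hF.isDensity m j x') (h₂.isBdd_χ j x') (h₂.isBdd_h m _)]
    have k1 := abs_densMean_sub_densMean_le (hF.isDensity m j x) (hF.isDensity m j x')
      (hF.comparable m j x x') (h₂.isBdd_h m (j + 1)) (ih (j + 1))
    rw [sub_sub_cancel] at k1
    have k2 := abs_densMean_le (hF.isDensity m j x) (h₂.isBdd_χ j x) (h₂.abs_χ_le j x)
    have k3 := abs_densMean_le (hF.isDensity m j x') (h₂.isBdd_χ j x') (h₂.abs_χ_le j x')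
    have k4 := FirstOrder.abs_densCov_le hF hW0 hW h₁ h₁' m j x
    have k5 := FirstOrder.abs_densCov_le hF hW0 hW h₁ h₁' m j x'
    have k6 := hU j
    rw [abs_le] at *
    constructor <;> linarith

lemma SecondOrder.oscLE_integrand (m j : ℕ) (x : Z) :
    OscLE (fun z => χ j x z + h m (j + 1) z) (2 * k₂ j + U (j + 1)) :=
  (oscLE_of_abs_le (h₂.abs_χ_le j x)).add
    (SecondOrder.oscLE hF hW0 hW h₁ h₁' h₂ hU hU0 m (j + 1))

lemma SecondOrder.abs_succ_sub_le (m j : ℕ) (x x₀ : Z) :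
    |h (m + 1) j x - h m (j + 1) x₀| ≤ k₂ j + U (j + 1) + oscBound k₁ W j ^ 2 := by
  rw [h₂.succ]
  have k1 := abs_densMean_sub_le (hF.isDensity m j x) ((h₂.isBdd_χ j x).add (h₂.isBdd_h m (j + 1)))
    (c := h m (j + 1) x₀) (R := k₂ j + U (j + 1)) fun z => by
      have k1 := h₂.abs_χ_le j x z
      have k2 := SecondOrder.oscLE hF hW0 hW h₁ h₁' h₂ hU hU0 m (j + 1) z x₀
      rw [abs_le] at *
      constructor <;> linarith
  have k4 := FirstOrder.abs_densCov_le hF hW0 hW h₁ h₁' m j x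
  rw [abs_le] at *
  constructor <;> linarith

variable (hN0 : ∀ j, 0 ≤ N j) (hWN : ∀ j, W j ≤ N j)
  (hN : ∀ j, lam ^ 3 * N (j + 1) + (2 * e₀ / lam * oscBound k₁ W j) ^ 2 / (1 - lam ^ 3) ≤ N j)

include hN0 hWN hN

/-- The effect of one step on the difference of the second order quantities for two horizons. -/
lemma SecondOrder.exists_abs_le (b n j : ℕ) (x : Z) : ∃ r : ℝ,
    |r| ≤ lam ^ b * (e₀ * (2 * k₂ j + U (j + 1)) + 2 * (√(N (j + 1)) * oscBound k₁ W j) +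
      3 * e₀ * oscBound k₁ W j ^ 2) ∧
    h (b + n + 1) j x - h (b + 1) j x =
      densMean μ (w (b + n) j x) (fun z => h (b + n) (j + 1) z - h b (j + 1) z) + r := by
  have hl := hF.lam_pos
  have hdiff := (h₂.isBdd_h (b + n) (j + 1)).sub (h₂.isBdd_h b (j + 1))
  have hb2 := (h₂.isBdd_χ j x).add (h₂.isBdd_h b (j + 1))
  have e1 : densMean μ (w (b + n) j x) (fun z => χ j x z + h (b + n) (j + 1) z) =
      densMean μ (w (b + n) j x) (fun z => h (b + n) (j + 1) z - h b (j + 1) z) +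
      densMean μ (w (b + n) j x) fun z => χ j x z + h b (j + 1) z := by
    rw [← densMean_add (hF.isDensity _ j x) hdiff hb2]
    congr 1
    funext z
    ring
  have k1 := abs_densMean_sub_densMean_le_of_ratio (hF.isDensity (b + n) j x)
    (hF.isDensity b j x) (hF.ratio b n j x) hb2
    (SecondOrder.oscLE_integrand hF hW0 hW h₁ h₁' h₂ hU hU0 b j x)
  have f1 := fun m => (h₁.isBdd_φ j x).add (h₁.isBdd_a m (j + 1))
  have f2 := fun m => (h₁'.isBdd_φ j x).add (h₁'.isBdd_a m (j + 1))
  have o1 := h₁.oscLE_sub hF hW0 hW hN0 hWN hN b n (j + 1)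
  have o2 := h₁'.oscLE_sub hF hW0 hW hN0 hWN hN b n (j + 1)
  have k2 := abs_densCov_sub_densCov_le (hF.isDensity (b + n) j x) (f1 (b + n)) (f2 (b + n)) (f1 b)
    (f2 b) (d := lam ^ b * √(N (j + 1))) (fun z z' => by simpa using o1 z z')
    (fun z z' => by simpa using o2 z z') (h₁'.oscLE_integrand hF hW0 hW (b + n) j x)
    (h₁.oscLE_integrand hF hW0 hW b j x)
  have k3 := abs_densCov_sub_densCov_le_of_ratio (hF.isDensity (b + n) j x)
    (hF.isDensity b j x) (hF.ratio b n j x) (f1 b) (f2 b) (h₁.oscLE_integrand hF hW0 hW b j x)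
    (h₁'.oscLE_integrand hF hW0 hW b j x)
  have hle : lam ^ (4 * b) ≤ lam ^ b := pow_le_pow_of_le_one hl.le hF.lam_lt_one.le (by omega)
  have hk : 0 ≤ 2 * k₂ j + U (j + 1) := by
    have := (abs_nonneg _).trans (h₂.abs_χ_le j x x)
    have := hU0 (j + 1)
    positivity
  have k4 := mul_le_mul_of_nonneg_right hle (mul_nonneg hF.e₀_nonneg hk)
  have k5 := mul_le_mul_of_nonneg_right hle
    (mul_nonneg hF.e₀_nonneg (sq_nonneg (oscBound k₁ W j)))
  -- The remainder collects three effects: the change of density in the mean (`k1`), the change of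
  -- the functions in the covariance (`k2`) and the change of density in the covariance (`k3`).
  refine ⟨_, ?_, eq_add_of_sub_eq' rfl⟩
  rw [h₂.succ (b + n), h₂.succ b, e1]
  rw [abs_le] at *
  constructor <;> nlinarith

variable (hUM : ∀ j, U j ≤ M j)
  (hM : ∀ j, lam ^ 4 * M (j + 1) + 2 * (e₀ * (2 * k₂ j + U (j + 1)) +
    2 * (√(N (j + 1)) * oscBound k₁ W j) + 3 * e₀ * oscBound k₁ W j ^ 2) ≤ lam * M j)

include hUM hM

/-- The differences contract by `lam ^ 4`, and the remainders at `x` and at `x'` account for the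
factor 2 in the hypothesis on `M`. -/
lemma SecondOrder.oscLE_sub (b n j : ℕ) :
    OscLE (fun z => h (b + n) j z - h b j z) (lam ^ b * M j) := by
  have hl := hF.lam_pos
  induction b generalizing j with
  | zero =>
    intro x x'
    simp only [h₂.zero, sub_zero, pow_zero, one_mul, zero_add]
    exact (SecondOrder.oscLE hF hW0 hW h₁ h₁' h₂ hU hU0 n j x x').trans (hUM j)
  | succ b ih =>
    intro x x'
    have hdiff := (h₂.isBdd_h (b + n) (j + 1)).sub (h₂.isBdd_h b (j + 1))
    have h0 := abs_densMean_sub_densMean_le (hF.isDensity (b + n) j x)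
      (hF.isDensity (b + n) j x') (hF.comparable _ j x x') hdiff (ih (j + 1))
    rw [sub_sub_cancel] at h0
    obtain ⟨r, hr, er⟩ :=
      SecondOrder.exists_abs_le hF hW0 hW h₁ h₁' h₂ hU hU0 hN0 hWN hN b n j x
    obtain ⟨r', hr', er'⟩ :=
      SecondOrder.exists_abs_le hF hW0 hW h₁ h₁' h₂ hU hU0 hN0 hWN hN b n j x'
    have e3 : b + 1 + n = b + n + 1 := by ring
    simp only [e3]
    rw [er, er']
    have k := mul_le_mul_of_nonneg_left (hM j) (pow_nonneg hl.le b)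
    have e4 : lam ^ (b + 1) * M j = lam ^ b * (lam * M j) := by ring
    rw [e4]
    rw [abs_le] at *
    constructor <;> nlinarith

lemma SecondOrder.abs_succ_sub_succ_sub_le (b n j : ℕ) (x x₀ : Z) :
    |(h (b + n + 1) j x - h (b + 1) j x) - (h (b + n) (j + 1) x₀ - h b (j + 1) x₀)| ≤
      lam ^ b * (M (j + 1) + (e₀ * (2 * k₂ j + U (j + 1)) +
        2 * (√(N (j + 1)) * oscBound k₁ W j) + 3 * e₀ * oscBound k₁ W j ^ 2)) := by
  have hdiff := (h₂.isBdd_h (b + n) (j + 1)).sub (h₂.isBdd_h b (j + 1))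
  obtain ⟨r, hr, er⟩ :=
    SecondOrder.exists_abs_le hF hW0 hW h₁ h₁' h₂ hU hU0 hN0 hWN hN b n j x
  have h1 := abs_densMean_sub_le (hF.isDensity (b + n) j x) hdiff
    (c := h (b + n) (j + 1) x₀ - h b (j + 1) x₀) fun z =>
      SecondOrder.oscLE_sub hF hW0 hW h₁ h₁' h₂ hU hU0 hN0 hWN hN hUM hM b n (j + 1) z x₀
  rw [er]
  rw [abs_le] at *
  constructor <;> nlinarith

end

end Forgetting

/-! ### Iterated integrals of tame kernels -/

section KernelProducts

variable {E : Type*} [NormedAddCommGroup E] [NormedSpace ℝ E] {S : Set E} {C : ℝ≥0}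
variable {X : Type*} [MeasurableSpace X] {μ : Measure X}

/-- The integrals of the products of `m` successive kernels, starting at time `j` from `x`. -/
def iterInt (μ : Measure X) (K : ℕ → E → X → X → ℝ) : ℕ → ℕ → E → X → ℝ
  | 0, _, _, _ => 1
  | m + 1, j, θ, x => ∫ z, K j θ x z * iterInt μ K m (j + 1) θ z ∂μ

/-- Regularity of a sequence of positive kernels depending on a parameter in `S`. -/
structure TameKernels (S : Set E) (μ : Measure X) (K : ℕ → E → X → X → ℝ) (α : ℝ)
    (b₁ b₂ : ℕ → ℝ) : Prop where
  measurable : ∀ j, ∀ θ ∈ S, Measurable (Function.uncurry (K j θ))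
  tame : ∀ j x z, Tame S (b₁ j) (b₂ j) fun θ => K j θ x z
  b₁_nonneg : ∀ j, 0 ≤ b₁ j
  b₂_nonneg : ∀ j, 0 ≤ b₂ j
  bounded : ∀ j, ∃ B, 0 ≤ B ∧ ∀ θ ∈ S, ∀ x z, K j θ x z ≤ B
  α_pos : 0 < α
  α_le_one : α ≤ 1
  comparable : ∀ j, ∀ θ ∈ S, ∀ x x' z, α * K j θ x' z ≤ K j θ x z
  pos : ∀ j, ∀ θ ∈ S, ∀ x, 0 < ∫ z, K j θ x z ∂μ

variable {K : ℕ → E → X → X → ℝ} {α : ℝ} {b₁ b₂ : ℕ → ℝ} [IsFiniteMeasure μ]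

/-- The regularity of the iterated integrals. -/
structure TameIter (S : Set E) (f : E → X → ℝ) : Prop where
  measurable : ∀ θ ∈ S, Measurable (f θ)
  bounded : ∃ B, 0 ≤ B ∧ ∀ θ ∈ S, ∀ x, f θ x ≤ B
  tame : ∃ b₁ b₂ : ℝ, 0 ≤ b₁ ∧ 0 ≤ b₂ ∧ ∀ x, Tame S b₁ b₂ fun θ => f θ x
  pos : ∀ θ ∈ S, ∀ x, 0 < f θ x

lemma tame_const (c : ℝ) (hc : 0 ≤ c) : Tame S 0 0 fun _ => c := by
  refine ⟨contDiffOn_const, fun _ _ => hc, fun θ _ => ?_, fun θ _ => ?_⟩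
  · simp
  · have : fderivWithin ℝ (fun _ : E => c) S = fun _ => 0 := by
      funext τ; simp
    rw [fderivWithin₂, this]
    simp

variable [FiniteDimensional ℝ E]

/-- Multiplication by a tame kernel and integration preserve tameness. The constants obtained here
grow with `m` and serve only to justify differentiation; bounds independent of `m` for the
logarithmic derivatives come from forgetting. -/
lemma TameKernels.tameIter (hS : QuasiconvexWith C S) (hu : UniqueDiffOn ℝ S)
    (hK : TameKernels S μ K α b₁ b₂) (m j : ℕ) : TameIter S (iterInt μ K m j) := by
  induction m generalizing j with
  | zero =>
    exact ⟨fun _ _ => measurable_const, ⟨1, zero_le_one, fun _ _ _ => le_rfl⟩,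
      ⟨0, 0, le_rfl, le_rfl, fun _ => tame_const 1 zero_le_one⟩, fun _ _ _ => one_pos⟩
  | succ m ih =>
    obtain ⟨hm, ⟨B, hB0, hB⟩, ⟨c₁, c₂, hc₁, hc₂, ht⟩, hp⟩ := ih (j + 1)
    obtain ⟨B', hB'0, hB'⟩ := hK.bounded j
    have hm' : ∀ θ ∈ S, Measurable (Function.uncurry fun x z => K j θ x z * iterInt μ K m (j + 1) θ z) :=
      fun θ hθ => (hK.measurable j θ hθ).mul ((hm θ hθ).comp measurable_snd)
    have hK0 : ∀ θ ∈ S, ∀ x z, 0 ≤ K j θ x z := fun θ hθ x z => (hK.tame j x z).nonneg θ hθ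
    have hle : ∀ θ ∈ S, ∀ x z, K j θ x z * iterInt μ K m (j + 1) θ z ≤ B' * B := fun θ hθ x z =>
      mul_le_mul (hB' θ hθ x z) (hB θ hθ z) (hp θ hθ z).le hB'0
    have htame := fun x => Tame.integral hS hu (μ := μ)
      (f := fun θ z => K j θ x z * iterInt μ K m (j + 1) θ z)
      (fun θ hθ => ((hm' θ hθ).comp measurable_prodMk_left).aestronglyMeasurable)
      (.of_forall fun z => (hK.tame j x z).mul hu (ht z)) (B := fun _ => B' * B)
      (.of_forall fun z θ hθ => hle θ hθ x z) (integrable_const _)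
      (add_nonneg (hK.b₁_nonneg j) hc₁)
      (by have := hK.b₁_nonneg j; have := hK.b₂_nonneg j; positivity)
    refine ⟨fun θ hθ => ?_, ⟨B' * B * μ.real Set.univ, by positivity, fun θ hθ x => ?_⟩,
      ⟨_, _, add_nonneg (hK.b₁_nonneg j) hc₁,
        by have := hK.b₁_nonneg j; have := hK.b₂_nonneg j; positivity, fun x => (htame x).1⟩,
      fun θ hθ x => ?_⟩
    · exact ((hm' θ hθ).stronglyMeasurable.integral_prod_right (ν := μ)).measurable
    · have := integral_mono ((htame x).2.2.2 θ hθ).1 (integrable_const (B' * B)) (hle θ hθ x)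
      rw [integral_const, smul_eq_mul, mul_comm] at this
      exact this
    · have hi := ((htame x).2.2.2 θ hθ).1
      have h0 : ∀ z, 0 ≤ K j θ x z * iterInt μ K m (j + 1) θ z := fun z =>
        mul_nonneg (hK0 θ hθ x z) (hp θ hθ z).le
      have hKi : Integrable (K j θ x) μ := by
        by_contra h
        exact (hK.pos j θ hθ x).ne' (integral_undef h)
      -- The second factor is strictly positive, so the support is that of the kernel, which has
      -- positive measure.
      refine (integral_pos_iff_support_of_nonneg h0 hi).2 ?_
      have := (integral_pos_iff_support_of_nonneg (hK0 θ hθ x) hKi).1 (hK.pos j θ hθ x)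
      convert this using 2
      ext z
      simp [(hp θ hθ z).ne']

/-- The conditional densities of the next state given the present state and `m + 1` future
observations. -/
def iterDens (μ : Measure X) (K : ℕ → E → X → X → ℝ) (θ : E) (m j : ℕ) (x z : X) : ℝ :=
  K j θ x z * iterInt μ K m (j + 1) θ z / iterInt μ K (m + 1) j θ x

section

variable (hS : QuasiconvexWith C S) (hu : UniqueDiffOn ℝ S) (hK : TameKernels S μ K α b₁ b₂)

include hS hu hK

lemma TameKernels.integrable_mul (m j : ℕ) {θ : E} (hθ : θ ∈ S) (x : X) :
    Integrable (fun z => K j θ x z * iterInt μ K m (j + 1) θ z) μ := by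
  obtain ⟨hm, ⟨B, hB0, hB⟩, -, hp⟩ := hK.tameIter hS hu m (j + 1)
  obtain ⟨B', hB'0, hB'⟩ := hK.bounded j
  refine (integrable_const (B' * B)).mono'
    (((hK.measurable j θ hθ).comp measurable_prodMk_left).mul (hm θ hθ)).aestronglyMeasurable
    (.of_forall fun z => ?_)
  have hK0 := (hK.tame j x z).nonneg θ hθ
  rw [Real.norm_of_nonneg (mul_nonneg hK0 (hp θ hθ z).le)]
  exact mul_le_mul (hB' θ hθ x z) (hB θ hθ z) (hp θ hθ z).le hB'0

lemma TameKernels.isDensity (m j : ℕ) {θ : E} (hθ : θ ∈ S) (x : X) :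
    IsDensity μ (iterDens μ K θ m j x) := by
  have hp := (hK.tameIter hS hu (m + 1) j).pos θ hθ x
  refine ⟨(hK.integrable_mul hS hu m j hθ x).div_const _, fun z => ?_, ?_⟩
  · exact div_nonneg (mul_nonneg ((hK.tame j x z).nonneg θ hθ)
      ((hK.tameIter hS hu m (j + 1)).pos θ hθ z).le) hp.le
  · simp only [iterDens, integral_div]
    exact div_self hp.ne'

lemma TameKernels.mul_iterInt_le (m j : ℕ) {θ : E} (hθ : θ ∈ S) (x x' : X) :
    α * iterInt μ K (m + 1) j θ x' ≤ iterInt μ K (m + 1) j θ x := by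
  simp only [iterInt]
  rw [← integral_const_mul]
  refine integral_mono ((hK.integrable_mul hS hu m j hθ x').const_mul α)
    (hK.integrable_mul hS hu m j hθ x) fun z => ?_
  have := mul_le_mul_of_nonneg_right (hK.comparable j θ hθ x x' z)
    ((hK.tameIter hS hu m (j + 1)).pos θ hθ z).le
  simp only
  linarith

/-- One factor `α` compares the kernels in the numerators, the other the normalizing integrals. -/
lemma TameKernels.iterDens_comparable (m j : ℕ) {θ : E} (hθ : θ ∈ S) (x x' z : X) :
    α ^ 2 * iterDens μ K θ m j x' z ≤ iterDens μ K θ m j x z := by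
  have hp := (hK.tameIter hS hu (m + 1) j).pos θ hθ x
  have hp' := (hK.tameIter hS hu (m + 1) j).pos θ hθ x'
  have hz := (hK.tameIter hS hu m (j + 1)).pos θ hθ z
  have hα := hK.α_pos
  have h1 := hK.comparable j θ hθ x x' z
  have h2 := hK.mul_iterInt_le hS hu m j hθ x' x
  have hK0 := (hK.tame j x z).nonneg θ hθ
  rw [iterDens, iterDens, ← mul_div_assoc, div_le_div_iff₀ hp' hp]
  calc α ^ 2 * (K j θ x' z * iterInt μ K m (j + 1) θ z) * iterInt μ K (m + 1) j θ x
      = (α * K j θ x' z) * (α * iterInt μ K (m + 1) j θ x) * iterInt μ K m (j + 1) θ z := by ring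
    _ ≤ K j θ x z * iterInt μ K (m + 1) j θ x' * iterInt μ K m (j + 1) θ z := by gcongr
    _ = _ := by ring

/-- The likelihood ratio of two horizons is nearly constant. -/
lemma TameKernels.ratio_osc {lam : ℝ} (hlam : 1 - lam ^ 4 ≤ α ^ 2) (b n j : ℕ) {θ : E}
    (hθ : θ ∈ S) (z z' z'' : X) :
    |iterInt μ K (b + n) j θ z / iterInt μ K b j θ z -
      iterInt μ K (b + n) j θ z' / iterInt μ K b j θ z'| ≤
      α⁻¹ * lam ^ (4 * b) * (iterInt μ K (b + n) j θ z'' / iterInt μ K b j θ z'') := by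
  have hα := hK.α_pos
  induction b generalizing j z z' z'' with
  | zero =>
    -- Without a shorter horizon the ratio is the iterated integral itself, whose values at
    -- different points are comparable with factor `α`.
    simp only [zero_add, iterInt, div_one, mul_zero, pow_zero, mul_one]
    cases n with
    | zero =>
      simp only [iterInt, sub_self, abs_zero, mul_one]
      positivity
    | succ n =>
      have h1 := hK.mul_iterInt_le hS hu n j hθ z'' z
      have h2 := hK.mul_iterInt_le hS hu n j hθ z'' z'
      have p1 := (hK.tameIter hS hu (n + 1) j).pos θ hθ z
      have p2 := (hK.tameIter hS hu (n + 1) j).pos θ hθ z'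
      rw [inv_mul_eq_div, le_div_iff₀ hα, mul_comm, ← abs_of_pos hα, ← abs_mul, mul_sub,
        abs_le]
      constructor <;> nlinarith
  | succ b ih =>
    have e3 : b + 1 + n = b + n + 1 := by ring
    rw [e3]
    set r : X → ℝ := fun z => iterInt μ K (b + n) (j + 1) θ z / iterInt μ K b (j + 1) θ z with hr
    have hm : Measurable r := ((hK.tameIter hS hu (b + n) (j + 1)).measurable θ hθ).div
      ((hK.tameIter hS hu b (j + 1)).measurable θ hθ)
    have hr0 : ∀ z, 0 ≤ r z := fun z => div_nonneg
      ((hK.tameIter hS hu (b + n) (j + 1)).pos θ hθ z).le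
      ((hK.tameIter hS hu b (j + 1)).pos θ hθ z).le
    have hosc : ∀ z'', OscLE r (α⁻¹ * lam ^ (4 * b) * r z'') := fun z'' z z' => ih (j + 1) z z' z''
    have hbd : IsBdd μ r := ⟨hm.aestronglyMeasurable,
      r z + α⁻¹ * lam ^ (4 * b) * r z, fun y => by
        have := hosc z y z
        have h0 := hr0 y
        rw [abs_le] at *
        constructor <;> linarith [hr0 z, this.2, this.1]⟩
    -- The ratio at time `j` is the conditional mean of the ratio at time `j + 1`, so its
    -- oscillation contracts by `lam ^ 4`.
    have key : ∀ x, iterInt μ K (b + n + 1) j θ x / iterInt μ K (b + 1) j θ x =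
        densMean μ (iterDens μ K θ b j x) r := fun x => by
      have hp := (hK.tameIter hS hu (b + 1) j).pos θ hθ x
      rw [div_eq_iff hp.ne', densMean, ← integral_mul_const, iterInt]
      refine integral_congr_ae (.of_forall fun y => ?_)
      have hp' := (hK.tameIter hS hu b (j + 1)).pos θ hθ y
      simp only [iterDens, hr]
      field_simp
    rw [key, key, key]
    have hd := fun x => hK.isDensity hS hu b j hθ x
    have h1 : ∀ y, |densMean μ (iterDens μ K θ b j z) r - densMean μ (iterDens μ K θ b j z') r| ≤
        α⁻¹ * lam ^ (4 * (b + 1)) * r y := fun y => by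
      have := abs_densMean_sub_densMean_le (hd z) (hd z') (α := 1 - lam ^ 4) (fun y =>
        (mul_le_mul_of_nonneg_right hlam ((hd z').nonneg y)).trans
          (hK.iterDens_comparable hS hu b j hθ z z' y)) hbd (hosc y)
      refine this.trans (le_of_eq ?_)
      ring
    set D := |densMean μ (iterDens μ K θ b j z) r - densMean μ (iterDens μ K θ b j z') r|
    have h2 := (hd z'').integral_eq_one
    -- The bound by `r y` holds for every `y`. Averaging it under the density from `z''` turns `r y`
    -- into the ratio at `z''`, so the estimate remains relative.
    calc D = ∫ y, iterDens μ K θ b j z'' y * D ∂μ := by rw [integral_mul_const, h2, one_mul]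
      _ ≤ ∫ y, α⁻¹ * lam ^ (4 * (b + 1)) * (iterDens μ K θ b j z'' y * r y) ∂μ := by
        refine integral_mono ((hd z'').integrable.mul_const D)
          ((integrable_mul_isBdd (hd z'').integrable hbd).const_mul _) fun y => ?_
        have := mul_le_mul_of_nonneg_left (h1 y) ((hd z'').nonneg y)
        simp only
        linarith
      _ = _ := by rw [integral_const_mul]; rfl

/-- The density for horizon `b + n` is that for horizon `b` times `r z / R`, where `R` is the mean
of `r`. Hence the relative change is `(r z - R) / R`, controlled by the relative oscillation of `r`.
-/
lemma TameKernels.forgettingDensities {lam : ℝ} (hl0 : 0 < lam) (hl1 : lam < 1)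
    (hlam : 1 - lam ^ 4 ≤ α ^ 2) {θ : E} (hθ : θ ∈ S) :
    ForgettingDensities μ (iterDens μ K θ) lam α⁻¹ := by
  refine ⟨hl0, hl1, inv_nonneg.2 hK.α_pos.le, fun m j x => hK.isDensity hS hu m j hθ x,
    fun m j x x' z => (mul_le_mul_of_nonneg_right hlam
      ((hK.isDensity hS hu m j hθ x').nonneg z)).trans (hK.iterDens_comparable hS hu m j hθ x x' z),
    fun b n j x z => ?_⟩
  set r : X → ℝ := fun z => iterInt μ K (b + n) (j + 1) θ z / iterInt μ K b (j + 1) θ z with hr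
  set R := iterInt μ K (b + n + 1) j θ x / iterInt μ K (b + 1) j θ x with hR
  have p1 := (hK.tameIter hS hu (b + n + 1) j).pos θ hθ x
  have p2 := (hK.tameIter hS hu (b + 1) j).pos θ hθ x
  have p3 := fun z => (hK.tameIter hS hu b (j + 1)).pos θ hθ z
  have p4 := fun z => (hK.tameIter hS hu (b + n) (j + 1)).pos θ hθ z
  have hR0 : 0 < R := div_pos p1 p2
  have hd := hK.isDensity hS hu b j hθ x
  have hm : Measurable r := ((hK.tameIter hS hu (b + n) (j + 1)).measurable θ hθ).div
    ((hK.tameIter hS hu b (j + 1)).measurable θ hθ)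
  have hosc : ∀ z'', OscLE r (α⁻¹ * lam ^ (4 * b) * r z'') := fun z'' y y' =>
    hK.ratio_osc hS hu hlam b n (j + 1) hθ y y' z''
  have hbd : IsBdd μ r := ⟨hm.aestronglyMeasurable, |r z| + α⁻¹ * lam ^ (4 * b) * r z, fun y => by
    have h1 := hosc z y z
    have h2 := abs_add_le (r y - r z) (r z)
    rw [sub_add_cancel] at h2
    linarith⟩
  have key : R = densMean μ (iterDens μ K θ b j x) r := by
    rw [hR, div_eq_iff p2.ne', densMean, ← integral_mul_const, iterInt]
    refine integral_congr_ae (.of_forall fun y => ?_)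
    have hp' := p3 y
    simp only [iterDens, hr]
    field_simp
  have hrel : ∀ y, |r z - R| ≤ α⁻¹ * lam ^ (4 * b) * r y := fun y => by
    rw [key]
    exact abs_sub_densMean_le hd hbd (hosc y) z
  have hmean : |r z - R| ≤ α⁻¹ * lam ^ (4 * b) * R := by
    set D := |r z - R|
    calc D = ∫ y, iterDens μ K θ b j x y * D ∂μ := by
          rw [integral_mul_const, hd.integral_eq_one, one_mul]
      _ ≤ ∫ y, α⁻¹ * lam ^ (4 * b) * (iterDens μ K θ b j x y * r y) ∂μ := by
        refine integral_mono (hd.integrable.mul_const D)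
          ((integrable_mul_isBdd hd.integrable hbd).const_mul _) fun y => ?_
        have := mul_le_mul_of_nonneg_left (hrel y) (hd.nonneg y)
        simp only
        linarith
      _ = _ := by rw [integral_const_mul, key]; rfl
  have e : iterDens μ K θ (b + n) j x z - iterDens μ K θ b j x z =
      iterDens μ K θ b j x z * ((r z - R) / R) := by
    have := p3 z
    simp only [iterDens, hr, hR]
    field_simp
  rw [e, abs_mul, abs_of_nonneg (hd.nonneg z), mul_comm, abs_div, abs_of_pos hR0]
  exact mul_le_mul_of_nonneg_right ((div_le_iff₀ hR0).2 hmean) (hd.nonneg z)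

end

end KernelProducts

/-! ### Derivatives of the logarithms of iterated integrals -/

section LogDerivatives

variable {E : Type*} [NormedAddCommGroup E] [NormedSpace ℝ E] {S : Set E} {C : ℝ≥0}
variable {X : Type*} [MeasurableSpace X] {μ : Measure X}

/-- The first derivative of the logarithm of an iterated integral. -/
def logDeriv₁ (S : Set E) (μ : Measure X) (K : ℕ → E → X → X → ℝ) (m j : ℕ) (θ : E) (x : X) :
    E →L[ℝ] ℝ :=
  fderivWithin ℝ (fun τ => Real.log (iterInt μ K m j τ x)) S θ

/-- The second derivative of the logarithm of an iterated integral. -/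
def logDeriv₂ (S : Set E) (μ : Measure X) (K : ℕ → E → X → X → ℝ) (m j : ℕ) (θ : E) (x : X) :
    E →L[ℝ] E →L[ℝ] ℝ :=
  fderivWithin₂ (fun τ => Real.log (iterInt μ K m j τ x)) S θ

/-- The derivative of `log K` in the direction `u`. -/
def kernelScore (S : Set E) (K : ℕ → E → X → X → ℝ) (θ u : E) (j : ℕ) (x z : X) : ℝ :=
  (K j θ x z)⁻¹ * fderivWithin ℝ (fun τ => K j τ x z) S θ u

/-- The second derivative of `log K` in the directions `u`, `v`. -/
def kernelHessian (S : Set E) (K : ℕ → E → X → X → ℝ) (θ u v : E) (j : ℕ) (x z : X) : ℝ :=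
  (K j θ x z)⁻¹ * fderivWithin₂ (fun τ => K j τ x z) S θ u v -
    (K j θ x z ^ 2)⁻¹ * (fderivWithin ℝ (fun τ => K j τ x z) S θ u *
      fderivWithin ℝ (fun τ => K j τ x z) S θ v)

lemma Tame.abs_apply_le {b₁ b₂ : ℝ} {f : E → ℝ} (hf : Tame S b₁ b₂ f) {θ u : E} (hθ : θ ∈ S)
    (hu1 : ‖u‖ ≤ 1) : |fderivWithin ℝ f S θ u| ≤ b₁ * f θ :=
  ((ContinuousLinearMap.le_opNorm _ u).trans
    (mul_le_of_le_one_right (norm_nonneg _) hu1)).trans (hf.norm_fderivWithin_le θ hθ)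

lemma Tame.abs_apply₂_le {b₁ b₂ : ℝ} {f : E → ℝ} (hf : Tame S b₁ b₂ f) {θ u v : E} (hθ : θ ∈ S)
    (hu1 : ‖u‖ ≤ 1) (hv1 : ‖v‖ ≤ 1) : |fderivWithin₂ f S θ u v| ≤ b₂ * f θ :=
  ((ContinuousLinearMap.le_opNorm _ v).trans
    (mul_le_of_le_one_right (norm_nonneg _) hv1)).trans <|
  ((ContinuousLinearMap.le_opNorm _ u).trans
    (mul_le_of_le_one_right (norm_nonneg _) hu1)).trans (hf.norm_fderivWithin₂_le θ hθ)

lemma Tame.abs_inv_mul_apply_le {b₁ b₂ : ℝ} {f : E → ℝ} (hf : Tame S b₁ b₂ f) (hb : 0 ≤ b₁)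
    {θ u : E} (hθ : θ ∈ S) (hu1 : ‖u‖ ≤ 1) : |(f θ)⁻¹ * fderivWithin ℝ f S θ u| ≤ b₁ := by
  have h0 := hf.nonneg θ hθ
  have h1 := hf.abs_apply_le hθ hu1
  rcases h0.eq_or_lt with h | h
  -- At a zero of `f` the inverse is zero by convention, so the quotient vanishes.
  · simpa [← h] using hb
  · rw [abs_mul, abs_inv, abs_of_pos h, inv_mul_le_iff₀ h, mul_comm]
    exact h1

lemma Tame.abs_hessian_le {b₁ b₂ : ℝ} {f : E → ℝ} (hf : Tame S b₁ b₂ f) (hb : 0 ≤ b₁)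
    (hb' : 0 ≤ b₂) {θ u v : E} (hθ : θ ∈ S) (hu1 : ‖u‖ ≤ 1) (hv1 : ‖v‖ ≤ 1) :
    |(f θ)⁻¹ * fderivWithin₂ f S θ u v - (f θ ^ 2)⁻¹ *
      (fderivWithin ℝ f S θ u * fderivWithin ℝ f S θ v)| ≤ b₂ + b₁ ^ 2 := by
  have h0 := hf.nonneg θ hθ
  have h1 := hf.abs_inv_mul_apply_le hb hθ hu1
  have h1' := hf.abs_inv_mul_apply_le hb hθ hv1
  have h2 : |(f θ)⁻¹ * fderivWithin₂ f S θ u v| ≤ b₂ := by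
    have h1 := hf.abs_apply₂_le hθ hu1 hv1
    rcases h0.eq_or_lt with h | h
    · simpa [← h] using hb'
    · rw [abs_mul, abs_inv, abs_of_pos h, inv_mul_le_iff₀ h, mul_comm]
      exact h1
  have e : (f θ ^ 2)⁻¹ * (fderivWithin ℝ f S θ u * fderivWithin ℝ f S θ v) =
    ((f θ)⁻¹ * fderivWithin ℝ f S θ u) * ((f θ)⁻¹ * fderivWithin ℝ f S θ v) := by
    rw [sq, mul_inv]; ring
  rw [e]
  refine (abs_sub _ _).trans (add_le_add h2 ?_)
  rw [abs_mul, sq]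
  exact mul_le_mul h1 h1' (abs_nonneg _) hb

variable {K : ℕ → E → X → X → ℝ} {α : ℝ} {b₁ b₂ : ℕ → ℝ} [IsFiniteMeasure μ]
  [FiniteDimensional ℝ E]

lemma TameIter.aestronglyMeasurable {f : E → X → ℝ} (hf : TameIter S f) (hu : UniqueDiffOn ℝ S)
    {θ : E} (hθ : θ ∈ S) (ρ : Measure X) : AEStronglyMeasurable (f θ) ρ ∧
      AEStronglyMeasurable (fun z => fderivWithin ℝ (fun τ => f τ z) S θ) ρ ∧
      AEStronglyMeasurable (fun z => fderivWithin₂ (fun τ => f τ z) S θ) ρ := by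
  obtain ⟨b₁, b₂, -, -, ht⟩ := hf.tame
  have hm0 : ∀ θ ∈ S, AEStronglyMeasurable (f θ) ρ := fun θ hθ =>
    (hf.measurable θ hθ).aestronglyMeasurable
  have hm1 : ∀ θ ∈ S, AEStronglyMeasurable (fun z => fderivWithin ℝ (fun θ => f θ z) S θ) ρ :=
    fun θ hθ => aestronglyMeasurable_fderivWithin (hu θ hθ) hθ hm0
      (.of_forall fun z =>
        (((contDiffOn_two_iff hu).1 (ht z).contDiffOn).1 θ hθ).differentiableWithinAt)
  exact ⟨hm0 θ hθ, hm1 θ hθ, aestronglyMeasurable_fderivWithin (hu θ hθ) hθ hm1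
      (.of_forall fun z =>
        (((contDiffOn_two_iff hu).1 (ht z).contDiffOn).2.1 θ hθ).differentiableWithinAt)⟩

section

variable (hS : QuasiconvexWith C S) (hu : UniqueDiffOn ℝ S) (hK : TameKernels S μ K α b₁ b₂)

include hu hK in
omit [IsFiniteMeasure μ] in
lemma TameKernels.aestronglyMeasurable (j : ℕ) (x : X) {θ : E} (hθ : θ ∈ S) :
    AEStronglyMeasurable (K j θ x) μ ∧
      AEStronglyMeasurable (fun z => fderivWithin ℝ (fun τ => K j τ x z) S θ) μ ∧
      AEStronglyMeasurable (fun z => fderivWithin₂ (fun τ => K j τ x z) S θ) μ := by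
  have hm0 : ∀ θ ∈ S, AEStronglyMeasurable (K j θ x) μ := fun θ hθ =>
    ((hK.measurable j θ hθ).comp measurable_prodMk_left).aestronglyMeasurable
  have hm1 : ∀ θ ∈ S, AEStronglyMeasurable (fun z => fderivWithin ℝ (fun τ => K j τ x z) S θ) μ :=
    fun θ hθ => aestronglyMeasurable_fderivWithin (hu θ hθ) hθ hm0
      (.of_forall fun z =>
        (((contDiffOn_two_iff hu).1 (hK.tame j x z).contDiffOn).1 θ hθ).differentiableWithinAt)
  exact ⟨hm0 θ hθ, hm1 θ hθ, aestronglyMeasurable_fderivWithin (hu θ hθ) hθ hm1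
      (.of_forall fun z =>
        (((contDiffOn_two_iff hu).1 (hK.tame j x z).contDiffOn).2.1 θ hθ).differentiableWithinAt)⟩

include hS hu hK

lemma TameKernels.logDeriv₁_apply (m j : ℕ) {θ : E} (hθ : θ ∈ S) (x : X) (u : E) :
    logDeriv₁ S μ K m j θ x u =
      (iterInt μ K m j θ x)⁻¹ * fderivWithin ℝ (fun τ => iterInt μ K m j τ x) S θ u := by
  have h := hK.tameIter hS hu m j
  obtain ⟨c₁, c₂, -, -, ht⟩ := h.tame
  rw [logDeriv₁, fderivWithin_log_of_contDiffOn hu (ht x).contDiffOn hθ (h.pos θ hθ x).ne']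
  rfl

lemma TameKernels.logDeriv₂_apply (m j : ℕ) {θ : E} (hθ : θ ∈ S) (x : X) (u v : E) :
    logDeriv₂ S μ K m j θ x u v =
      (iterInt μ K m j θ x)⁻¹ * fderivWithin₂ (fun τ => iterInt μ K m j τ x) S θ u v -
      (iterInt μ K m j θ x ^ 2)⁻¹ * (fderivWithin ℝ (fun τ => iterInt μ K m j τ x) S θ u *
        fderivWithin ℝ (fun τ => iterInt μ K m j τ x) S θ v) := by
  have h := hK.tameIter hS hu m j
  obtain ⟨c₁, c₂, -, -, ht⟩ := h.tame
  rw [logDeriv₂, fderivWithin₂_log_of_contDiffOn hu (ht x).contDiffOn hθ (h.pos θ hθ x).ne']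
  rfl

lemma TameKernels.isBdd_logDeriv₁ (m j : ℕ) {θ u : E} (hθ : θ ∈ S) (hu1 : ‖u‖ ≤ 1) :
    IsBdd μ fun x => logDeriv₁ S μ K m j θ x u := by
  have h := hK.tameIter hS hu m j
  obtain ⟨c₁, c₂, h1, -, ht⟩ := h.tame
  obtain ⟨m0, m1, -⟩ := h.aestronglyMeasurable hu hθ μ
  simp only [hK.logDeriv₁_apply hS hu m j hθ]
  exact ⟨m0.inv₀.mul (m1.apply_continuousLinearMap u), c₁,
    fun z => (ht z).abs_inv_mul_apply_le h1 hθ hu1⟩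

lemma TameKernels.isBdd_logDeriv₂ (m j : ℕ) {θ u v : E} (hθ : θ ∈ S) (hu1 : ‖u‖ ≤ 1)
    (hv1 : ‖v‖ ≤ 1) : IsBdd μ fun x => logDeriv₂ S μ K m j θ x u v := by
  have h := hK.tameIter hS hu m j
  obtain ⟨c₁, c₂, h1, h2, ht⟩ := h.tame
  obtain ⟨m0, m1, m2⟩ := h.aestronglyMeasurable hu hθ μ
  simp only [hK.logDeriv₂_apply hS hu m j hθ]
  exact ⟨(m0.inv₀.mul ((m2.apply_continuousLinearMap u).apply_continuousLinearMap v)).sub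
    ((m0.pow 2).inv₀.mul ((m1.apply_continuousLinearMap u).mul (m1.apply_continuousLinearMap v))),
    c₂ + c₁ ^ 2, fun z => (ht z).abs_hessian_le h1 h2 hθ hu1 hv1⟩

omit [IsFiniteMeasure μ] hS in
lemma TameKernels.isBdd_kernelScore (j : ℕ) (x : X) {θ u : E} (hθ : θ ∈ S) (hu1 : ‖u‖ ≤ 1) :
    IsBdd μ (kernelScore S K θ u j x) := by
  obtain ⟨m0, m1, -⟩ := hK.aestronglyMeasurable hu j x hθ
  exact ⟨m0.inv₀.mul (m1.apply_continuousLinearMap u), b₁ j,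
    fun z => (hK.tame j x z).abs_inv_mul_apply_le (hK.b₁_nonneg j) hθ hu1⟩

omit [IsFiniteMeasure μ] hS in
lemma TameKernels.isBdd_kernelHessian (j : ℕ) (x : X) {θ u v : E} (hθ : θ ∈ S) (hu1 : ‖u‖ ≤ 1)
    (hv1 : ‖v‖ ≤ 1) : IsBdd μ (kernelHessian S K θ u v j x) := by
  obtain ⟨m0, m1, m2⟩ := hK.aestronglyMeasurable hu j x hθ
  exact ⟨(m0.inv₀.mul ((m2.apply_continuousLinearMap u).apply_continuousLinearMap v)).sub
    ((m0.pow 2).inv₀.mul ((m1.apply_continuousLinearMap u).mul (m1.apply_continuousLinearMap v))),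
    b₂ j + b₁ j ^ 2,
    fun z => (hK.tame j x z).abs_hessian_le (hK.b₁_nonneg j) (hK.b₂_nonneg j) hθ hu1 hv1⟩

lemma TameKernels.tame_integral (m j : ℕ) (x : X) :
    (∀ θ ∈ S, fderivWithin ℝ (fun τ => iterInt μ K (m + 1) j τ x) S θ =
      ∫ z, fderivWithin ℝ (fun τ => K j τ x z * iterInt μ K m (j + 1) τ z) S θ ∂μ) ∧
    (∀ θ ∈ S, fderivWithin₂ (fun τ => iterInt μ K (m + 1) j τ x) S θ =
      ∫ z, fderivWithin₂ (fun τ => K j τ x z * iterInt μ K m (j + 1) τ z) S θ ∂μ) ∧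
    (∀ θ ∈ S, Integrable (fun z => fderivWithin ℝ (fun τ => K j τ x z *
        iterInt μ K m (j + 1) τ z) S θ) μ ∧
      Integrable (fun z => fderivWithin₂ (fun τ => K j τ x z *
        iterInt μ K m (j + 1) τ z) S θ) μ) := by
  obtain ⟨hm, ⟨B, hB0, hB⟩, ⟨c₁, c₂, hc₁, hc₂, ht⟩, hp⟩ := hK.tameIter hS hu m (j + 1)
  obtain ⟨B', hB'0, hB'⟩ := hK.bounded j
  have htame := Tame.integral hS hu (μ := μ)
      (f := fun θ z => K j θ x z * iterInt μ K m (j + 1) θ z)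
      (fun θ hθ => (hK.integrable_mul hS hu m j hθ x).aestronglyMeasurable)
      (.of_forall fun z => (hK.tame j x z).mul hu (ht z)) (B := fun _ => B' * B)
      (.of_forall fun z θ hθ => mul_le_mul (hB' θ hθ x z) (hB θ hθ z) (hp θ hθ z).le hB'0)
      (integrable_const _)
      (add_nonneg (hK.b₁_nonneg j) hc₁)
      (by have := hK.b₁_nonneg j; have := hK.b₂_nonneg j; positivity)
  exact ⟨htame.2.1, htame.2.2.1, fun θ hθ => (htame.2.2.2 θ hθ).2⟩

/-- Fisher's identity: differentiation under the integral, followed by normalization, represents the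
score as a conditional mean of the score of the integrand. -/
lemma TameKernels.fderivWithin_iterInt (m j : ℕ) (x : X) {θ : E} (hθ : θ ∈ S) (u : E) :
    fderivWithin ℝ (fun τ => iterInt μ K (m + 1) j τ x) S θ u = iterInt μ K (m + 1) j θ x *
      densMean μ (iterDens μ K θ m j x)
        fun z => kernelScore S K θ u j x z + logDeriv₁ S μ K m (j + 1) θ z u := by
  obtain ⟨e1, -, hi⟩ := hK.tame_integral hS hu m j x
  have hp := (hK.tameIter hS hu (m + 1) j).pos θ hθ x
  rw [e1 θ hθ, ContinuousLinearMap.integral_apply (hi θ hθ).1, densMean, ← integral_const_mul]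
  refine integral_congr_ae (.of_forall fun z => ?_)
  obtain ⟨c₁, c₂, -, -, ht⟩ := (hK.tameIter hS hu m (j + 1)).tame
  have hz := (hK.tameIter hS hu m (j + 1)).pos θ hθ z
  simp only [hK.logDeriv₁_apply hS hu m (j + 1) hθ, kernelScore, iterDens]
  rw [fderivWithin_mul_of_contDiffOn hu (hK.tame j x z).contDiffOn (ht z).contDiffOn hθ]
  have h0 := (hK.tame j x z).norm_fderivWithin_le θ hθ
  simp only [add_apply, smul_apply, smul_eq_mul]
  -- Where the kernel vanishes, tameness forces its derivative to vanish too, so the conventional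
  -- value of the quotient is harmless.
  by_cases hk : K j θ x z = 0
  · rw [hk, mul_zero] at h0
    rw [norm_le_zero_iff.1 h0, hk]
    simp
  · field_simp
    ring

lemma TameKernels.fderivWithin₂_iterInt (m j : ℕ) (x : X) {θ : E} (hθ : θ ∈ S) (u v : E) :
    fderivWithin₂ (fun τ => iterInt μ K (m + 1) j τ x) S θ u v = iterInt μ K (m + 1) j θ x *
      densMean μ (iterDens μ K θ m j x)
        fun z => (kernelHessian S K θ u v j x z + logDeriv₂ S μ K m (j + 1) θ z u v) +
          (kernelScore S K θ u j x z + logDeriv₁ S μ K m (j + 1) θ z u) *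
          (kernelScore S K θ v j x z + logDeriv₁ S μ K m (j + 1) θ z v) := by
  obtain ⟨-, e1, hi⟩ := hK.tame_integral hS hu m j x
  have hp := (hK.tameIter hS hu (m + 1) j).pos θ hθ x
  rw [e1 θ hθ, ContinuousLinearMap.integral_apply (hi θ hθ).2,
    ContinuousLinearMap.integral_apply ((hi θ hθ).2.apply_continuousLinearMap u), densMean,
    ← integral_const_mul]
  refine integral_congr_ae (.of_forall fun z => ?_)
  obtain ⟨c₁, c₂, -, -, ht⟩ := (hK.tameIter hS hu m (j + 1)).tame
  have hz := (hK.tameIter hS hu m (j + 1)).pos θ hθ z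
  simp only [hK.logDeriv₁_apply hS hu m (j + 1) hθ, hK.logDeriv₂_apply hS hu m (j + 1) hθ,
    kernelScore, kernelHessian, iterDens]
  rw [fderivWithin₂_mul_of_contDiffOn hu (hK.tame j x z).contDiffOn (ht z).contDiffOn hθ]
  have h0 := (hK.tame j x z).norm_fderivWithin_le θ hθ
  have h0' := (hK.tame j x z).norm_fderivWithin₂_le θ hθ
  simp only [add_apply, smul_apply, smul_eq_mul,
    ContinuousLinearMap.smulRight_apply]
  by_cases hk : K j θ x z = 0
  · rw [hk, mul_zero] at h0 h0'
    rw [norm_le_zero_iff.1 h0, norm_le_zero_iff.1 h0', hk]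
    simp
  · field_simp
    ring

lemma TameKernels.firstOrder {θ u : E} (hθ : θ ∈ S) (hu1 : ‖u‖ ≤ 1) :
    FirstOrder μ (iterDens μ K θ) b₁ (kernelScore S K θ u)
      fun m j x => logDeriv₁ S μ K m j θ x u := by
  refine ⟨fun j x => hK.isBdd_kernelScore hu j x hθ hu1,
    fun m j => hK.isBdd_logDeriv₁ hS hu m j hθ hu1,
    fun j x z => (hK.tame j x z).abs_inv_mul_apply_le (hK.b₁_nonneg j) hθ hu1,
    fun j x => ?_, fun m j x => ?_⟩
  · simp [logDeriv₁, iterInt]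
  · have hp := (hK.tameIter hS hu (m + 1) j).pos θ hθ x
    rw [hK.logDeriv₁_apply hS hu (m + 1) j hθ, hK.fderivWithin_iterInt hS hu m j x hθ,
      inv_mul_cancel_left₀ hp.ne']

/-- Louis' identity: subtracting the product of the mean scores turns the second moment in
`fderivWithin₂_iterInt` into a covariance. -/
lemma TameKernels.secondOrder {θ u v : E} (hθ : θ ∈ S) (hu1 : ‖u‖ ≤ 1) (hv1 : ‖v‖ ≤ 1) :
    SecondOrder μ (iterDens μ K θ) (fun j => b₂ j + b₁ j ^ 2) (kernelScore S K θ u)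
      (kernelScore S K θ v) (fun m j x => logDeriv₁ S μ K m j θ x u)
      (fun m j x => logDeriv₁ S μ K m j θ x v) (kernelHessian S K θ u v)
      fun m j x => logDeriv₂ S μ K m j θ x u v := by
  refine ⟨fun j x => hK.isBdd_kernelHessian hu j x hθ hu1 hv1,
    fun m j => hK.isBdd_logDeriv₂ hS hu m j hθ hu1 hv1,
    fun j x z => (hK.tame j x z).abs_hessian_le (hK.b₁_nonneg j) (hK.b₂_nonneg j) hθ hu1 hv1,
    fun j x => ?_, fun m j x => ?_⟩
  · have : fderivWithin ℝ (fun τ => Real.log (iterInt μ K 0 j τ x)) S = fun _ => 0 := by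
      funext τ; simp [iterInt]
    rw [logDeriv₂, fderivWithin₂, this]
    simp
  · have hp := (hK.tameIter hS hu (m + 1) j).pos θ hθ x
    have hd := hK.isDensity hS hu m j hθ x
    have b1 := (hK.isBdd_kernelScore hu j x hθ hu1).add (hK.isBdd_logDeriv₁ hS hu m (j + 1) hθ hu1)
    have b2 := (hK.isBdd_kernelScore hu j x hθ hv1).add (hK.isBdd_logDeriv₁ hS hu m (j + 1) hθ hv1)
    have b3 := (hK.isBdd_kernelHessian hu j x hθ hu1 hv1).add
      (hK.isBdd_logDeriv₂ hS hu m (j + 1) hθ hu1 hv1)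
    rw [hK.logDeriv₂_apply hS hu (m + 1) j hθ, hK.fderivWithin_iterInt hS hu m j x hθ,
      hK.fderivWithin_iterInt hS hu m j x hθ, hK.fderivWithin₂_iterInt hS hu m j x hθ,
      densMean_add hd b3 (b1.mul b2), densCov]
    field_simp
    ring

/-- Sequences dominating the oscillations and the horizon effects of the first and second
derivatives of the logarithms of the iterated integrals. -/
structure OscEnvelopes (lam e₀ : ℝ) (k₁ k₂ W N U M H : ℕ → ℝ) : Prop where
  -- `W` and `N` bound squares for the first derivative (oscillation and horizon difference); `U`
  -- and `M` bound the corresponding quantities themselves for the second derivative.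
  W_nonneg : ∀ j, 0 ≤ W j
  W_step : ∀ j, lam ^ 4 * W (j + 1) + (2 * k₁ j) ^ 2 / (1 - lam ^ 4) ≤ W j
  N_nonneg : ∀ j, 0 ≤ N j
  W_le_N : ∀ j, W j ≤ N j
  N_step : ∀ j, lam ^ 3 * N (j + 1) + (2 * e₀ / lam * oscBound k₁ W j) ^ 2 / (1 - lam ^ 3) ≤ N j
  U_nonneg : ∀ j, 0 ≤ U j
  U_step : ∀ j, lam ^ 4 * U (j + 1) + (2 * k₂ j + 2 * oscBound k₁ W j ^ 2) ≤ U j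
  U_le_M : ∀ j, U j ≤ M j
  M_step : ∀ j, lam ^ 4 * M (j + 1) + 2 * (e₀ * (2 * k₂ j + U (j + 1)) +
    2 * (√(N (j + 1)) * oscBound k₁ W j) + 3 * e₀ * oscBound k₁ W j ^ 2) ≤ lam * M j
  H_nonneg : ∀ j, 0 ≤ H j
  sqrt_W_le : ∀ j, √(W j) ≤ H j
  U_le : ∀ j, U j ≤ H j
  oscBound_le : ∀ j, oscBound k₁ W j ≤ H j
  first_le : ∀ j, √(N (j + 1)) + e₀ * oscBound k₁ W j ≤ H j
  second_le : ∀ j, k₂ j + U (j + 1) + oscBound k₁ W j ^ 2 ≤ H j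
  third_le : ∀ j, M (j + 1) + (e₀ * (2 * k₂ j + U (j + 1)) +
        2 * (√(N (j + 1)) * oscBound k₁ W j) + 3 * e₀ * oscBound k₁ W j ^ 2) ≤ H j

/-- An array of functions depending on a horizon `m` and a time `j`, whose oscillations and whose
increments in the horizon are controlled by the sequence `H`, and whose increments forget the
horizon geometrically. -/
structure ForgettingArray {F : Type*} [NormedAddCommGroup F] (S : Set E) (lam : ℝ) (H : ℕ → ℝ)
    (J : ℕ → ℕ → E → X → F) : Prop where
  zero : ∀ j θ x, J 0 j θ x = 0
  osc : ∀ m j, ∀ θ ∈ S, ∀ x x', ‖J m j θ x - J m j θ x'‖ ≤ H j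
  step : ∀ m j, ∀ θ ∈ S, ∀ x x', ‖J (m + 1) j θ x - J m (j + 1) θ x'‖ ≤ H j
  forget : ∀ b n j, ∀ θ ∈ S, ∀ x x', ‖(J (b + n + 1) j θ x - J (b + n) (j + 1) θ x') -
    (J (b + 1) j θ x - J b (j + 1) θ x')‖ ≤ lam ^ b * H j

/-- Testing against unit directions reduces the operator norms to the scalar recursion, whose bounds
do not depend on the direction. -/
theorem TameKernels.forgettingArray_logDeriv₁ {lam : ℝ} (hl0 : 0 < lam) (hl1 : lam < 1)
    (hlam : 1 - lam ^ 4 ≤ α ^ 2) {W N U M H : ℕ → ℝ}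
    (he : OscEnvelopes lam α⁻¹ b₁ (fun j => b₂ j + b₁ j ^ 2) W N U M H) :
    ForgettingArray S lam H (logDeriv₁ S μ K) := by
  have hF := fun θ hθ => hK.forgettingDensities hS hu hl0 hl1 hlam (θ := θ) hθ
  refine ⟨fun j θ x => by simp [logDeriv₁, iterInt], fun m j θ hθ x x' => ?_,
    fun m j θ hθ x x' => ?_, fun b n j θ hθ x x' => ?_⟩
  · refine ContinuousLinearMap.opNorm_le_of_unit_norm (he.H_nonneg j) fun u hu1 => ?_
    exact ((hK.firstOrder hS hu hθ hu1.le).oscLE (hF θ hθ) he.W_nonneg he.W_step m j x x').trans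
      (he.sqrt_W_le j)
  · refine ContinuousLinearMap.opNorm_le_of_unit_norm (he.H_nonneg j) fun u hu1 => ?_
    exact ((hK.firstOrder hS hu hθ hu1.le).abs_succ_sub_le (hF θ hθ) he.W_nonneg he.W_step
      m j x x').trans (he.oscBound_le j)
  · rw [sub_sub_sub_comm]
    refine ContinuousLinearMap.opNorm_le_of_unit_norm
      (mul_nonneg (pow_nonneg hl0.le _) (he.H_nonneg j)) fun u hu1 => ?_
    have hf := hK.firstOrder hS hu hθ hu1.le
    refine (hf.abs_succ_sub_succ_sub_le (hF θ hθ) he.W_nonneg he.W_step b n j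
      (hf.oscLE_sub (hF θ hθ) he.W_nonneg he.W_step he.N_nonneg he.W_le_N he.N_step b n (j + 1))
      x x').trans ?_
    have h1 : 0 ≤ oscBound b₁ W j := by
      have := hK.b₁_nonneg j
      rw [oscBound]; positivity
    have h2 : lam ^ (4 * b) ≤ lam ^ b := pow_le_pow_of_le_one hl0.le hl1.le (by omega)
    have h3 : 0 < α⁻¹ := inv_pos.2 hK.α_pos
    calc _ ≤ lam ^ b * √(N (j + 1)) + α⁻¹ * lam ^ b * oscBound b₁ W j := by gcongr
      _ = lam ^ b * (√(N (j + 1)) + α⁻¹ * oscBound b₁ W j) := by ring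
      _ ≤ _ := mul_le_mul_of_nonneg_left (he.first_le j) (pow_nonneg hl0.le _)

omit [IsFiniteMeasure μ] [FiniteDimensional ℝ E] hS hu hK [MeasurableSpace X] in
lemma opNorm₂_le_of_unit_norm {L : E →L[ℝ] E →L[ℝ] ℝ} {B : ℝ} (hB : 0 ≤ B)
    (h : ∀ u v, ‖u‖ = 1 → ‖v‖ = 1 → |L u v| ≤ B) : ‖L‖ ≤ B :=
  ContinuousLinearMap.opNorm_le_of_unit_norm hB fun u hu1 =>
    ContinuousLinearMap.opNorm_le_of_unit_norm hB fun v hv1 => h u v hu1 hv1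

theorem TameKernels.forgettingArray_logDeriv₂ {lam : ℝ} (hl0 : 0 < lam) (hl1 : lam < 1)
    (hlam : 1 - lam ^ 4 ≤ α ^ 2) {W N U M H : ℕ → ℝ}
    (he : OscEnvelopes lam α⁻¹ b₁ (fun j => b₂ j + b₁ j ^ 2) W N U M H) :
    ForgettingArray S lam H (logDeriv₂ S μ K) := by
  have hF := fun θ hθ => hK.forgettingDensities hS hu hl0 hl1 hlam (θ := θ) hθ
  refine ⟨fun j θ x => ?_, fun m j θ hθ x x' => ?_,
    fun m j θ hθ x x' => ?_, fun b n j θ hθ x x' => ?_⟩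
  · have : fderivWithin ℝ (fun τ => Real.log (iterInt μ K 0 j τ x)) S = fun _ => 0 := by
      funext τ; simp [iterInt]
    rw [logDeriv₂, fderivWithin₂, this]
    simp
  · refine opNorm₂_le_of_unit_norm (he.H_nonneg j) fun u v hu1 hv1 => ?_
    exact (SecondOrder.oscLE (hF θ hθ) he.W_nonneg he.W_step (hK.firstOrder hS hu hθ hu1.le)
      (hK.firstOrder hS hu hθ hv1.le) (hK.secondOrder hS hu hθ hu1.le hv1.le) he.U_step
      he.U_nonneg m j x x').trans (he.U_le j)
  · refine opNorm₂_le_of_unit_norm (he.H_nonneg j) fun u v hu1 hv1 => ?_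
    exact (SecondOrder.abs_succ_sub_le (hF θ hθ) he.W_nonneg he.W_step
      (hK.firstOrder hS hu hθ hu1.le)
      (hK.firstOrder hS hu hθ hv1.le) (hK.secondOrder hS hu hθ hu1.le hv1.le) he.U_step
      he.U_nonneg m j x x').trans (he.second_le j)
  · rw [sub_sub_sub_comm]
    refine opNorm₂_le_of_unit_norm
      (mul_nonneg (pow_nonneg hl0.le _) (he.H_nonneg j)) fun u v hu1 hv1 => ?_
    exact (SecondOrder.abs_succ_sub_succ_sub_le (hF θ hθ) he.W_nonneg he.W_step
      (hK.firstOrder hS hu hθ hu1.le)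
      (hK.firstOrder hS hu hθ hv1.le) (hK.secondOrder hS hu hθ hu1.le hv1.le) he.U_step
      he.U_nonneg he.N_nonneg he.W_le_N he.N_step he.U_le_M he.M_step b n j x x').trans
      (mul_le_mul_of_nonneg_left (he.third_le j) (pow_nonneg hl0.le _))

end

end LogDerivatives

/-! ### Uniform ergodic theorems -/

section UniformErgodic

variable {Ω : Type*} [MeasurableSpace Ω] {P : Measure Ω} [IsProbabilityMeasure P] {T : Ω → Ω}
variable {F : Type*} [NormedAddCommGroup F] [NormedSpace ℝ F]

omit [IsProbabilityMeasure P] in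
lemma MeasureTheory.MeasurePreserving.ae_forall_iterate (hT : MeasurePreserving T P P) {p : Ω → Prop}
    (hp : ∀ᵐ ω ∂P, p ω) : ∀ᵐ ω ∂P, ∀ k : ℕ, p (T^[k] ω) :=
  ae_all_iff.2 fun k => (hT.iterate k).quasiMeasurePreserving.ae hp

/-- The ergodic theorem for functions with values in a finite-dimensional space. -/
theorem Ergodic.ae_tendsto_average [FiniteDimensional ℝ F] (hT : Ergodic T P) {f : Ω → F}
    (hf : Integrable f P) :
    ∀ᵐ ω ∂P, Tendsto (fun n : ℕ => (1 / (n : ℝ)) • ∑ k ∈ Finset.range n, f (T^[k] ω)) atTop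
      (𝓝 (∫ ω, f ω ∂P)) := by
  set e : F ≃L[ℝ] (Fin (Module.finrank ℝ F) → ℝ) :=
    ContinuousLinearEquiv.ofFinrankEq (by simp) with he
  have hi : ∀ i, ∀ᵐ ω ∂P, Tendsto (fun n : ℕ => (1 / (n : ℝ)) *
      birkhoffSum T (fun ω => e (f ω) i) n ω) atTop (𝓝 (∫ ω, e (f ω) i ∂P)) := fun i =>
    hT.ae_tendsto_birkhoffSum (f := fun ω => e (f ω) i)
      (((ContinuousLinearMap.proj (R := ℝ) (φ := fun _ => ℝ) i).comp
        e.toContinuousLinearMap).integrable_comp hf)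
  filter_upwards [ae_all_iff.2 hi] with ω hω
  have : Tendsto (fun n : ℕ => e ((1 / (n : ℝ)) • ∑ k ∈ Finset.range n, f (T^[k] ω))) atTop
      (𝓝 (e (∫ ω, f ω ∂P))) := by
    rw [tendsto_pi_nhds]
    intro i
    have h1 : e (∫ ω, f ω ∂P) i = ∫ ω, e (f ω) i ∂P :=
      (((ContinuousLinearMap.proj (R := ℝ) (φ := fun _ => ℝ) i).comp
        e.toContinuousLinearMap).integral_comp_comm hf).symm
    rw [h1]
    refine (hω i).congr fun n => ?_
    simp [birkhoffSum]
  have h2 := (e.symm.continuous.tendsto _).comp this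
  simpa [Function.comp_def] using h2

/-- A uniform ergodic theorem over a compact set of parameters. -/
theorem Ergodic.ae_tendstoUniformlyOn_average [FiniteDimensional ℝ F] (hT : Ergodic T P)
    {E : Type*} [PseudoMetricSpace E] {S : Set E} (hS : IsCompact S) {f : Ω → E → F}
    (hm : ∀ θ ∈ S, AEStronglyMeasurable (fun ω => f ω θ) P)
    (hc : ∀ᵐ ω ∂P, ContinuousOn (f ω) S) {H : Ω → ℝ} (hH : Integrable H P)
    (hb : ∀ᵐ ω ∂P, ∀ θ ∈ S, ‖f ω θ‖ ≤ H ω) :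
    ∀ᵐ ω ∂P, TendstoUniformlyOn
      (fun (n : ℕ) θ => (1 / (n : ℝ)) • ∑ k ∈ Finset.range n, f (T^[k] ω) θ)
      (fun θ => ∫ ω, f ω θ ∂P) atTop S := by
  have hi : ∀ θ ∈ S, Integrable (fun ω => f ω θ) P := fun θ hθ =>
    hH.mono' (hm θ hθ) (hb.mono fun ω h => h θ hθ)
  -- The modulus of continuity `w δ` is a supremum over a countable dense set, which keeps it
  -- measurable. Continuity extends its bound to all pairs in `S`.
  obtain ⟨D, hDS, hDc, hDd⟩ := hS.isSeparable.exists_countable_dense_subset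
  set V : ℝ → Set (E × E) := fun δ => {p | p ∈ D ×ˢ D ∧ dist p.1 p.2 < δ} with hV
  have hVc : ∀ δ, (V δ).Countable := fun δ => (hDc.prod hDc).mono fun p hp => hp.1
  set w : ℝ → Ω → ℝ≥0∞ := fun δ ω => ⨆ p ∈ V δ, ‖f ω p.1 - f ω p.2‖ₑ with hw
  have hwm : ∀ δ, AEMeasurable (w δ) P := fun δ =>
    AEMeasurable.biSup _ (hVc δ) fun p hp =>
      ((hm _ (hDS hp.1.1)).sub (hm _ (hDS hp.1.2))).enorm
  have hw2 : ∀ δ, ∀ᵐ ω ∂P, w δ ω ≤ ENNReal.ofReal (2 * H ω) := fun δ => by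
    filter_upwards [hb] with ω h
    refine iSup₂_le fun p hp => ?_
    rw [← ofReal_norm]
    refine ENNReal.ofReal_le_ofReal ((norm_sub_le _ _).trans ?_)
    linarith [h _ (hDS hp.1.1), h _ (hDS hp.1.2)]
  have hwfin : ∀ δ, ∀ᵐ ω ∂P, w δ ω ≠ ∞ := fun δ =>
    (hw2 δ).mono fun ω h => (h.trans_lt ENNReal.ofReal_lt_top).ne
  have hH0 : ∀ᵐ ω ∂P, S.Nonempty → 0 ≤ H ω := by
    filter_upwards [hb] with ω h ⟨θ, hθ⟩
    exact (norm_nonneg _).trans (h θ hθ)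
  rcases S.eq_empty_or_nonempty with rfl | hne
  · exact .of_forall fun ω => tendstoUniformlyOn_empty
  have hwr : ∀ δ, ∀ᵐ ω ∂P, ‖(w δ ω).toReal‖ ≤ 2 * H ω := fun δ => by
    filter_upwards [hw2 δ, hH0] with ω h h0
    rw [Real.norm_of_nonneg ENNReal.toReal_nonneg]
    exact ENNReal.toReal_le_of_le_ofReal (by linarith [h0 hne]) h
  have hwi : ∀ δ, Integrable (fun ω => (w δ ω).toReal) P := fun δ =>
    (hH.const_mul 2).mono' (hwm δ).ennreal_toReal.aestronglyMeasurable (hwr δ)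
  have hmod : ∀ δ, ∀ᵐ ω ∂P, ∀ θ ∈ S, ∀ θ' ∈ S, dist θ θ' < δ →
      ‖f ω θ - f ω θ'‖ ≤ (w δ ω).toReal := fun δ => by
    filter_upwards [hc, hwfin δ] with ω h hf θ hθ θ' hθ' hd
    have hcl : (θ, θ') ∈ closure (V δ) := by
      have ho : IsOpen {p : E × E | dist p.1 p.2 < δ} := isOpen_lt continuous_dist continuous_const
      have : (θ, θ') ∈ {p : E × E | dist p.1 p.2 < δ} ∩ closure (D ×ˢ D) :=
        ⟨hd, by rw [closure_prod_eq]; exact ⟨hDd hθ, hDd hθ'⟩⟩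
      refine closure_mono ?_ (ho.inter_closure this)
      exact fun p hp => ⟨hp.2, hp.1⟩
    have hVS : V δ ⊆ S ×ˢ S := fun p hp => ⟨hDS hp.1.1, hDS hp.1.2⟩
    have hcw : ContinuousWithinAt (fun p : E × E => ‖f ω p.1 - f ω p.2‖) (V δ) (θ, θ') :=
      (((h θ hθ).comp continuousWithinAt_fst fun p hp => (hVS hp).1).sub
        ((h θ' hθ').comp continuousWithinAt_snd fun p hp => (hVS hp).2)).norm
    refine ContinuousWithinAt.closure_le hcl hcw continuousWithinAt_const fun p hp => ?_
    rw [← toReal_enorm]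
    exact ENNReal.toReal_mono hf (le_iSup₂ (f := fun p _ => ‖f ω p.1 - f ω p.2‖ₑ) p hp)
  -- Each path is uniformly continuous on the compact `S`, and `2 * H` dominates, so the mean
  -- modulus tends to zero.
  have hlim : Tendsto (fun k : ℕ => ∫ ω, (w (1 / ((k : ℝ) + 1)) ω).toReal ∂P) atTop (𝓝 0) := by
    rw [← integral_zero Ω ℝ (μ := P)]
    refine tendsto_integral_of_dominated_convergence (fun ω => 2 * H ω)
      (fun k => (hwi _).aestronglyMeasurable) (hH.const_mul 2) (fun k => hwr _) ?_
    filter_upwards [hc] with ω h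
    rw [Metric.tendsto_atTop]
    intro η hη
    obtain ⟨δ, hδ, hδ'⟩ := Metric.uniformContinuousOn_iff.1
      (hS.uniformContinuousOn_of_continuous h) (η / 2) (half_pos hη)
    obtain ⟨k₀, hk₀⟩ := exists_nat_one_div_lt hδ
    refine ⟨k₀, fun k hk => ?_⟩
    rw [Real.dist_0_eq_abs, abs_of_nonneg ENNReal.toReal_nonneg]
    refine (ENNReal.toReal_le_of_le_ofReal (half_pos hη).le (iSup₂_le fun p hp => ?_)).trans_lt
      (half_lt_self hη)
    rw [← ofReal_norm, ← dist_eq_norm]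
    refine ENNReal.ofReal_le_ofReal (hδ' _ (hDS hp.1.1) _ (hDS hp.1.2)
      (hp.2.trans (lt_of_le_of_lt ?_ hk₀))).le
    exact one_div_le_one_div_of_le (by positivity) (by exact_mod_cast Nat.succ_le_succ hk)
  have hnet : ∀ k : ℕ, ∃ t ⊆ S, t.Finite ∧ S ⊆ ⋃ x ∈ t, Metric.ball x (1 / ((k : ℝ) + 1)) :=
    fun k => hS.finite_cover_balls (by positivity)
  choose t htS htf htc using hnet
  have hBt : ∀ k, ∀ᵐ ω ∂P, ∀ θ ∈ t k, Tendsto (fun n : ℕ => (1 / (n : ℝ)) •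
      ∑ i ∈ Finset.range n, f (T^[i] ω) θ) atTop (𝓝 (∫ ω, f ω θ ∂P)) := fun k =>
    (ae_ball_iff (htf k).countable).2 fun θ hθ => hT.ae_tendsto_average (hi θ (htS k hθ))
  have hBw : ∀ k : ℕ, ∀ᵐ ω ∂P, Tendsto (fun n : ℕ => (1 / (n : ℝ)) •
      ∑ i ∈ Finset.range n, (w (1 / ((k : ℝ) + 1)) (T^[i] ω)).toReal) atTop
      (𝓝 (∫ ω, (w (1 / ((k : ℝ) + 1)) ω).toReal ∂P)) := fun k => hT.ae_tendsto_average (hwi _)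
  filter_upwards [ae_all_iff.2 hBt, ae_all_iff.2 hBw,
    ae_all_iff.2 fun k : ℕ => hT.toMeasurePreserving.ae_forall_iterate (hmod (1 / ((k : ℝ) + 1)))]
    with ω h1 h2 h3
  rw [Metric.tendstoUniformlyOn_iff]
  intro η hη
  obtain ⟨k, hk⟩ := (hlim.eventually_lt_const (u := η / 4) (by positivity)).exists
  have h4 : ∀ᶠ n : ℕ in atTop, ∀ θ ∈ t k, ‖(1 / (n : ℝ)) •
      ∑ i ∈ Finset.range n, f (T^[i] ω) θ - ∫ ω, f ω θ ∂P‖ < η / 4 := by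
    rw [eventually_all_finite (htf k)]
    intro θ hθ
    filter_upwards [Metric.tendsto_nhds.1 (h1 k θ hθ) (η / 4) (by positivity)] with n hn
    rwa [dist_eq_norm] at hn
  -- The ergodic theorem is used at the finitely many points of the net and for the modulus, which
  -- controls the passage from any `θ` to the net.
  filter_upwards [h4, (h2 k).eventually_lt_const (u := η / 4) hk] with n hn1 hn2 θ hθ
  obtain ⟨θ', hθ't, hθ'⟩ := Set.mem_iUnion₂.1 (htc k hθ)
  have hθ'S := htS k hθ't
  have hd : dist θ θ' < 1 / ((k : ℝ) + 1) := hθ'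
  have a1 : ‖∫ ω, f ω θ ∂P - ∫ ω, f ω θ' ∂P‖ ≤ ∫ ω, (w (1 / ((k : ℝ) + 1)) ω).toReal ∂P := by
    rw [← integral_sub (hi θ hθ) (hi θ' hθ'S)]
    refine norm_integral_le_of_norm_le (hwi _) ?_
    filter_upwards [hmod (1 / ((k : ℝ) + 1))] with ω h using h θ hθ θ' hθ'S hd
  have a2 : ‖(1 / (n : ℝ)) • ∑ i ∈ Finset.range n, f (T^[i] ω) θ -
      (1 / (n : ℝ)) • ∑ i ∈ Finset.range n, f (T^[i] ω) θ'‖ ≤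
      (1 / (n : ℝ)) • ∑ i ∈ Finset.range n, (w (1 / ((k : ℝ) + 1)) (T^[i] ω)).toReal := by
    rw [← smul_sub, ← Finset.sum_sub_distrib, norm_smul, Real.norm_of_nonneg (by positivity),
      smul_eq_mul]
    exact mul_le_mul_of_nonneg_left (norm_sum_le_of_le _ fun i _ => h3 k i θ hθ θ' hθ'S hd)
      (by positivity)
  have a3 := hn1 θ' hθ't
  rw [dist_eq_norm]
  set A := (1 / (n : ℝ)) • ∑ i ∈ Finset.range n, f (T^[i] ω) θ
  set A' := (1 / (n : ℝ)) • ∑ i ∈ Finset.range n, f (T^[i] ω) θ'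
  have e : ∫ ω, f ω θ ∂P - A = (∫ ω, f ω θ ∂P - ∫ ω, f ω θ' ∂P) - (A' - ∫ ω, f ω θ' ∂P) -
    (A - A') := by abel
  rw [e]
  have b1 := norm_sub_le ((∫ ω, f ω θ ∂P - ∫ ω, f ω θ' ∂P) - (A' - ∫ ω, f ω θ' ∂P)) (A - A')
  have b2 := norm_sub_le (∫ ω, f ω θ ∂P - ∫ ω, f ω θ' ∂P) (A' - ∫ ω, f ω θ' ∂P)
  linarith

/-- The uniform ergodic theorem for the initial functions of stationary forgetting arrays. -/
theorem Ergodic.exists_tendstoUniformlyOn_forgettingArray [FiniteDimensional ℝ F]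
    (hT : Ergodic T P) {E : Type*} [NormedAddCommGroup E] [NormedSpace ℝ E] {S : Set E}
    (hS : IsCompact S) {X : Type*} {A : Ω → ℕ → E → X → F} {lam : ℝ} (hl0 : 0 < lam)
    (hl1 : lam < 1) {H : Ω → ℝ} (hH : Integrable H P)
    (hJ : ∀ᵐ ω ∂P, ForgettingArray S lam (fun j => H (T^[j] ω)) fun m j => A (T^[j] ω) m)
    (hm : ∀ m, ∀ θ ∈ S, ∀ x, AEStronglyMeasurable (fun ω => A ω m θ x) P)
    (hc : ∀ᵐ ω ∂P, ∀ m x, ContinuousOn (fun θ => A ω m θ x) S) (x₀ : X) :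
    ∃ ℓ : E → F, ContinuousOn ℓ S ∧
      (∀ b, ∀ θ ∈ S, ‖ℓ θ - ∫ ω, (A ω (b + 1) θ x₀ - A (T ω) b θ x₀) ∂P‖ ≤
        lam ^ b * ∫ ω, H ω ∂P) ∧
      ∀ x, ∀ᵐ ω ∂P, TendstoUniformlyOn (fun (n : ℕ) θ => (1 / (n : ℝ)) • A ω n θ x) ℓ atTop S := by
  -- The increment with fixed horizon `b` is a single function on `Ω`, so its sums along the orbit
  -- are ergodic averages.
  set I : ℕ → Ω → E → F := fun b ω θ => A ω (b + 1) θ x₀ - A (T ω) b θ x₀ with hI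
  have hTm := hT.toMeasurePreserving
  have hIm : ∀ b, ∀ θ ∈ S, AEStronglyMeasurable (fun ω => I b ω θ) P := fun b θ hθ =>
    (hm _ θ hθ x₀).sub ((hm b θ hθ x₀).comp_measurePreserving hTm)
  have hIb : ∀ b, ∀ᵐ ω ∂P, ∀ θ ∈ S, ‖I b ω θ‖ ≤ H ω := fun b => by
    filter_upwards [hJ] with ω h θ hθ
    exact h.step b 0 θ hθ x₀ x₀
  have hIi : ∀ b, ∀ θ ∈ S, Integrable (fun ω => I b ω θ) P := fun b θ hθ =>
    hH.mono' (hIm b θ hθ) ((hIb b).mono fun ω h => h θ hθ)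
  have hIc : ∀ b, ∀ᵐ ω ∂P, ContinuousOn (I b ω) S := fun b => by
    filter_upwards [hc, hTm.quasiMeasurePreserving.ae hc] with ω h1 h2
    exact (h1 _ x₀).sub (h2 _ x₀)
  have hII : ∀ b n, ∀ᵐ ω ∂P, ∀ θ ∈ S, ‖I (b + n) ω θ - I b ω θ‖ ≤ lam ^ b * H ω := fun b n => by
    filter_upwards [hJ] with ω h θ hθ
    exact h.forget b n 0 θ hθ x₀ x₀
  have hd : ∀ b n, ∀ θ ∈ S, ‖∫ ω, I (b + n) ω θ ∂P - ∫ ω, I b ω θ ∂P‖ ≤ lam ^ b * ∫ ω, H ω ∂P := by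
    intro b n θ hθ
    rw [← integral_sub (hIi _ θ hθ) (hIi _ θ hθ), ← integral_const_mul]
    exact norm_integral_le_of_norm_le (hH.const_mul _) ((hII b n).mono fun ω h => h θ hθ)
  have hpow : Tendsto (fun b : ℕ => lam ^ b * ∫ ω, H ω ∂P) atTop (𝓝 0) := by
    simpa using (tendsto_pow_atTop_nhds_zero_of_lt_one hl0.le hl1).mul_const (∫ ω, H ω ∂P)
  have hex : ∀ θ ∈ S, ∃ z, Tendsto (fun b => ∫ ω, I b ω θ ∂P) atTop (𝓝 z) := by
    intro θ hθ
    refine cauchySeq_tendsto_of_complete (cauchySeq_of_le_tendsto_0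
      (fun b => 2 * (lam ^ b * ∫ ω, H ω ∂P)) (fun n m N hn hm' => ?_) (by simpa using hpow.const_mul 2))
    obtain ⟨n, rfl⟩ := Nat.exists_eq_add_of_le hn
    obtain ⟨m, rfl⟩ := Nat.exists_eq_add_of_le hm'
    refine (dist_triangle_right _ _ (∫ ω, I N ω θ ∂P)).trans ?_
    rw [dist_eq_norm, dist_eq_norm]
    linarith [hd N n θ hθ, hd N m θ hθ]
  choose! ℓ hℓ using hex
  have hℓb : ∀ b, ∀ θ ∈ S, ‖ℓ θ - ∫ ω, I b ω θ ∂P‖ ≤ lam ^ b * ∫ ω, H ω ∂P := fun b θ hθ =>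
    le_of_tendsto (((hℓ θ hθ).sub_const _).norm) <| by
      filter_upwards [eventually_ge_atTop b] with n hn
      obtain ⟨n, rfl⟩ := Nat.exists_eq_add_of_le hn
      exact hd b n θ hθ
  have hmain : ∀ x, ∀ᵐ ω ∂P,
      TendstoUniformlyOn (fun (n : ℕ) θ => (1 / (n : ℝ)) • A ω n θ x) ℓ atTop S := by
    intro x
    have hHnn : ∀ᵐ ω ∂P, S.Nonempty → 0 ≤ H ω := by
      filter_upwards [hIb 0] with ω h ⟨θ, hθ⟩
      exact (norm_nonneg _).trans (h θ hθ)
    filter_upwards [ae_all_iff.2 fun b =>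
        hT.ae_tendstoUniformlyOn_average hS (hIm b) (hIc b) hH (hIb b),
      hT.ae_tendsto_average hH, hJ] with ω h1 h2 h3
    set a : ℕ → ℝ := fun n => ∑ k ∈ Finset.range n, H (T^[k] ω) with ha
    -- The last `b` terms of an ergodic sum are negligible: two normalized sums whose lengths differ
    -- by `b` have the same limit.
    have htail : ∀ b : ℕ, Tendsto (fun n : ℕ => (1 / (n : ℝ)) * ∑ k ∈ Finset.range n,
        if n ≤ k + b then 2 * H (T^[k] ω) else 0) atTop (𝓝 0) := by
      intro b
      rw [← tendsto_add_atTop_iff_nat b]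
      have e1 := (tendsto_add_atTop_iff_nat b).2 h2
      have e2 := h2.mul (tendsto_natCast_div_add_atTop (b : ℝ))
      have e3 := (e1.sub e2).const_mul 2
      rw [mul_one, sub_self, mul_zero] at e3
      refine e3.congr' ?_
      filter_upwards [eventually_gt_atTop 0] with n hn
      have hn' : (n : ℝ) ≠ 0 := by positivity
      have e4 : ∑ k ∈ Finset.range (n + b), (if n + b ≤ k + b then 2 * H (T^[k] ω) else 0) =
          2 * (a (n + b) - a n) := by
        simp only [ha]
        rw [Finset.sum_range_add, Finset.sum_range_add, add_sub_cancel_left, Finset.mul_sum,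
          Finset.sum_eq_zero, zero_add]
        · exact Finset.sum_congr rfl fun k _ => if_pos (by omega)
        · intro k hk
          exact if_neg (by have := Finset.mem_range.1 hk; omega)
      rw [e4]
      simp only [smul_eq_mul]
      change 2 * (1 / ((n + b : ℕ) : ℝ) * a (n + b) - 1 / (n : ℝ) * a n * (n / (n + b : ℝ))) = _
      push_cast
      field_simp
    -- By telescoping, the increment at time `k` has horizon `n - k - 1`. If this is at least `b`,
    -- it is replaced by the one of horizon `b` at cost `lam ^ b * H`; otherwise both are bounded by
    -- `H`.
    have hkey : ∀ b n : ℕ, ∀ θ ∈ S, ‖A ω n θ x₀ - ∑ k ∈ Finset.range n, I b (T^[k] ω) θ‖ ≤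
        lam ^ b * a n + ∑ k ∈ Finset.range n, if n ≤ k + b then 2 * H (T^[k] ω) else 0 := by
      intro b n θ hθ
      have et : A ω n θ x₀ = ∑ k ∈ Finset.range n,
          (A (T^[k] ω) (n - k) θ x₀ - A (T^[k + 1] ω) (n - (k + 1)) θ x₀) := by
        rw [Finset.sum_range_sub' fun k => A (T^[k] ω) (n - k) θ x₀, Nat.sub_self]
        have := h3.zero n θ x₀
        simp [this]
      rw [et, ← Finset.sum_sub_distrib, ha, Finset.mul_sum, ← Finset.sum_add_distrib]
      refine norm_sum_le_of_le _ fun k hk => ?_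
      have hkn := Finset.mem_range.1 hk
      have hIk : I b (T^[k] ω) θ = A (T^[k] ω) (b + 1) θ x₀ - A (T^[k + 1] ω) b θ x₀ := by
        rw [Function.iterate_succ_apply']
      rw [hIk]
      have hHk : 0 ≤ H (T^[k] ω) := (norm_nonneg _).trans (h3.step 0 k θ hθ x₀ x₀)
      split_ifs with hnk
      · have s1 := h3.step (n - (k + 1)) k θ hθ x₀ x₀
        have s2 := h3.step b k θ hθ x₀ x₀
        rw [show n - (k + 1) + 1 = n - k by omega] at s1
        have := norm_sub_le (A (T^[k] ω) (n - k) θ x₀ - A (T^[k + 1] ω) (n - (k + 1)) θ x₀)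
          (A (T^[k] ω) (b + 1) θ x₀ - A (T^[k + 1] ω) b θ x₀)
        have : 0 ≤ lam ^ b * H (T^[k] ω) := by positivity
        linarith
      · obtain ⟨c, hc'⟩ := Nat.exists_eq_add_of_le (show b + (k + 1) ≤ n by omega)
        have s1 := h3.forget b c k θ hθ x₀ x₀
        rw [show n - k = b + c + 1 by omega, show n - (k + 1) = b + c by omega, add_zero]
        exact s1
    rw [Metric.tendstoUniformlyOn_iff]
    intro η hη
    -- The five shares of `η` go to the change of starting point, the forgetting error, the tail,
    -- the ergodic average, and the distance from `ℓ` to the mean for horizon `b`.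
    obtain ⟨b, hb⟩ := (hpow.eventually_lt_const (u := η / 5) (by positivity)).exists
    have hx : Tendsto (fun n : ℕ => (1 / (n : ℝ)) * H ω) atTop (𝓝 0) := by
      simpa using tendsto_one_div_atTop_nhds_zero_nat.mul_const (H ω)
    have h2' := h2.const_mul (lam ^ b)
    filter_upwards [Metric.tendstoUniformlyOn_iff.1 (h1 b) (η / 5) (by positivity),
      h2'.eventually_lt_const hb, (htail b).eventually_lt_const (u := η / 5) (by positivity),
      hx.eventually_lt_const (u := η / 5) (by positivity)] with n c1 c2 c3 c4 θ hθ
    have d1 := hℓb b θ hθ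
    have d2 := c1 θ hθ
    have hn0 : 0 ≤ 1 / (n : ℝ) := by positivity
    have d3 : ‖(1 / (n : ℝ)) • A ω n θ x₀ -
        (1 / (n : ℝ)) • ∑ k ∈ Finset.range n, I b (T^[k] ω) θ‖ < η / 5 + η / 5 := by
      rw [← smul_sub, norm_smul, Real.norm_of_nonneg hn0]
      refine (mul_le_mul_of_nonneg_left (hkey b n θ hθ) hn0).trans_lt ?_
      rw [mul_add]
      refine add_lt_add ?_ c3
      simp only [smul_eq_mul] at c2
      linarith [c2]
    have d4 : ‖(1 / (n : ℝ)) • A ω n θ x - (1 / (n : ℝ)) • A ω n θ x₀‖ < η / 5 := by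
      rw [← smul_sub, norm_smul, Real.norm_of_nonneg hn0]
      exact (mul_le_mul_of_nonneg_left (h3.osc n 0 θ hθ x x₀) hn0).trans_lt c4
    rw [dist_eq_norm] at d2
    rw [dist_eq_norm, norm_sub_rev]
    rw [norm_sub_rev] at d1 d2
    have e : (1 / (n : ℝ)) • A ω n θ x - ℓ θ =
      ((1 / (n : ℝ)) • A ω n θ x - (1 / (n : ℝ)) • A ω n θ x₀) +
      ((1 / (n : ℝ)) • A ω n θ x₀ - (1 / (n : ℝ)) • ∑ k ∈ Finset.range n, I b (T^[k] ω) θ) +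
      ((1 / (n : ℝ)) • ∑ k ∈ Finset.range n, I b (T^[k] ω) θ - ∫ ω, I b ω θ ∂P) +
      (∫ ω, I b ω θ ∂P - ℓ θ) := by abel
    rw [e]
    refine (norm_add_le _ _).trans_lt ?_
    have f1 := norm_add₃_le (a := (1 / (n : ℝ)) • A ω n θ x - (1 / (n : ℝ)) • A ω n θ x₀)
      (b := (1 / (n : ℝ)) • A ω n θ x₀ - (1 / (n : ℝ)) • ∑ k ∈ Finset.range n, I b (T^[k] ω) θ)
      (c := (1 / (n : ℝ)) • ∑ k ∈ Finset.range n, I b (T^[k] ω) θ - ∫ ω, I b ω θ ∂P)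
    linarith
  refine ⟨ℓ, ?_, hℓb, hmain⟩
  obtain ⟨ω, h1, h2⟩ := ((hmain x₀).and hc).exists
  exact h1.continuousOn (.of_forall fun n => (h2 n x₀).const_smul _)

end UniformErgodic

/-! ### Integrable envelopes along orbits -/

section Envelopes

variable {Ω : Type*} [MeasurableSpace Ω] {P : Measure Ω} {T : Ω → Ω}

/-- Geometric sums along the orbits of a measure preserving map. -/
lemma MeasureTheory.MeasurePreserving.exists_geometric_envelope (hT : MeasurePreserving T P P)
    {F : Ω → ℝ} (hF : Integrable F P) (hF0 : ∀ ω, 0 ≤ F ω) {r : ℝ} (hr0 : 0 ≤ r) (hr1 : r < 1) :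
    ∃ U : Ω → ℝ, Integrable U P ∧ (∀ ω, 0 ≤ U ω) ∧ ∀ᵐ ω ∂P, r * U (T ω) + F ω ≤ U ω := by
  -- The geometric series solves `V = F + r V ∘ T` exactly and has integral `∫ F / (1 - r)`. Being
  -- almost surely finite, it may be read as a real function.
  set V : Ω → ℝ≥0∞ := fun ω => ∑' k : ℕ, ENNReal.ofReal (r ^ k) * ENNReal.ofReal (F (T^[k] ω))
    with hV
  have hmk : ∀ k : ℕ, AEMeasurable (fun ω => ENNReal.ofReal (F (T^[k] ω))) P := fun k =>
    (hF.1.comp_measurePreserving (hT.iterate k)).aemeasurable.ennreal_ofReal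
  have hVm : AEMeasurable V P := AEMeasurable.tsum fun k => (hmk k).const_mul _
  have hlin : ∀ k : ℕ, ∫⁻ ω, ENNReal.ofReal (F (T^[k] ω)) ∂P = ∫⁻ ω, ENNReal.ofReal (F ω) ∂P :=
    fun k => by
      rw [← lintegral_map' (f := fun ω => ENNReal.ofReal (F ω)) (g := T^[k]) ?_
        (hT.iterate k).measurable.aemeasurable, (hT.iterate k).map_eq]
      rw [(hT.iterate k).map_eq]
      exact hF.1.aemeasurable.ennreal_ofReal
  have hfin : ∫⁻ ω, V ω ∂P ≠ ∞ := by
    rw [hV, lintegral_tsum fun k => (hmk k).const_mul _]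
    simp_rw [lintegral_const_mul' _ _ ENNReal.ofReal_ne_top, hlin, ENNReal.ofReal_pow hr0]
    rw [ENNReal.tsum_mul_right, ENNReal.tsum_geometric]
    refine ENNReal.mul_ne_top (ENNReal.inv_ne_top.2 ?_) ?_
    · rw [← ENNReal.ofReal_one, ← ENNReal.ofReal_sub _ hr0]
      simpa using hr1
    · rw [← ofReal_integral_eq_lintegral_ofReal hF (.of_forall hF0)]
      exact ENNReal.ofReal_ne_top
  refine ⟨fun ω => (V ω).toReal, integrable_toReal_of_lintegral_ne_top hVm hfin,
    fun ω => ENNReal.toReal_nonneg, ?_⟩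
  have hae := ae_lt_top' hVm hfin
  filter_upwards [hae, hT.quasiMeasurePreserving.ae hae] with ω h1 h2
  have e : V ω = ENNReal.ofReal (F ω) + ENNReal.ofReal r * V (T ω) := by
    simp only [hV]
    rw [tsum_eq_zero_add' ENNReal.summable, ← ENNReal.tsum_mul_left]
    simp only [pow_zero, ENNReal.ofReal_one, one_mul, Function.iterate_zero, id, pow_succ',
      ENNReal.ofReal_mul hr0, Function.iterate_succ_apply, mul_assoc]
  rw [e, ENNReal.toReal_add ENNReal.ofReal_ne_top (ENNReal.mul_ne_top ENNReal.ofReal_ne_top h2.ne),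
    ENNReal.toReal_mul, ENNReal.toReal_ofReal (hF0 ω), ENNReal.toReal_ofReal hr0, add_comm]

lemma MeasureTheory.Integrable.sqrt [IsFiniteMeasure P] {f : Ω → ℝ} (hf : Integrable f P) :
    Integrable (fun ω => √(f ω)) P := by
  refine ((integrable_const 1).add hf.norm).mono'
    (Real.continuous_sqrt.comp_aestronglyMeasurable hf.1) (.of_forall fun ω => ?_)
  rw [Real.norm_of_nonneg (Real.sqrt_nonneg _)]
  refine Real.sqrt_le_iff.2 ⟨add_nonneg zero_le_one (norm_nonneg _), ?_⟩
  have h := le_abs_self (f ω)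
  simp only [Pi.add_apply, Real.norm_eq_abs]
  nlinarith [abs_nonneg (f ω)]

lemma MeasureTheory.Integrable.memLp_sqrt {f : Ω → ℝ} (hf : Integrable f P)
    (h0 : ∀ ω, 0 ≤ f ω) : MemLp (fun ω => √(f ω)) 2 P := by
  rw [memLp_two_iff_integrable_sq (Real.continuous_sqrt.comp_aestronglyMeasurable hf.1)]
  simpa only [Real.sq_sqrt (h0 _)] using hf

/-- Integrable random envelopes for the oscillations of stationary arrays. -/
theorem MeasureTheory.MeasurePreserving.exists_oscEnvelopes [IsFiniteMeasure P]
    (hT : MeasurePreserving T P P)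
    {k₁ k₂ : Ω → ℝ} (h₁ : MemLp k₁ 2 P) (h₁' : ∀ ω, 0 ≤ k₁ ω) (h₂ : Integrable k₂ P)
    (h₂' : ∀ ω, 0 ≤ k₂ ω) {lam e₀ : ℝ} (hl0 : 0 < lam) (hl1 : lam < 1) (he₀ : 0 ≤ e₀) :
    ∃ W N U M H : Ω → ℝ, Integrable H P ∧ ∀ᵐ ω ∂P,
      OscEnvelopes lam e₀ (fun j => k₁ (T^[j] ω)) (fun j => k₂ (T^[j] ω)) (fun j => W (T^[j] ω))
        (fun j => N (T^[j] ω)) (fun j => U (T^[j] ω)) (fun j => M (T^[j] ω))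
        fun j => H (T^[j] ω) := by
  have hl3 : lam ^ 3 < 1 := pow_lt_one₀ hl0.le hl1 (by norm_num)
  have hl4 : lam ^ 4 < 1 := pow_lt_one₀ hl0.le hl1 (by norm_num)
  have p3 : 0 < 1 - lam ^ 3 := sub_pos.2 hl3
  have p4 : 0 < 1 - lam ^ 4 := sub_pos.2 hl4
  have hTi : ∀ {f : Ω → ℝ}, Integrable f P → Integrable (fun ω => f (T ω)) P := fun hf =>
    hT.integrable_comp_of_integrable hf
  obtain ⟨W, hWi, hW0, hW⟩ := hT.exists_geometric_envelope
    (F := fun ω => (2 * k₁ ω) ^ 2 / (1 - lam ^ 4))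
    (((h₁.const_mul 2).integrable_sq).div_const _) (fun ω => by positivity)
    (pow_nonneg hl0.le 4) hl4
  -- This is the oscillation bound of the first order integrands; it is square integrable because
  -- `k₁` is and `W` is integrable.
  set o : Ω → ℝ := fun ω => 2 * k₁ ω + √(W (T ω)) with ho
  have ho0 : ∀ ω, 0 ≤ o ω := fun ω => by have := h₁' ω; positivity
  have hoL : MemLp o 2 P :=
    (h₁.const_mul 2).add ((hTi hWi).memLp_sqrt fun ω => hW0 (T ω))
  have ho2 : Integrable (fun ω => o ω ^ 2) P := hoL.integrable_sq
  have ho1 : Integrable o P := hoL.integrable one_le_two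
  -- Adding `W` to the source term enforces `W ≤ N`. The summand `U` in the construction of `M`
  -- plays the same role.
  obtain ⟨N, hNi, hN0, hN⟩ := hT.exists_geometric_envelope
    (F := fun ω => (2 * e₀ / lam * o ω) ^ 2 / (1 - lam ^ 3) + W ω)
    ((((hoL.const_mul (2 * e₀ / lam)).integrable_sq).div_const _).add hWi)
    (fun ω => by have := hW0 ω; positivity) (pow_nonneg hl0.le 3) hl3
  obtain ⟨U, hUi, hU0, hU⟩ := hT.exists_geometric_envelope
    (F := fun ω => 2 * k₂ ω + 2 * o ω ^ 2)
    ((h₂.const_mul 2).add (ho2.const_mul 2))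
    (fun ω => by have := h₂' ω; positivity) (pow_nonneg hl0.le 4) hl4
  -- The second order remainder is integrable: its cross term is a product of two square integrable
  -- functions.
  set Q : Ω → ℝ := fun ω => e₀ * (2 * k₂ ω + U (T ω)) + 2 * (√(N (T ω)) * o ω) +
    3 * e₀ * o ω ^ 2 with hQ
  have hQ0 : ∀ ω, 0 ≤ Q ω := fun ω => by
    have := h₂' ω; have := hU0 (T ω); have := ho0 ω; positivity
  have hQi : Integrable Q P :=
    ((((h₂.const_mul 2).add (hTi hUi)).const_mul e₀).add
      ((((hTi hNi).memLp_sqrt fun ω => hN0 (T ω)).integrable_mul hoL).const_mul 2)).add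
      (ho2.const_mul (3 * e₀))
  -- The rate is `lam ^ 3` and the source `2 / lam * Q`, so that multiplication by `lam` gives the
  -- required inequality with `lam ^ 4` and `2 Q`.
  obtain ⟨M, hMi, hM0, hM⟩ := hT.exists_geometric_envelope
    (F := fun ω => 2 / lam * Q ω + U ω) ((hQi.const_mul _).add hUi)
    (fun ω => by have := hQ0 ω; have := hU0 ω; positivity) (pow_nonneg hl0.le 3) hl3
  refine ⟨W, N, U, M, fun ω => √(W ω) + U ω + o ω + (√(N (T ω)) + e₀ * o ω) +
    (k₂ ω + U (T ω) + o ω ^ 2) + (M (T ω) + Q ω), ?_, ?_⟩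
  · exact ((((hWi.sqrt.add hUi).add ho1).add ((hTi hNi).sqrt.add (ho1.const_mul _))).add
      ((h₂.add (hTi hUi)).add ho2)).add ((hTi hMi).add hQi)
  · filter_upwards [hT.ae_forall_iterate hW, hT.ae_forall_iterate hN, hT.ae_forall_iterate hU,
      hT.ae_forall_iterate hM] with ω c1 c2 c3 c4
    have hob : ∀ j, oscBound (fun j => k₁ (T^[j] ω)) (fun j => W (T^[j] ω)) j = o (T^[j] ω) :=
      fun j => by simp only [oscBound, ho, Function.iterate_succ_apply']
    have hH : ∀ j : ℕ, 0 ≤ √(W (T^[j] ω)) ∧ 0 ≤ U (T^[j] ω) ∧ 0 ≤ o (T^[j] ω) ∧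
        0 ≤ √(N (T (T^[j] ω))) + e₀ * o (T^[j] ω) ∧
        0 ≤ k₂ (T^[j] ω) + U (T (T^[j] ω)) + o (T^[j] ω) ^ 2 ∧
        0 ≤ M (T (T^[j] ω)) + Q (T^[j] ω) := fun j => by
      have := ho0 (T^[j] ω)
      have := h₂' (T^[j] ω)
      have := hU0 (T (T^[j] ω))
      refine ⟨by positivity, hU0 _, ho0 _, by positivity, by positivity,
        add_nonneg (hM0 _) (hQ0 _)⟩
    constructor <;> intro j <;> (try simp only [hob]) <;>
      (try simp only [Function.iterate_succ_apply'])
    · exact hW0 _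
    · exact c1 j
    · exact hN0 _
    · have := c2 j
      have h2 := hN0 (T (T^[j] ω))
      have : 0 ≤ lam ^ 3 * N (T (T^[j] ω)) + (2 * e₀ / lam * o (T^[j] ω)) ^ 2 / (1 - lam ^ 3) := by
        positivity
      linarith
    · have := c2 j
      have := hW0 (T^[j] ω)
      linarith
    · exact hU0 _
    · exact c3 j
    · have := c4 j
      have h2 := hM0 (T (T^[j] ω))
      have h3 := hQ0 (T^[j] ω)
      have : 0 ≤ lam ^ 3 * M (T (T^[j] ω)) + 2 / lam * Q (T^[j] ω) := by positivity
      linarith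
    · have h1 := c4 j
      have h2 := hU0 (T^[j] ω)
      have h3 : lam ^ 3 * M (T (T^[j] ω)) + 2 / lam * Q (T^[j] ω) ≤ M (T^[j] ω) := by linarith
      have h4 := mul_le_mul_of_nonneg_left h3 hl0.le
      have h5 : lam * (2 / lam * Q (T^[j] ω)) = 2 * Q (T^[j] ω) := by field_simp
      calc _ = lam * (lam ^ 3 * M (T (T^[j] ω))) + lam * (2 / lam * Q (T^[j] ω)) := by
            rw [h5]; simp only [hQ]; ring
        _ ≤ _ := by linarith
    all_goals
      obtain ⟨i1, i2, i3, i4, i5, i6⟩ := hH j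
      linarith

end Envelopes

/-! ### The stationary law of a hidden Markov model -/

namespace HMMFamily

variable {X : Type*} [TopologicalSpace X] [MeasurableSpace X] {d m : ℕ} {M : HMMFamily X d m}

lemma transition_apply (θ : M.Θ) (x : X) :
    M.transition θ x = M.μ.withDensity fun x' => ENNReal.ofReal (M.q θ x x') := by
  rw [transition, Kernel.withDensity_apply _ (M.measurable_q θ θ.2).ennreal_ofReal,
    Kernel.const_apply]

lemma emission_apply (θ : M.Θ) (x : X) :
    M.emission θ x = M.ν.withDensity fun y => ENNReal.ofReal (M.g θ y x) := by
  rw [emission, Kernel.withDensity_apply _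
    (((M.measurable_g θ θ.2).comp measurable_swap).ennreal_ofReal), Kernel.const_apply]

lemma lintegral_joint (θ : M.Θ) (z : X × EuclideanSpace ℝ (Fin m))
    {f : X × EuclideanSpace ℝ (Fin m) → ℝ≥0∞} (hf : Measurable f) :
    ∫⁻ p, f p ∂M.joint θ z =
      ∫⁻ x', ENNReal.ofReal (M.q θ z.1 x') * ∫⁻ y', f (x', y') ∂M.emission θ x' ∂M.μ := by
  rw [joint, Kernel.comap_apply, Kernel.lintegral_compProd _ _ _ hf, transition_apply,
    lintegral_withDensity_eq_lintegral_mul]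
  · rfl
  · exact ((M.measurable_q θ θ.2).comp measurable_prodMk_left).ennreal_ofReal
  · exact hf.lintegral_kernel_prod_right'

/-- Only the transition density sees the present state and the emission is common, so the bounds on
`q` minorize the joint kernel. -/
lemma smul_joint_le {c₁ C₁ : ℝ} (hc : 0 < c₁) (hC : 0 < C₁) {θ : M.Θ}
    (h : ∀ x x', c₁ ≤ M.q θ x x' ∧ M.q θ x x' ≤ C₁) (z z' : X × EuclideanSpace ℝ (Fin m)) :
    ENNReal.ofReal (c₁ / C₁) • M.joint θ z' ≤ M.joint θ z := by
  refine Measure.le_iff.2 fun s hs => ?_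
  rw [Measure.smul_apply, ← lintegral_indicator_one hs, ← lintegral_indicator_one hs,
    lintegral_joint θ z' (measurable_one.indicator hs),
    lintegral_joint θ z (measurable_one.indicator hs), smul_eq_mul,
    ← lintegral_const_mul' _ _ ENNReal.ofReal_ne_top]
  refine lintegral_mono fun x' => ?_
  rw [← mul_assoc, ← ENNReal.ofReal_mul (by positivity)]
  refine mul_le_mul_left (ENNReal.ofReal_le_ofReal ?_) _
  calc c₁ / C₁ * M.q θ z'.1 x' ≤ c₁ / C₁ * C₁ := by gcongr; exact (h _ _).2
    _ = c₁ := div_mul_cancel₀ _ hC.ne'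
    _ ≤ _ := (h _ _).1

lemma pathLaw_eq_bind (θ : M.Θ) (ρ : Measure (X × EuclideanSpace ℝ (Fin m))) :
    M.pathLaw θ ρ = ρ.bind (MarkovChain.pathKernel (M.joint θ)) :=
  MarkovChain.trajMeasure_eq_bind (K := M.joint θ) ρ

variable {π : M.Θ → Measure (X × EuclideanSpace ℝ (Fin m))} {θs : M.Θ}

lemma IsStationary.isProbabilityMeasure_pathLaw (hπ : M.IsStationary π) (θ : M.Θ) :
    IsProbabilityMeasure (M.pathLaw θ (π θ)) := by
  have := (hπ θ).1
  unfold pathLaw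
  infer_instance

lemma IsStationary.nonempty (hπ : M.IsStationary π) (θ : M.Θ) : Nonempty X := by
  have := (hπ θ).1
  obtain ⟨z⟩ : Nonempty (X × EuclideanSpace ℝ (Fin m)) := nonempty_of_isProbabilityMeasure (π θ)
  exact ⟨z.1⟩

/-- The emission density has mass one with respect to a measure concentrated on the observation
space. A point of that space is needed to extract the bounds on `q` from `A3`. -/
lemma IsStationary.obs_nonempty (hπ : M.IsStationary π) (θ : M.Θ) : M.𝒴.Nonempty := by
  obtain ⟨x⟩ := hπ.nonempty θ
  by_contra h
  have h0 := M.ν_compl_obs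
  rw [Set.not_nonempty_iff_eq_empty.1 h, Set.compl_empty, Measure.measure_univ_eq_zero] at h0
  have := M.lintegral_g θ θ.2 x
  simp [h0] at this

lemma A3.exists_bounds (h3 : M.A3) (hπ : M.IsStationary π) (θs : M.Θ) :
    ∃ c₁ C₁ : ℝ, 0 < c₁ ∧ c₁ ≤ C₁ ∧ (∀ θ ∈ M.Θ, ∀ x x', c₁ ≤ M.q θ x x' ∧ M.q θ x x' ≤ C₁) ∧
      ∀ θ ∈ M.Θ, ∀ y ∈ M.𝒴, ∀ x, M.g θ y x ≤ C₁ := by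
  obtain ⟨c₁, C₁, hc, hC, h⟩ := h3
  obtain ⟨x⟩ := hπ.nonempty θs
  obtain ⟨y, hy⟩ := hπ.obs_nonempty θs
  have h0 := h θs θs.2 x x y hy
  exact ⟨c₁, C₁, hc, h0.1.trans h0.2.1, fun θ hθ x x' => ⟨(h θ hθ x x' y hy).1,
    (h θ hθ x x' y hy).2.1⟩, fun θ hθ y hy x => (h θ hθ x x y hy).2.2⟩

lemma IsStationary.ergodic (hπ : M.IsStationary π) (h3 : M.A3) (θ : M.Θ) :
    Ergodic MarkovChain.shift (M.pathLaw θ (π θ)) := by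
  have := (hπ θ).1
  obtain ⟨c₁, C₁, hc, hC, h, -⟩ := h3.exists_bounds hπ θ
  rw [pathLaw_eq_bind]
  exact MarkovChain.ergodic_shift (hπ θ).2
    (ENNReal.ofReal_pos.2 (div_pos hc (hc.trans_le hC))).ne'
    (smul_joint_le hc (hc.trans_le hC) (h θ θ.2))

lemma IsStationary.map_eval (hπ : M.IsStationary π) (h3 : M.A3) (θ : M.Θ) (k : ℕ) :
    (M.pathLaw θ (π θ)).map (fun ω => ω k) = π θ := by
  have := (hπ θ).1
  have h1 := ((hπ.ergodic h3 θ).toMeasurePreserving.iterate k)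
  have h2 : (fun ω : ℕ → X × EuclideanSpace ℝ (Fin m) => ω k) =
      (fun ω => ω 0) ∘ MarkovChain.shift^[k] := by
    funext ω
    simp [MarkovChain.shift_iterate]
  rw [h2, ← Measure.map_map (measurable_pi_apply 0) h1.measurable, h1.map_eq, pathLaw_eq_bind,
    MarkovChain.bind_pathKernel_map_zero]

lemma IsStationary.map_obs (hπ : M.IsStationary π) (h3 : M.A3) (θ : M.Θ) (k : ℕ) :
    (M.pathLaw θ (π θ)).map (fun ω => (ω k).2) = (π θ).map Prod.snd := by
  have h := Measure.map_map (μ := M.pathLaw θ (π θ)) (measurable_snd (α := X)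
    (β := EuclideanSpace ℝ (Fin m))) (measurable_pi_apply k)
  rw [hπ.map_eval h3 θ k] at h
  exact h.symm

lemma IsStationary.measurePreserving_obs (hπ : M.IsStationary π) (h3 : M.A3) (θ : M.Θ) (k : ℕ) :
    MeasurePreserving (fun ω : ℕ → X × EuclideanSpace ℝ (Fin m) => (ω k).2)
      (M.pathLaw θ (π θ)) ((π θ).map Prod.snd) :=
  ⟨measurable_snd.comp (measurable_pi_apply k), hπ.map_obs h3 θ k⟩

/-- By invariance the law of an observation is a mixture of emission laws. It transfers statements
valid `ν`-almost everywhere, such as Lebesgue differentiation, to the observations. -/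
lemma IsStationary.map_snd_absolutelyContinuous (hπ : M.IsStationary π) (θ : M.Θ) :
    (π θ).map Prod.snd ≪ M.ν := by
  refine Measure.AbsolutelyContinuous.mk fun s hs h0 => ?_
  have hs' : MeasurableSet (Prod.snd ⁻¹' s : Set (X × EuclideanSpace ℝ (Fin m))) :=
    measurable_snd hs
  rw [Measure.map_apply measurable_snd hs, ← (hπ θ).2,
    Measure.bind_apply hs' (Kernel.aemeasurable _), lintegral_eq_zero_iff (Kernel.measurable_coe _ hs')]
  refine .of_forall fun z => ?_
  change M.joint θ z (Prod.snd ⁻¹' s) = 0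
  rw [← lintegral_indicator_one hs', lintegral_joint θ z (measurable_one.indicator hs')]
  refine lintegral_eq_zero_of_ae_eq_zero (.of_forall fun x' => ?_)
  have : M.emission θ x' s = 0 := by
    rw [emission_apply]
    exact withDensity_absolutelyContinuous _ _ h0
  have h2 : ∫⁻ y', (Prod.snd ⁻¹' s).indicator 1 (x', y') ∂M.emission θ x' =
      M.emission θ x' s := by
    rw [← lintegral_indicator_one hs]
    rfl
  simp only [h2, this, mul_zero, Pi.zero_apply]

end HMMFamily

/-! ### Likelihoods as iterated integrals -/

section PathIntegral

variable {E : Type*} [NormedAddCommGroup E] [NormedSpace ℝ E]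
variable {X : Type*} [MeasurableSpace X] {μ : Measure X} [IsFiniteMeasure μ]

omit [IsFiniteMeasure μ] [NormedAddCommGroup E] [NormedSpace ℝ E] in
lemma iterInt_add (K : ℕ → E → X → X → ℝ) (m j k : ℕ) (θ : E) (x : X) :
    iterInt μ K m (j + k) θ x = iterInt μ (fun i => K (i + k)) m j θ x := by
  induction m generalizing j x with
  | zero => rfl
  | succ m ih =>
    simp only [iterInt]
    refine integral_congr_ae (.of_forall fun z => ?_)
    simp only
    rw [← ih, add_right_comm]

omit [NormedAddCommGroup E] [NormedSpace ℝ E] in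
/-- An integral over paths is an iterated integral. -/
lemma integral_pi_prod_eq_iterInt {K : ℕ → E → X → X → ℝ} {θ : E}
    (hm : ∀ j, Measurable (Function.uncurry (K j θ))) {B : ℝ} (hB : ∀ j x z, |K j θ x z| ≤ B)
    (n : ℕ) (x₀ : X) :
    ∫ x : Fin n → X, ∏ k : Fin n, K k θ ((Fin.cons x₀ x : Fin (n + 1) → X) k.castSucc) (x k)
      ∂(Measure.pi fun _ => μ) = iterInt μ K n 0 θ x₀ := by
  induction n generalizing K x₀ with
  | zero => simp [iterInt, Measure.pi_of_empty _ (fun i : Fin 0 => i.elim0)]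
  | succ n ih =>
    have hB0 : 0 ≤ B := (abs_nonneg _).trans (hB 0 x₀ x₀)
    -- The first hidden state is split off; it becomes the starting point of the remaining path.
    have hmp := measurePreserving_piFinSuccAbove (fun _ : Fin (n + 1) => μ) 0
    set Φ : X × (Fin n → X) → ℝ := fun p => K 0 θ x₀ p.1 *
      ∏ k : Fin n, K (k + 1) θ ((Fin.cons p.1 p.2 : Fin (n + 1) → X) k.castSucc) (p.2 k) with hΦ
    have hcons : ∀ i : Fin (n + 1), Measurable fun p : X × (Fin n → X) =>
        (Fin.cons p.1 p.2 : Fin (n + 1) → X) i := by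
      intro i
      refine Fin.cases ?_ (fun i => ?_) i
      · exact measurable_fst
      · simp only [Fin.cons_succ]
        exact (measurable_pi_apply i).comp measurable_snd
    have hΦm : Measurable Φ := by
      refine ((hm 0).comp (measurable_const.prodMk measurable_fst)).mul
        (Finset.measurable_prod _ fun k _ => ?_)
      have := (hm (k + 1)).comp ((hcons k.castSucc).prodMk
        ((measurable_pi_apply (X := fun _ => X) k).comp measurable_snd))
      exact this
    have hΦi : Integrable Φ (μ.prod (Measure.pi fun _ => μ)) := by
      refine (integrable_const (B * ∏ _k : Fin n, B)).mono' hΦm.aestronglyMeasurable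
        (.of_forall fun p => ?_)
      rw [hΦ, Real.norm_eq_abs, abs_mul, Finset.abs_prod]
      exact mul_le_mul (hB _ _ _) (Finset.prod_le_prod (fun _ _ => abs_nonneg _)
        fun _ _ => hB _ _ _) (Finset.prod_nonneg fun _ _ => abs_nonneg _) hB0
    have e1 : ∫ x : Fin (n + 1) → X, ∏ k : Fin (n + 1),
        K k θ ((Fin.cons x₀ x : Fin (n + 1 + 1) → X) k.castSucc) (x k) ∂Measure.pi (fun _ => μ) =
        ∫ p, Φ p ∂(μ.prod (Measure.pi fun _ => μ)) := by
      refine Eq.trans (integral_congr_ae (.of_forall fun x => ?_)) (hmp.integral_comp' Φ)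
      simp only [hΦ, Fin.prod_univ_succ]
      refine congrArg₂ _ rfl (Finset.prod_congr rfl fun k _ => ?_)
      have e2 : (Fin.cons (x 0) (Fin.tail x) : Fin (n + 1) → X) k.castSucc = x k.castSucc := by
        rw [Fin.cons_self_tail]
      have e3 : (Fin.cons x₀ x : Fin (n + 1 + 1) → X) k.succ.castSucc = x k.castSucc := by
        rw [Fin.castSucc_succ, Fin.cons_succ]
      rw [e3, ← e2]
      rfl
    rw [e1, integral_prod _ hΦi, iterInt]
    refine integral_congr_ae (.of_forall fun z => ?_)
    simp only [hΦ]
    rw [integral_const_mul, iterInt_add, ← ih (K := fun i => K (i + 1)) (fun j => hm (j + 1))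
      (fun j => hB (j + 1))]

end PathIntegral

/-! ### Perturbed densities at good observations -/

namespace HMMFamily

variable {X : Type*} [TopologicalSpace X] [MeasurableSpace X] {d m : ℕ} {M : HMMFamily X d m}

/-- The weight of a transition from `x` to `z` together with the observation at time `j + 1`. -/
def pertKernel (M : HMMFamily X d m) (ε : ℝ) (y : ℕ → EuclideanSpace ℝ (Fin m)) (j : ℕ)
    (θ : EuclideanSpace ℝ (Fin d)) (x z : X) : ℝ :=
  M.q θ x z * M.gPert ε θ (y (j + 1)) z

/-- The law of the perturbation of an observation. -/
def pertMeasure (M : HMMFamily X d m) (ε : ℝ) (y : EuclideanSpace ℝ (Fin m)) :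
    Measure (EuclideanSpace ℝ (Fin m)) :=
  if ε = 0 then Measure.dirac y else
    (M.ν.restrict (Metric.closedBall y ε) Set.univ)⁻¹ • M.ν.restrict (Metric.closedBall y ε)

/-- With a Dirac mass for `ε = 0`, the original and the perturbed model are both averages over a
probability measure and can be treated together. -/
lemma gPert_eq_integral (ε : ℝ) (θ : EuclideanSpace ℝ (Fin d)) (y : EuclideanSpace ℝ (Fin m))
    (x : X) : M.gPert ε θ y x = ∫ y', M.g θ y' x ∂M.pertMeasure ε y := by
  rw [gPert, pertMeasure]
  split_ifs with h
  · rw [integral_dirac]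
  · rfl

/-- An observation around which the derivatives of the logarithms of the conditional densities
are bounded. -/
structure GoodObs (M : HMMFamily X d m) (ε κ G₁ G₂ G₃ : ℝ) (y : EuclideanSpace ℝ (Fin m)) :
    Prop where
  mem : y ∈ M.𝒴
  ball_pos : ε ≠ 0 → 0 < M.ν (Metric.closedBall y ε)
  ε_nonneg : 0 ≤ ε
  ε_le : ε ≤ κ
  G₁_nonneg : 0 ≤ G₁
  G₂_nonneg : 0 ≤ G₂
  G₃_nonneg : 0 ≤ G₃
  first : ∀ θ ∈ M.Θ, ∀ x, ∀ y' ∈ M.𝒴, dist y' y ≤ κ → 0 < M.g θ y' x →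
    ‖fderivWithin ℝ (fun τ => Real.log (M.g τ y' x)) M.Θ θ‖ ≤ G₁
  second : ∀ θ ∈ M.Θ, ∀ x, ∀ y' ∈ M.𝒴, dist y' y ≤ κ → 0 < M.g θ y' x →
    ‖fderivWithin₂ (fun τ => Real.log (M.g τ y' x)) M.Θ θ‖ ≤ G₂
  third : ∀ θ ∈ M.Θ, ∀ x, ∀ y' ∈ M.𝒴, dist y' y ≤ κ → 0 < M.g θ y' x →
    ‖fderivWithin ℝ (fderivWithin₂ (fun τ => Real.log (M.g τ y' x)) M.Θ) M.Θ θ‖ ≤ G₃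

section

variable {ε κ G₁ G₂ G₃ : ℝ} {y : EuclideanSpace ℝ (Fin m)}

lemma GoodObs.isProbabilityMeasure (h : M.GoodObs ε κ G₁ G₂ G₃ y) :
    IsProbabilityMeasure (M.pertMeasure ε y) := by
  rw [pertMeasure]
  split_ifs with h0
  · infer_instance
  · refine ⟨?_⟩
    rw [Measure.smul_apply, Measure.restrict_apply_univ, smul_eq_mul]
    exact ENNReal.inv_mul_cancel (h.ball_pos h0).ne'
      (isCompact_closedBall y ε).measure_lt_top.ne

lemma GoodObs.ae_pertMeasure (h : M.GoodObs ε κ G₁ G₂ G₃ y) :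
    ∀ᵐ y' ∂M.pertMeasure ε y, y' ∈ M.𝒴 ∧ dist y' y ≤ ε := by
  rw [pertMeasure]
  split_ifs with h0
  · rw [ae_dirac_eq]
    simpa [h0] using h.mem
  · refine Measure.ae_smul_measure ?_ _
    filter_upwards [ae_restrict_mem Metric.isClosed_closedBall.measurableSet,
      ae_restrict_of_ae (show ∀ᵐ y' ∂M.ν, y' ∈ M.𝒴 from M.ν_compl_obs)] with y' h1 h2
    exact ⟨h2, h1⟩

lemma GoodObs.tame_g (h : M.GoodObs ε κ G₁ G₂ G₃ y) (hu : UniqueDiffOn ℝ M.Θ) (h2 : M.A2)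
    {y' : EuclideanSpace ℝ (Fin m)} (hy' : y' ∈ M.𝒴) (hd : dist y' y ≤ κ) (x : X) :
    Tame M.Θ G₁ (G₂ + G₁ ^ 2) fun θ => M.g θ y' x :=
  tame_of_log hu ((h2.2 y' hy' x).of_le (by norm_num)) (fun θ hθ => M.g_nonneg θ hθ y' hy' x)
    (fun θ hθ hp => h.first θ hθ x y' hy' hd hp) fun θ hθ hp => h.second θ hθ x y' hy' hd hp

/-- All densities at points of the ball are tame with the same constants, so their average is too,
with constants independent of `ε` and without a lower bound on `g`. -/
lemma GoodObs.tame_gPert {C C₁ : ℝ≥0} (h : M.GoodObs ε κ G₁ G₂ G₃ y)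
    (hS : QuasiconvexWith C M.Θ) (hu : UniqueDiffOn ℝ M.Θ)
    (h2 : M.A2) (hC : ∀ θ ∈ M.Θ, ∀ y ∈ M.𝒴, ∀ x, M.g θ y x ≤ C₁) (x : X) :
    Tame M.Θ G₁ (G₂ + G₁ ^ 2) (fun θ => M.gPert ε θ y x) ∧
    (∀ θ ∈ M.Θ, fderivWithin ℝ (fun θ => M.gPert ε θ y x) M.Θ θ =
      ∫ y', fderivWithin ℝ (fun θ => M.g θ y' x) M.Θ θ ∂M.pertMeasure ε y) ∧
    (∀ θ ∈ M.Θ, fderivWithin₂ (fun θ => M.gPert ε θ y x) M.Θ θ =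
      ∫ y', fderivWithin₂ (fun θ => M.g θ y' x) M.Θ θ ∂M.pertMeasure ε y) ∧
    (∀ θ ∈ M.Θ, Integrable (fun y' => M.g θ y' x) (M.pertMeasure ε y) ∧
      Integrable (fun y' => fderivWithin ℝ (fun θ => M.g θ y' x) M.Θ θ) (M.pertMeasure ε y) ∧
      Integrable (fun y' => fderivWithin₂ (fun θ => M.g θ y' x) M.Θ θ) (M.pertMeasure ε y)) := by
  have := h.isProbabilityMeasure
  simp only [gPert_eq_integral]
  refine Tame.integral hS hu (f := fun θ y' => M.g θ y' x)
    (fun θ hθ => ((M.measurable_g θ hθ).comp measurable_prodMk_right).aestronglyMeasurable)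
    ?_ (B := fun _ => C₁) ?_ (integrable_const _) h.G₁_nonneg
    (by have := h.G₂_nonneg; positivity)
  · filter_upwards [h.ae_pertMeasure] with y' hy'
    exact h.tame_g hu h2 hy'.1 (hy'.2.trans h.ε_le) x
  · filter_upwards [h.ae_pertMeasure] with y' hy' θ hθ
    exact hC θ hθ y' hy'.1 x

lemma GoodObs.gPert_le {C₁ : ℝ≥0} (h : M.GoodObs ε κ G₁ G₂ G₃ y)
    (hC : ∀ θ ∈ M.Θ, ∀ y ∈ M.𝒴, ∀ x, M.g θ y x ≤ C₁) {θ : EuclideanSpace ℝ (Fin d)}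
    (hθ : θ ∈ M.Θ) (x : X) : M.gPert ε θ y x ≤ C₁ := by
  have := h.isProbabilityMeasure
  rw [gPert_eq_integral]
  have h1 : ∀ᵐ y' ∂M.pertMeasure ε y, ‖M.g θ y' x‖ ≤ (C₁ : ℝ) := by
    filter_upwards [h.ae_pertMeasure] with y' hy'
    rw [Real.norm_of_nonneg (M.g_nonneg θ hθ y' hy'.1 x)]
    exact hC θ hθ y' hy'.1 x
  have := norm_integral_le_of_norm_le_const h1
  rw [probReal_univ, mul_one] at this
  exact (le_abs_self _).trans this

lemma GoodObs.gPert_nonneg (h : M.GoodObs ε κ G₁ G₂ G₃ y)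
    {θ : EuclideanSpace ℝ (Fin d)} (hθ : θ ∈ M.Θ) (x : X) : 0 ≤ M.gPert ε θ y x := by
  rw [gPert_eq_integral]
  refine integral_nonneg_of_ae ?_
  filter_upwards [h.ae_pertMeasure] with y' hy' using M.g_nonneg θ hθ y' hy'.1 x

lemma measurable_gPert (ε : ℝ) {θ : EuclideanSpace ℝ (Fin d)} (hθ : θ ∈ M.Θ) :
    Measurable fun p : EuclideanSpace ℝ (Fin m) × X => M.gPert ε θ p.1 p.2 := by
  by_cases h0 : ε = 0
  · simp only [gPert, h0, if_true]
    exact M.measurable_g θ hθ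
  · simp only [gPert, h0, if_false, setAverage_eq]
    have hs : MeasurableSet {p : EuclideanSpace ℝ (Fin m) × EuclideanSpace ℝ (Fin m) |
        p.2 ∈ Metric.closedBall p.1 ε} :=
      measurableSet_le (measurable_snd.dist measurable_fst) measurable_const
    have h1 : Measurable fun y => M.ν.real (Metric.closedBall y ε) :=
      (measurable_measure_prodMk_left hs).ennreal_toReal
    refine (h1.comp measurable_fst).inv.smul ?_
    set A : Set ((EuclideanSpace ℝ (Fin m) × X) × EuclideanSpace ℝ (Fin m)) :=
      {p | dist p.2 p.1.1 ≤ ε} with hA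
    have hAm : MeasurableSet A :=
      measurableSet_le (measurable_snd.dist (measurable_fst.comp measurable_fst)) measurable_const
    have h2 : Measurable fun p : (EuclideanSpace ℝ (Fin m) × X) × EuclideanSpace ℝ (Fin m) =>
        M.g θ p.2 p.1.2 :=
      (M.measurable_g θ hθ).comp (measurable_snd.prodMk (measurable_snd.comp measurable_fst))
    have h3 := ((h2.indicator hAm).stronglyMeasurable.integral_prod_right' (ν := M.ν)).measurable
    convert h3 using 2 with p
    rw [← integral_indicator Metric.isClosed_closedBall.measurableSet]
    rfl

/-- After exchanging the integrals this is an average of the positive numbers `∫ g_θ(y' | x) μ(dx)`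
under a probability measure. -/
lemma GoodObs.integral_gPert_pos {C₁ : ℝ≥0} (h : M.GoodObs ε κ G₁ G₂ G₃ y) (h5 : M.A5)
    (hC : ∀ θ ∈ M.Θ, ∀ y ∈ M.𝒴, ∀ x, M.g θ y x ≤ C₁) {θ : EuclideanSpace ℝ (Fin d)}
    (hθ : θ ∈ M.Θ) : 0 < ∫ x, M.gPert ε θ y x ∂M.μ := by
  have := h.isProbabilityMeasure
  simp only [gPert_eq_integral]
  have hm : Measurable fun p : X × EuclideanSpace ℝ (Fin m) => M.g θ p.2 p.1 :=
    (M.measurable_g θ hθ).comp measurable_swap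
  have hb : ∀ᵐ p ∂M.μ.prod (M.pertMeasure ε y), ‖M.g θ p.2 p.1‖ ≤ (C₁ : ℝ) := by
    have : ∀ᵐ p ∂M.μ.prod (M.pertMeasure ε y), p.2 ∈ M.𝒴 :=
      Measure.quasiMeasurePreserving_snd.ae (h.ae_pertMeasure.mono fun y' h => h.1)
    filter_upwards [this] with p hp
    rw [Real.norm_of_nonneg (M.g_nonneg θ hθ _ hp _)]
    exact hC θ hθ _ hp _
  rw [integral_integral_swap (f := fun x y' => M.g θ y' x)
    ((integrable_const (C₁ : ℝ)).mono' hm.aestronglyMeasurable hb)]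
  have hpos : ∀ᵐ y' ∂M.pertMeasure ε y, 0 < ∫ x, M.g θ y' x ∂M.μ := by
    filter_upwards [h.ae_pertMeasure] with y' hy' using (h5 θ hθ y' hy'.1).2
  have hi : Integrable (fun y' => ∫ x, M.g θ y' x ∂M.μ) (M.pertMeasure ε y) :=
    Integrable.integral_prod_right ((integrable_const (C₁ : ℝ)).mono' hm.aestronglyMeasurable hb)
  have hnn : 0 ≤ᵐ[M.pertMeasure ε y] fun y' => ∫ x, M.g θ y' x ∂M.μ := hpos.mono fun _ h => h.le
  refine lt_of_le_of_ne (integral_nonneg_of_ae hnn) fun h0 => ?_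
  obtain ⟨y', h1, h2⟩ := (hpos.and ((integral_eq_zero_iff_of_nonneg_ae hnn hi).1 h0.symm)).exists
  exact h1.ne' h2

lemma tame_q (hu : UniqueDiffOn ℝ M.Θ) (h2 : M.A2) {c C₂ : ℝ} (hc : 0 < c)
    (hq : ∀ θ ∈ M.Θ, ∀ x x', c ≤ M.q θ x x') (h4 : ∀ θ ∈ M.Θ, ∀ x x',
      ‖iteratedFDerivWithin ℝ 1 (fun τ => Real.log (M.q τ x x')) M.Θ θ‖ ≤ C₂ ∧
      ‖iteratedFDerivWithin ℝ 2 (fun τ => Real.log (M.q τ x x')) M.Θ θ‖ ≤ C₂) (x x' : X) :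
    Tame M.Θ C₂ (C₂ + C₂ ^ 2) fun θ => M.q θ x x' := by
  refine tame_of_log hu ((h2.1 x x').of_le (by norm_num))
    (fun θ hθ => hc.le.trans (hq θ hθ x x')) (fun θ hθ _ => ?_) fun θ hθ _ => ?_
  · rw [← norm_iteratedFDerivWithin_one _ (hu θ hθ)]
    exact (h4 θ hθ x x').1
  · rw [← norm_iteratedFDerivWithin_two hu hθ]
    exact (h4 θ hθ x x').2

end

end HMMFamily

/-! ### Regularity and forgetting for the perturbed likelihoods -/

namespace HMMFamily

variable {X : Type*} [TopologicalSpace X] [MeasurableSpace X] {d m : ℕ} {M : HMMFamily X d m}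

lemma measurable_gPert_comp (ε : ℝ) {θ : EuclideanSpace ℝ (Fin d)} (hθ : θ ∈ M.Θ) {α : Type*}
    [MeasurableSpace α] {f : α → EuclideanSpace ℝ (Fin m)} {h : α → X} (hf : Measurable f)
    (hh : Measurable h) : Measurable fun a => M.gPert ε θ (f a) (h a) := by
  have := (measurable_gPert ε hθ).comp (hf.prodMk hh)
  exact this

lemma measurable_q_comp {θ : EuclideanSpace ℝ (Fin d)} (hθ : θ ∈ M.Θ) {α : Type*}
    [MeasurableSpace α] {f h : α → X} (hf : Measurable f)
    (hh : Measurable h) : Measurable fun a => M.q θ (f a) (h a) := by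
  have := (M.measurable_q θ hθ).comp (hf.prodMk hh)
  exact this

lemma measurable_pertKernel_comp (ε : ℝ) {θ : EuclideanSpace ℝ (Fin d)} (hθ : θ ∈ M.Θ) (j : ℕ)
    {α : Type*} [MeasurableSpace α] {y : α → ℕ → EuclideanSpace ℝ (Fin m)} {f h : α → X}
    (hy : Measurable fun a => y a (j + 1)) (hf : Measurable f) (hh : Measurable h) :
    Measurable fun a => M.pertKernel ε (y a) j θ (f a) (h a) := by
  unfold pertKernel
  exact (measurable_q_comp hθ hf hh).mul (measurable_gPert_comp ε hθ hy hh)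

/-- The standing regularity assumptions, with explicit constants. -/
structure Regular (M : HMMFamily X d m) (C C₁ : ℝ≥0) (c₁ C₂ : ℝ) : Prop where
  compact : IsCompact M.Θ
  quasiconvex : QuasiconvexWith C M.Θ
  uniqueDiff : UniqueDiffOn ℝ M.Θ
  smooth : M.A2
  c₁_pos : 0 < c₁
  c₁_le : c₁ ≤ C₁
  le_q : ∀ θ ∈ M.Θ, ∀ x x', c₁ ≤ M.q θ x x'
  q_le : ∀ θ ∈ M.Θ, ∀ x x', M.q θ x x' ≤ C₁
  g_le : ∀ θ ∈ M.Θ, ∀ y ∈ M.𝒴, ∀ x, M.g θ y x ≤ C₁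
  C₂_nonneg : 0 ≤ C₂
  log_q : ∀ θ ∈ M.Θ, ∀ x x',
      ‖iteratedFDerivWithin ℝ 1 (fun τ => Real.log (M.q τ x x')) M.Θ θ‖ ≤ C₂ ∧
      ‖iteratedFDerivWithin ℝ 2 (fun τ => Real.log (M.q τ x x')) M.Θ θ‖ ≤ C₂
  obs_pos : M.A5

variable {π : M.Θ → Measure (X × EuclideanSpace ℝ (Fin m))} {θs : M.Θ}

lemma IsStationary.exists_regular (hπ : M.IsStationary π) (θs : M.Θ) (hΘ : M.RegularParam)
    (h2 : M.A2) (h3 : M.A3) (h4 : M.A4) (h5 : M.A5) :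
    ∃ (C C₁ : ℝ≥0) (c₁ C₂ : ℝ), M.Regular C C₁ c₁ C₂ := by
  obtain ⟨c₁, C₁, hc, hC, hq, hg⟩ := h3.exists_bounds hπ θs
  obtain ⟨C, hQ⟩ := hΘ.quasiconvex
  obtain ⟨C₂, hC₂, hlq⟩ := h4
  have e : ((Real.toNNReal C₁ : ℝ≥0) : ℝ) = C₁ := Real.coe_toNNReal _ (hc.le.trans hC)
  exact ⟨C, Real.toNNReal C₁, c₁, C₂, hΘ.compact, hQ, hΘ.uniqueDiff, h2, hc, by rwa [e],
    fun θ hθ x x' => (hq θ hθ x x').1, fun θ hθ x x' => by rw [e]; exact (hq θ hθ x x').2,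
    fun θ hθ y hy x => by rw [e]; exact hg θ hθ y hy x, hC₂.le, hlq, h5⟩

section

variable {C C₁ : ℝ≥0} {c₁ C₂ : ℝ} (hM : M.Regular C C₁ c₁ C₂) {ε κ : ℝ}

include hM

lemma Regular.integral_kernel_pos {y : EuclideanSpace ℝ (Fin m)} {G₁ G₂ G₃ : ℝ}
    (hy : M.GoodObs ε κ G₁ G₂ G₃ y) {θ : EuclideanSpace ℝ (Fin d)} (hθ : θ ∈ M.Θ) (x : X) :
    0 < ∫ z, M.q θ x z * M.gPert ε θ y z ∂M.μ := by
  have hg : Measurable fun z => M.gPert ε θ y z :=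
    measurable_gPert_comp ε hθ measurable_const measurable_id
  have hgi : Integrable (fun z => M.gPert ε θ y z) M.μ :=
    (integrable_const (C₁ : ℝ)).mono' hg.aestronglyMeasurable (.of_forall fun z => by
      rw [Real.norm_of_nonneg (hy.gPert_nonneg hθ z)]
      exact hy.gPert_le hM.g_le hθ z)
  have hqm : Measurable fun z => M.q θ x z :=
    measurable_q_comp hθ measurable_const measurable_id
  have hi : Integrable (fun z => M.q θ x z * M.gPert ε θ y z) M.μ :=
    (hgi.const_mul C₁).mono' (hqm.mul hg).aestronglyMeasurable (.of_forall fun z => by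
      rw [Real.norm_of_nonneg (mul_nonneg (hM.c₁_pos.le.trans (hM.le_q θ hθ x z))
        (hy.gPert_nonneg hθ z))]
      exact mul_le_mul_of_nonneg_right (hM.q_le θ hθ x z) (hy.gPert_nonneg hθ z))
  refine (mul_pos hM.c₁_pos (hy.integral_gPert_pos hM.obs_pos hM.g_le hθ)).trans_le ?_
  rw [← integral_const_mul]
  exact integral_mono (hgi.const_mul _) hi fun z =>
    mul_le_mul_of_nonneg_right (hM.le_q θ hθ x z) (hy.gPert_nonneg hθ z)

lemma Regular.kernel_comparable {y : EuclideanSpace ℝ (Fin m)} {G₁ G₂ G₃ : ℝ}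
    (hy : M.GoodObs ε κ G₁ G₂ G₃ y) {θ : EuclideanSpace ℝ (Fin d)} (hθ : θ ∈ M.Θ) (x x' z : X) :
    c₁ / C₁ * (M.q θ x' z * M.gPert ε θ y z) ≤ M.q θ x z * M.gPert ε θ y z := by
  have hC₁ : (0 : ℝ) < C₁ := hM.c₁_pos.trans_le hM.c₁_le
  rw [← mul_assoc]
  refine mul_le_mul_of_nonneg_right ?_ (hy.gPert_nonneg hθ z)
  calc c₁ / C₁ * M.q θ x' z ≤ c₁ / C₁ * C₁ :=
        mul_le_mul_of_nonneg_left (hM.q_le θ hθ x' z) (div_pos hM.c₁_pos hC₁).le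
    _ = c₁ := div_mul_cancel₀ _ hC₁.ne'
    _ ≤ _ := hM.le_q θ hθ x z

/-- The comparison constant `c₁ / C₁` comes from `q` alone, so the rate of forgetting depends
neither on the observations nor on `ε`. The other constants follow the product rule for `q` and
`g^ε`. -/
lemma Regular.tameKernels {y : ℕ → EuclideanSpace ℝ (Fin m)} {G₁ G₂ G₃ : ℕ → ℝ}
    (hy : ∀ j, M.GoodObs ε κ (G₁ j) (G₂ j) (G₃ j) (y (j + 1))) :
    TameKernels M.Θ M.μ (M.pertKernel ε y) (c₁ / C₁) (fun j => C₂ + G₁ j)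
      fun j => C₂ + C₂ ^ 2 + 2 * (C₂ * G₁ j) + (G₂ j + G₁ j ^ 2) := by
  have hC₁ : (0 : ℝ) < C₁ := hM.c₁_pos.trans_le hM.c₁_le
  have hC₂ := hM.C₂_nonneg
  refine ⟨fun j θ hθ => ?_, fun j x z => ?_, fun j => add_nonneg hC₂ (hy j).G₁_nonneg, fun j => ?_,
    fun j => ⟨C₁ * C₁, by positivity, fun θ hθ x z => ?_⟩, div_pos hM.c₁_pos hC₁,
    (div_le_one hC₁).2 hM.c₁_le, fun j θ hθ x x' z => ?_, fun j θ hθ x => ?_⟩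
  · exact measurable_pertKernel_comp ε hθ j measurable_const measurable_fst measurable_snd
  · exact (tame_q hM.uniqueDiff hM.smooth hM.c₁_pos hM.le_q hM.log_q x z).mul hM.uniqueDiff
      ((hy j).tame_gPert hM.quasiconvex hM.uniqueDiff hM.smooth hM.g_le z).1
  · have := (hy j).G₁_nonneg
    have := (hy j).G₂_nonneg
    positivity
  · exact mul_le_mul (hM.q_le θ hθ x z) ((hy j).gPert_le hM.g_le hθ z) ((hy j).gPert_nonneg hθ z)
      hC₁.le
  · exact hM.kernel_comparable (hy j) hθ x x' z
  · exact hM.integral_kernel_pos (hy j) hθ x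

lemma Regular.likelihood_eq {y : ℕ → EuclideanSpace ℝ (Fin m)} {G₁ G₂ G₃ : ℕ → ℝ}
    (hy : ∀ j, M.GoodObs ε κ (G₁ j) (G₂ j) (G₃ j) (y (j + 1))) (n : ℕ) (x : X)
    {θ : EuclideanSpace ℝ (Fin d)} (hθ : θ ∈ M.Θ) :
    M.likelihood ε n y x θ = iterInt M.μ (M.pertKernel ε y) n 0 θ x := by
  have hK := hM.tameKernels hy
  have hC₁ : (0 : ℝ) < C₁ := hM.c₁_pos.trans_le hM.c₁_le
  refine integral_pi_prod_eq_iterInt (K := M.pertKernel ε y) (fun j => hK.measurable j θ hθ)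
    (B := C₁ * C₁) (fun j x z => ?_) n x
  rw [abs_of_nonneg ((hK.tame j x z).nonneg θ hθ)]
  exact mul_le_mul (hM.q_le θ hθ x z) ((hy j).gPert_le hM.g_le hθ z) ((hy j).gPert_nonneg hθ z)
      hC₁.le

omit hM in
lemma measurable_iterInt_pertKernel (ε : ℝ) {θ : EuclideanSpace ℝ (Fin d)} (hθ : θ ∈ M.Θ)
    (n j : ℕ) : Measurable fun p : (ℕ → X × EuclideanSpace ℝ (Fin m)) × X =>
      iterInt M.μ (M.pertKernel ε fun k => (p.1 k).2) n j θ p.2 := by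
  induction n generalizing j with
  | zero => exact measurable_const
  | succ n ih =>
    have h1 : Measurable fun p : ((ℕ → X × EuclideanSpace ℝ (Fin m)) × X) × X =>
        M.pertKernel ε (fun k => (p.1.1 k).2) j θ p.1.2 p.2 *
          iterInt M.μ (M.pertKernel ε fun k => (p.1.1 k).2) n (j + 1) θ p.2 := by
      have a1 : Measurable fun p : ((ℕ → X × EuclideanSpace ℝ (Fin m)) × X) × X =>
          M.pertKernel ε (fun k => (p.1.1 k).2) j θ p.1.2 p.2 :=
        measurable_pertKernel_comp ε hθ j (measurable_snd.comp ((measurable_pi_apply (j + 1)).comp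
          (measurable_fst.comp measurable_fst))) (measurable_snd.comp measurable_fst) measurable_snd
      have a0 : Measurable fun p : ((ℕ → X × EuclideanSpace ℝ (Fin m)) × X) × X => (p.1.1, p.2) :=
        (measurable_fst.comp measurable_fst).prodMk measurable_snd
      have a3 : Measurable fun p : ((ℕ → X × EuclideanSpace ℝ (Fin m)) × X) × X =>
          iterInt M.μ (M.pertKernel ε fun k => (p.1.1 k).2) n (j + 1) θ p.2 := (ih (j + 1)).comp a0
      exact a1.mul a3
    exact (h1.stronglyMeasurable.integral_prod_right' (ν := M.μ)).measurable

/-- The derivatives of the log-likelihood are measurable functions of the observations. -/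
lemma Regular.aestronglyMeasurable_logDeriv {P : Measure (ℕ → X × EuclideanSpace ℝ (Fin m))}
    {G₁ G₂ G₃ : EuclideanSpace ℝ (Fin m) → ℝ}
    (hP : ∀ᵐ ω ∂P, ∀ j, M.GoodObs ε κ (G₁ (ω j).2) (G₂ (ω j).2) (G₃ (ω j).2) (ω j).2)
    (n j : ℕ) (x : X) {θ : EuclideanSpace ℝ (Fin d)} (hθ : θ ∈ M.Θ) :
    AEStronglyMeasurable (fun ω => logDeriv₁ M.Θ M.μ (M.pertKernel ε fun k => (ω k).2) n j θ x) P ∧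
    AEStronglyMeasurable (fun ω => logDeriv₂ M.Θ M.μ (M.pertKernel ε fun k => (ω k).2) n j θ x) P := by
  have hd : ∀ᵐ ω ∂P, (∀ θ ∈ M.Θ, HasFDerivWithinAt
      (fun τ => Real.log (iterInt M.μ (M.pertKernel ε fun k => (ω k).2) n j τ x))
      (logDeriv₁ M.Θ M.μ (M.pertKernel ε fun k => (ω k).2) n j θ x) M.Θ θ) ∧
      ∀ θ ∈ M.Θ, HasFDerivWithinAt
      (fun τ => logDeriv₁ M.Θ M.μ (M.pertKernel ε fun k => (ω k).2) n j τ x)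
      (logDeriv₂ M.Θ M.μ (M.pertKernel ε fun k => (ω k).2) n j θ x) M.Θ θ := by
    filter_upwards [hP] with ω hω
    have hK := hM.tameKernels (y := fun k => (ω k).2) fun j => hω (j + 1)
    have hI := hK.tameIter hM.quasiconvex hM.uniqueDiff n j
    obtain ⟨b₁, b₂, -, -, ht⟩ := hI.tame
    have hcd := (contDiffOn_two_iff hM.uniqueDiff).1
      ((ht x).contDiffOn.log fun θ hθ => (hI.pos θ hθ x).ne')
    exact ⟨hcd.1, hcd.2.1⟩
  have hm0 : ∀ θ ∈ M.Θ, AEStronglyMeasurable (fun ω : ℕ → X × EuclideanSpace ℝ (Fin m) =>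
      Real.log (iterInt M.μ (M.pertKernel ε fun k => (ω k).2) n j θ x)) P := fun θ hθ =>
    (Real.measurable_log.comp ((measurable_iterInt_pertKernel ε hθ n j).comp
      measurable_prodMk_right)).aestronglyMeasurable
  have hm1 : ∀ θ ∈ M.Θ, AEStronglyMeasurable (fun ω : ℕ → X × EuclideanSpace ℝ (Fin m) =>
      logDeriv₁ M.Θ M.μ (M.pertKernel ε fun k => (ω k).2) n j θ x) P := fun θ hθ =>
    aestronglyMeasurable_fderivWithin (hM.uniqueDiff θ hθ) hθ hm0
      (hd.mono fun ω h => (h.1 θ hθ).differentiableWithinAt)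
  exact ⟨hm1 θ hθ, aestronglyMeasurable_fderivWithin (hM.uniqueDiff θ hθ) hθ hm1
      (hd.mono fun ω h => (h.2 θ hθ).differentiableWithinAt)⟩

end

/-- Starting at time `j` amounts to shifting the observations by `j`, so the arrays are stationary
functions along the orbit of the shift. -/
lemma logDeriv_shift (ε : ℝ) (ω : ℕ → X × EuclideanSpace ℝ (Fin m)) (n j : ℕ) :
    logDeriv₁ M.Θ M.μ (M.pertKernel ε fun k => (ω k).2) n j =
      logDeriv₁ M.Θ M.μ (M.pertKernel ε fun k => (MarkovChain.shift^[j] ω k).2) n 0 ∧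
    logDeriv₂ M.Θ M.μ (M.pertKernel ε fun k => (ω k).2) n j =
      logDeriv₂ M.Θ M.μ (M.pertKernel ε fun k => (MarkovChain.shift^[j] ω k).2) n 0 := by
  have e : ∀ τ x, iterInt M.μ (M.pertKernel ε fun k => (ω k).2) n j τ x =
      iterInt M.μ (M.pertKernel ε fun k => (MarkovChain.shift^[j] ω k).2) n 0 τ x := by
    intro τ x
    have h := iterInt_add (μ := M.μ) (M.pertKernel ε fun k => (ω k).2) n 0 j τ x
    rw [zero_add] at h
    rw [h]
    congr 1
    funext i θ x z
    rw [pertKernel, pertKernel, MarkovChain.shift_iterate, add_right_comm]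
  constructor <;> funext θ x <;> simp only [logDeriv₁, logDeriv₂, e]

/-- The moment assumption in terms of observations around which the logarithmic derivatives are
bounded. -/
lemma A6.exists_goodObs (h6 : M.A6 π θs) (hu : UniqueDiffOn ℝ M.Θ) (hπ : M.IsStationary π)
    {κ : ℝ} (hκ : 0 < κ) :
    ∃ G₁ G₂ G₃ : EuclideanSpace ℝ (Fin m) → ℝ≥0,
      MemLp (fun y => (G₁ y : ℝ)) 2 ((π θs).map Prod.snd) ∧
      Integrable (fun y => (G₂ y : ℝ)) ((π θs).map Prod.snd) ∧
      ∀ᵐ y ∂(π θs).map Prod.snd, ∀ ε ∈ Set.Icc 0 κ,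
        M.GoodObs ε κ (G₁ y) (G₂ y) (G₃ y) y := by
  have := (hπ θs).1
  have : IsProbabilityMeasure ((π θs).map Prod.snd) :=
    Measure.isProbabilityMeasure_map measurable_snd.aemeasurable
  obtain ⟨⟨G₁, hm₁, hi₁, hb₁⟩, ⟨G₂, hm₂, hi₂, hb₂⟩, ⟨G₃, -, -, hb₃⟩⟩ := h6 κ hκ
  have hL : ∀ (G : EuclideanSpace ℝ (Fin m) → ℝ≥0) (p : ℕ), p ≠ 0 → Measurable G →
      ∫⁻ y, (G y : ℝ≥0∞) ^ p ∂(π θs).map Prod.snd < ∞ →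
      MemLp (fun y => (G y : ℝ)) p ((π θs).map Prod.snd) := by
    intro G p hp hm hi
    refine ⟨hm.coe_nnreal_real.aestronglyMeasurable, ?_⟩
    rw [eLpNorm_lt_top_iff_lintegral_rpow_enorm_lt_top (by exact_mod_cast hp)
      (ENNReal.natCast_ne_top p)]
    simpa using hi
  have hac := hπ.map_snd_absolutelyContinuous θs
  refine ⟨G₁, G₂, G₃, (hL G₁ 3 (by norm_num) hm₁ hi₁).mono_exponent (by norm_num),
    (hL G₂ 2 (by norm_num) hm₂ hi₂).integrable (by norm_num), ?_⟩
  filter_upwards [hb₁, hb₂, hb₃, hac (show ∀ᵐ y ∂M.ν, y ∈ M.𝒴 from M.ν_compl_obs),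
    hac Measure.support_mem_ae] with y c1 c2 c3 c4 c5 ε hε
  refine ⟨c4, fun h0 => ?_, hε.1, hε.2, NNReal.coe_nonneg _, NNReal.coe_nonneg _,
    NNReal.coe_nonneg _, fun θ hθ x y' hy' hd hp => ?_, fun θ hθ x y' hy' hd hp => ?_,
    fun θ hθ x y' hy' hd hp => ?_⟩
  -- Almost every observation lies in the support of `ν`, so every ball of positive radius around it
  -- has positive mass and the average is meaningful.
  · exact (Measure.mem_support_iff_forall y).1 c5 _
      (Metric.closedBall_mem_nhds y (lt_of_le_of_ne hε.1 (Ne.symm h0)))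
  · rw [← norm_iteratedFDerivWithin_one _ (hu θ hθ)]
    exact c1 θ hθ x y' hy' hd hp
  · rw [← norm_iteratedFDerivWithin_two hu hθ]
    exact c2 θ hθ x y' hy' hd hp
  · rw [← norm_iteratedFDerivWithin_three hu hθ]
    exact c3 θ hθ x y' hy' hd hp

/-- With `lam = 1 - α² / 8`, Bernoulli's inequality gives `lam ^ 4 ≥ 1 - α² / 2`. -/
lemma exists_rate {α : ℝ} (h0 : 0 < α) (h1 : α ≤ 1) :
    ∃ lam : ℝ, 0 < lam ∧ lam < 1 ∧ 1 - lam ^ 4 ≤ α ^ 2 := by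
  refine ⟨1 - α ^ 2 / 8, by nlinarith, by nlinarith [pow_pos h0 2], ?_⟩
  have := one_add_mul_le_pow (a := -(α ^ 2 / 8)) (by nlinarith) 4
  norm_num at this
  rw [sub_eq_add_neg (1 : ℝ) (α ^ 2 / 8)]
  nlinarith [pow_pos h0 2]

/-- Along almost all observation sequences, and for all perturbations of bounded size, the
derivatives of the log-likelihoods form stationary forgetting arrays. -/
theorem Regular.exists_forgettingArray {C C₁ : ℝ≥0} {c₁ C₂ : ℝ} (hM : M.Regular C C₁ c₁ C₂)
    (hπ : M.IsStationary π) (h3 : M.A3) (h6 : M.A6 π θs) {κ : ℝ} (hκ : 0 < κ) :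
    ∃ (G₁ G₂ G₃ : EuclideanSpace ℝ (Fin m) → ℝ≥0) (lam : ℝ)
      (H : (ℕ → X × EuclideanSpace ℝ (Fin m)) → ℝ),
      0 < lam ∧ lam < 1 ∧ Integrable H (M.pathLaw θs (π θs)) ∧
      (∀ᵐ y ∂(π θs).map Prod.snd, ∀ ε ∈ Set.Icc 0 κ, M.GoodObs ε κ (G₁ y) (G₂ y) (G₃ y) y) ∧
      ∀ᵐ ω ∂M.pathLaw θs (π θs), ∀ ε ∈ Set.Icc 0 κ,
        (∀ j, M.GoodObs ε κ (G₁ (ω j).2) (G₂ (ω j).2) (G₃ (ω j).2) (ω j).2) ∧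
        ForgettingArray M.Θ lam (fun j => H (MarkovChain.shift^[j] ω)) (fun n j =>
          logDeriv₁ M.Θ M.μ (M.pertKernel ε fun k => (MarkovChain.shift^[j] ω k).2) n 0) ∧
        ForgettingArray M.Θ lam (fun j => H (MarkovChain.shift^[j] ω)) (fun n j =>
          logDeriv₂ M.Θ M.μ (M.pertKernel ε fun k => (MarkovChain.shift^[j] ω k).2) n 0) := by
  have := hπ.isProbabilityMeasure_pathLaw θs
  have hT := (hπ.ergodic h3 θs).toMeasurePreserving
  have hC₁ : (0 : ℝ) < C₁ := hM.c₁_pos.trans_le hM.c₁_le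
  have hα : 0 < c₁ / C₁ := div_pos hM.c₁_pos hC₁
  obtain ⟨G₁, G₂, G₃, hL₁, hL₂, hG⟩ := h6.exists_goodObs hM.uniqueDiff hπ hκ
  obtain ⟨lam, hl0, hl1, hlam⟩ := exists_rate hα ((div_le_one hC₁).2 hM.c₁_le)
  -- The kernel at time `j` weighs the observation at time `j + 1`, so the bounds are evaluated at
  -- coordinate 1 of the shifted path.
  have hY := hπ.measurePreserving_obs h3 θs 1
  set k₁ : (ℕ → X × EuclideanSpace ℝ (Fin m)) → ℝ := fun ω => C₂ + G₁ (ω 1).2 with hk₁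
  set k₂ : (ℕ → X × EuclideanSpace ℝ (Fin m)) → ℝ := fun ω =>
    C₂ + C₂ ^ 2 + 2 * (C₂ * G₁ (ω 1).2) + (G₂ (ω 1).2 + (G₁ (ω 1).2 : ℝ) ^ 2) +
      (C₂ + G₁ (ω 1).2) ^ 2 with hk₂
  have hC₂ := hM.C₂_nonneg
  have i1 : MemLp (fun ω : ℕ → X × EuclideanSpace ℝ (Fin m) => (G₁ (ω 1).2 : ℝ)) 2
      (M.pathLaw θs (π θs)) := hL₁.comp_measurePreserving hY
  have i2 : Integrable (fun ω : ℕ → X × EuclideanSpace ℝ (Fin m) => (G₂ (ω 1).2 : ℝ))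
      (M.pathLaw θs (π θs)) := hY.integrable_comp_of_integrable hL₂
  have j1 : MemLp k₁ 2 (M.pathLaw θs (π θs)) := (memLp_const C₂).add i1
  have j2 : Integrable k₂ (M.pathLaw θs (π θs)) :=
    (((integrable_const _).add (((i1.integrable one_le_two).const_mul C₂).const_mul 2)).add
      (i2.add i1.integrable_sq)).add j1.integrable_sq
  obtain ⟨W, N, U, B, H, hH, he⟩ := hT.exists_oscEnvelopes j1 (fun ω => by positivity) j2
    (fun ω => by positivity) hl0 hl1 (inv_nonneg.2 hα.le)
  refine ⟨G₁, G₂, G₃, lam, H, hl0, hl1, hH, hG, ?_⟩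
  have hgood : ∀ᵐ ω ∂M.pathLaw θs (π θs), ∀ j, ∀ ε ∈ Set.Icc 0 κ,
      M.GoodObs ε κ (G₁ (ω j).2) (G₂ (ω j).2) (G₃ (ω j).2) (ω j).2 := ae_all_iff.2 fun j =>
    (hπ.measurePreserving_obs h3 θs j).quasiMeasurePreserving.ae hG
  -- The envelopes do not involve `ε`, so a single null set and a single `H` serve all perturbations
  -- up to size `κ`.
  filter_upwards [hgood, he] with ω h1 h2 ε hε
  have hgo := fun j => h1 j ε hε
  have hK := hM.tameKernels (y := fun k => (ω k).2) fun j => hgo (j + 1)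
  have e1 : ∀ j, (MarkovChain.shift^[j] ω 1).2 = (ω (j + 1)).2 := fun j => by
    rw [MarkovChain.shift_iterate, add_comm]
  simp only [hk₁, hk₂, e1] at h2
  have a1 := hK.forgettingArray_logDeriv₁ hM.quasiconvex hM.uniqueDiff hl0 hl1 hlam h2
  have a2 := hK.forgettingArray_logDeriv₂ hM.quasiconvex hM.uniqueDiff hl0 hl1 hlam h2
  refine ⟨hgo, ?_, ?_⟩
  · convert a1 using 1
    funext n j
    exact (logDeriv_shift ε ω n j).1.symm
  · convert a2 using 1
    funext n j
    exact (logDeriv_shift ε ω n j).2.symm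

end HMMFamily

/-! ### Twice differentiable limits -/

section LimitC2

variable {E : Type*} [NormedAddCommGroup E] [NormedSpace ℝ E] {S : Set E} {C : ℝ≥0}

/-- Functions vanishing at a common point whose first two derivatives converge uniformly have a
twice continuously differentiable limit. -/
lemma QuasiconvexWith.exists_contDiffOn_limit (hS : QuasiconvexWith C S) (hu : UniqueDiffOn ℝ S)
    {f : ℕ → E → ℝ} (hf : ∀ n, ContDiffOn ℝ 2 (f n) S) {a : E} (ha : a ∈ S)
    (h0 : ∀ n, f n a = 0) {g₁ : E → E →L[ℝ] ℝ} {g₂ : E → E →L[ℝ] E →L[ℝ] ℝ}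
    (h1 : TendstoUniformlyOn (fun n => fderivWithin ℝ (f n) S) g₁ atTop S)
    (h2 : TendstoUniformlyOn (fun n => fderivWithin₂ (f n) S) g₂ atTop S) :
    ∃ g : E → ℝ, ContDiffOn ℝ 2 g S ∧ g a = 0 ∧ Set.EqOn (fderivWithin ℝ g S) g₁ S ∧
      Set.EqOn (fderivWithin₂ g S) g₂ S := by
  have hd := fun n => (contDiffOn_two_iff hu).1 (hf n)
  have hex : ∀ θ ∈ S, ∃ z, Tendsto (fun n => f n θ) atTop (𝓝 z) := by
    intro θ hθ
    refine cauchySeq_tendsto_of_complete (Metric.cauchySeq_iff.2 fun η hη => ?_)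
    -- The values agree at `a`, so the mean value inequality bounds their difference at `θ` by `C *
    -- δ * ‖θ - a‖`. The added 1 avoids a zero denominator.
    set δ : ℝ := η / (C * ‖θ - a‖ + 1) with hδ
    have hδ0 : 0 < δ := by positivity
    obtain ⟨N, hN⟩ := Metric.uniformCauchySeqOn_iff.1 h1.uniformCauchySeqOn δ hδ0
    refine ⟨N, fun n hn k hk => ?_⟩
    have h3 := hS.norm_image_sub_le (f := fun τ => f n τ - f k τ)
      (fun τ hτ => ((hd n).1 τ hτ).sub ((hd k).1 τ hτ)) (B := δ)
      (fun τ hτ => by rw [← dist_eq_norm]; exact (hN n hn k hk τ hτ).le) ha hθ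
    rw [h0, h0, sub_self, sub_zero] at h3
    rw [dist_eq_norm]
    calc _ ≤ C * δ * ‖θ - a‖ := h3
      _ = δ * (C * ‖θ - a‖) := by ring
      _ < δ * (C * ‖θ - a‖ + 1) := by gcongr; linarith
      _ = η := by rw [hδ]; field_simp
  choose! g hg using hex
  have d1 : ∀ θ ∈ S, HasFDerivWithinAt g (g₁ θ) S θ := fun θ hθ =>
    hS.hasFDerivWithinAt_of_tendsto (fun n => (hd n).1) h1 hg hθ
  have d2 : ∀ θ ∈ S, HasFDerivWithinAt g₁ (g₂ θ) S θ := fun θ hθ =>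
    hS.hasFDerivWithinAt_of_tendsto (fun n => (hd n).2.1) h2 (fun τ hτ => h1.tendsto_at hτ) hθ
  obtain ⟨e0, e1, e2⟩ := contDiffOn_two_of_hasFDerivWithinAt hu d1 d2
    (h2.continuousOn (.of_forall fun n => (hd n).2.2))
  exact ⟨g, e0, tendsto_nhds_unique (hg a ha) (by simp [h0]), e1, e2⟩

lemma contDiffOn_normalized_log (hu : UniqueDiffOn ℝ S) {p F : E → ℝ} (hp : ContDiffOn ℝ 2 p S)
    (h0 : ∀ θ ∈ S, p θ ≠ 0) {c k : ℝ} (hF : ∀ θ ∈ S, F θ = c * (Real.log (p θ) - k)) :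
    ContDiffOn ℝ 2 F S ∧
      (∀ θ ∈ S, fderivWithin ℝ F S θ = c • fderivWithin ℝ (fun τ => Real.log (p τ)) S θ) ∧
      ∀ θ ∈ S, fderivWithin₂ F S θ = c • fderivWithin₂ (fun τ => Real.log (p τ)) S θ := by
  obtain ⟨l1, l2, l3⟩ := (contDiffOn_two_iff hu).1 (hp.log h0)
  exact contDiffOn_two_of_hasFDerivWithinAt hu
    (fun θ hθ => (((l1 θ hθ).sub_const k).const_smul c).congr hF (hF θ hθ))
    (fun θ hθ => (l2 θ hθ).const_smul c) (l3.const_smul c)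

end LimitC2

lemma QuasiconvexWith.tendstoC2On {d : ℕ} {S : Set (EuclideanSpace ℝ (Fin d))} {C : ℝ≥0}
    (hS : QuasiconvexWith C S) (hb : Bornology.IsBounded S) (hu : UniqueDiffOn ℝ S)
    {ι : Type*} {l : Filter ι}
    {f : ι → EuclideanSpace ℝ (Fin d) → ℝ} {g : EuclideanSpace ℝ (Fin d) → ℝ}
    (hf : ∀ᶠ i in l, ContDiffOn ℝ 2 (f i) S) (hg : ContDiffOn ℝ 2 g S)
    {a : EuclideanSpace ℝ (Fin d)} (ha : a ∈ S) (h0 : ∀ᶠ i in l, f i a = g a)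
    (h1 : TendstoUniformlyOn (fun i => fderivWithin ℝ (f i) S) (fderivWithin ℝ g S) l S)
    (h2 : TendstoUniformlyOn (fun i => fderivWithin₂ (f i) S) (fderivWithin₂ g S) l S) :
    TendstoC2On f g l S := by
  refine ⟨hS.tendstoUniformlyOn_of_deriv hb
    (hf.mono fun i hi => ((contDiffOn_two_iff hu).1 hi).1) ((contDiffOn_two_iff hu).1 hg).1 h1 ha h0,
    h1, ?_⟩
  rw [Metric.tendstoUniformlyOn_iff] at h2 ⊢
  intro η hη
  filter_upwards [h2 η hη] with i hi θ hθ
  rw [dist_eq_norm, norm_iteratedFDerivWithin_two_sub hu hθ, ← dist_eq_norm]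
  exact hi θ hθ

/-! ### The limit for a fixed perturbation -/

namespace HMMFamily

variable {X : Type*} [TopologicalSpace X] [MeasurableSpace X] {d m : ℕ} {M : HMMFamily X d m}

/-- The first derivative of the log-likelihood of the perturbed model. -/
abbrev score (M : HMMFamily X d m) (ε : ℝ) (ω : ℕ → X × EuclideanSpace ℝ (Fin m)) (n : ℕ)
    (θ : EuclideanSpace ℝ (Fin d)) (x : X) : EuclideanSpace ℝ (Fin d) →L[ℝ] ℝ :=
  logDeriv₁ M.Θ M.μ (M.pertKernel ε fun k => (ω k).2) n 0 θ x

/-- The second derivative of the log-likelihood of the perturbed model. -/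
abbrev hessian (M : HMMFamily X d m) (ε : ℝ) (ω : ℕ → X × EuclideanSpace ℝ (Fin m)) (n : ℕ)
    (θ : EuclideanSpace ℝ (Fin d)) (x : X) :
    EuclideanSpace ℝ (Fin d) →L[ℝ] EuclideanSpace ℝ (Fin d) →L[ℝ] ℝ :=
  logDeriv₂ M.Θ M.μ (M.pertKernel ε fun k => (ω k).2) n 0 θ x

variable {π : M.Θ → Measure (X × EuclideanSpace ℝ (Fin m))} {θs : M.Θ}
  {C C₁ : ℝ≥0} {c₁ C₂ : ℝ} {ε κ : ℝ}

/-- The likelihood and the normalized log-likelihood along a sequence of good observations. -/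
lemma Regular.relLogLik_regular (hM : M.Regular C C₁ c₁ C₂)
    {ω : ℕ → X × EuclideanSpace ℝ (Fin m)} {G₁ G₂ G₃ : ℕ → ℝ}
    (hy : ∀ j, M.GoodObs ε κ (G₁ j) (G₂ j) (G₃ j) (ω (j + 1)).2) (θs : M.Θ) (n : ℕ) (x : X) :
    (∀ θ ∈ M.Θ, 0 < M.likelihood ε n (fun k => (ω k).2) x θ) ∧
    ContDiffOn ℝ 2 (M.likelihood ε n (fun k => (ω k).2) x) M.Θ ∧
    ContDiffOn ℝ 2 (M.relLogLik θs ε n (fun k => (ω k).2) x) M.Θ ∧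
    (∀ θ ∈ M.Θ, fderivWithin ℝ (M.relLogLik θs ε n (fun k => (ω k).2) x) M.Θ θ =
      (1 / (n : ℝ)) • M.score ε ω n θ x) ∧
    ∀ θ ∈ M.Θ, fderivWithin₂ (M.relLogLik θs ε n (fun k => (ω k).2) x) M.Θ θ =
      (1 / (n : ℝ)) • M.hessian ε ω n θ x := by
  have hu := hM.uniqueDiff
  have hI := (hM.tameKernels (y := fun k => (ω k).2) hy).tameIter hM.quasiconvex hu n 0
  have heq : Set.EqOn (M.likelihood ε n (fun k => (ω k).2) x)
      (fun θ => iterInt M.μ (M.pertKernel ε fun k => (ω k).2) n 0 θ x) M.Θ := fun θ hθ =>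
    hM.likelihood_eq (y := fun k => (ω k).2) hy n x hθ
  obtain ⟨b₁, b₂, -, -, ht⟩ := hI.tame
  refine ⟨fun θ hθ => ?_, (ht x).contDiffOn.congr heq, contDiffOn_normalized_log hu
    (ht x).contDiffOn (fun θ hθ => (hI.pos θ hθ x).ne')
    (k := Real.log (M.likelihood ε n (fun k => (ω k).2) x θs)) fun θ hθ => ?_⟩
  · rw [heq hθ]
    exact hI.pos θ hθ x
  · rw [relLogLik, heq hθ]

/-- The limit of the normalized log-likelihoods of a perturbed model. -/
theorem Regular.exists_limit (hM : M.Regular C C₁ c₁ C₂) (hπ : M.IsStationary π) (h3 : M.A3)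
    {G₁ G₂ G₃ : EuclideanSpace ℝ (Fin m) → ℝ} {lam : ℝ} (hl0 : 0 < lam) (hl1 : lam < 1)
    {H : (ℕ → X × EuclideanSpace ℝ (Fin m)) → ℝ} (hH : Integrable H (M.pathLaw θs (π θs)))
    (hG : ∀ᵐ ω ∂M.pathLaw θs (π θs),
      (∀ j, M.GoodObs ε κ (G₁ (ω j).2) (G₂ (ω j).2) (G₃ (ω j).2) (ω j).2) ∧
      ForgettingArray M.Θ lam (fun j => H (MarkovChain.shift^[j] ω)) (fun n j =>
        M.score ε (MarkovChain.shift^[j] ω) n) ∧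
      ForgettingArray M.Θ lam (fun j => H (MarkovChain.shift^[j] ω)) (fun n j =>
        M.hessian ε (MarkovChain.shift^[j] ω) n)) (x₀ : X) :
    ∃ l : EuclideanSpace ℝ (Fin d) → ℝ, ContDiffOn ℝ 2 l M.Θ ∧ l θs = 0 ∧
      (∀ x : X, ∀ᵐ ω ∂M.pathLaw θs (π θs),
        (∀ n : ℕ, (∀ θ ∈ M.Θ, 0 < M.likelihood ε n (fun k => (ω k).2) x θ) ∧
          ContDiffOn ℝ 2 (M.likelihood ε n (fun k => (ω k).2) x) M.Θ) ∧
        TendstoC2On (fun n : ℕ => M.relLogLik θs ε n (fun k => (ω k).2) x) l atTop M.Θ) ∧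
      ∀ b, ∀ θ ∈ M.Θ,
        ‖fderivWithin ℝ l M.Θ θ - ∫ ω, (M.score ε ω (b + 1) θ x₀ -
          M.score ε (MarkovChain.shift ω) b θ x₀) ∂M.pathLaw θs (π θs)‖ ≤
          lam ^ b * ∫ ω, H ω ∂M.pathLaw θs (π θs) ∧
        ‖fderivWithin₂ l M.Θ θ - ∫ ω, (M.hessian ε ω (b + 1) θ x₀ -
          M.hessian ε (MarkovChain.shift ω) b θ x₀) ∂M.pathLaw θs (π θs)‖ ≤
          lam ^ b * ∫ ω, H ω ∂M.pathLaw θs (π θs) := by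
  have := hπ.isProbabilityMeasure_pathLaw θs
  have hu := hM.uniqueDiff
  have hT := hπ.ergodic h3 θs
  have hgood := hG.mono fun ω h => h.1
  have hcd : ∀ᵐ ω ∂M.pathLaw θs (π θs), ∀ n x, ContinuousOn (fun θ => M.score ε ω n θ x) M.Θ ∧
      ContinuousOn (fun θ => M.hessian ε ω n θ x) M.Θ := by
    filter_upwards [hgood] with ω hω n x
    have hI := (hM.tameKernels (y := fun k => (ω k).2) fun j => hω (j + 1)).tameIter
      hM.quasiconvex hu n 0
    obtain ⟨b₁, b₂, -, -, ht⟩ := hI.tame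
    obtain ⟨-, l2, l3⟩ := (contDiffOn_two_iff hu).1
      ((ht x).contDiffOn.log fun θ hθ => (hI.pos θ hθ x).ne')
    exact ⟨fun θ hθ => (l2 θ hθ).continuousWithinAt, l3⟩
  obtain ⟨l₁, -, hb₁, hl₁⟩ := hT.exists_tendstoUniformlyOn_forgettingArray hM.compact hl0 hl1 hH
    (A := fun ω n => M.score ε ω n) (hG.mono fun ω h => h.2.1)
    (fun n θ hθ x => (hM.aestronglyMeasurable_logDeriv hgood n 0 x hθ).1)
    (hcd.mono fun ω h n x => (h n x).1) x₀
  obtain ⟨l₂, -, hb₂, hl₂⟩ := hT.exists_tendstoUniformlyOn_forgettingArray hM.compact hl0 hl1 hH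
    (A := fun ω n => M.hessian ε ω n) (hG.mono fun ω h => h.2.2)
    (fun n θ hθ x => (hM.aestronglyMeasurable_logDeriv hgood n 0 x hθ).2)
    (hcd.mono fun ω h n x => (h n x).2) x₀
  have hconv : ∀ x : X, ∀ᵐ ω ∂M.pathLaw θs (π θs),
      TendstoUniformlyOn (fun n : ℕ => fderivWithin ℝ
        (M.relLogLik θs ε n (fun k => (ω k).2) x) M.Θ) l₁ atTop M.Θ ∧
      TendstoUniformlyOn (fun n : ℕ => fderivWithin₂
        (M.relLogLik θs ε n (fun k => (ω k).2) x) M.Θ) l₂ atTop M.Θ := by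
    intro x
    filter_upwards [hgood, hl₁ x, hl₂ x] with ω hω c1 c2
    have hr := fun n => hM.relLogLik_regular (fun j => hω (j + 1)) θs n x
    exact ⟨c1.congr (.of_forall fun n θ hθ => ((hr n).2.2.2.1 θ hθ).symm),
      c2.congr (.of_forall fun n θ hθ => ((hr n).2.2.2.2 θ hθ).symm)⟩
  have hzero : ∀ (ω : ℕ → X × EuclideanSpace ℝ (Fin m)) (n : ℕ) (x : X),
      M.relLogLik θs ε n (fun k => (ω k).2) x θs = 0 := fun ω n x => by simp [relLogLik]
  -- The limits `l₁` and `l₂` depend neither on `ω` nor on `x`. Hence one typical path suffices to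
  -- construct `l`, and the normalization at `θ*` identifies it as the limit along all other typical
  -- paths.
  obtain ⟨ω₀, hω₀, hω₁, hω₂⟩ := (hgood.and (hconv x₀)).exists
  obtain ⟨l, hlC, hl0', e1, e2⟩ := hM.quasiconvex.exists_contDiffOn_limit hu
    (fun n => (hM.relLogLik_regular (fun j => hω₀ (j + 1)) θs n x₀).2.2.1) θs.2
    (fun n => hzero ω₀ n x₀) hω₁ hω₂
  refine ⟨l, hlC, hl0', fun x => ?_, fun b θ hθ => ?_⟩
  · filter_upwards [hgood, hconv x] with ω hω c
    have hr := fun n => hM.relLogLik_regular (fun j => hω (j + 1)) θs n x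
    exact ⟨fun n => ⟨(hr n).1, (hr n).2.1⟩, hM.quasiconvex.tendstoC2On hM.compact.isBounded hu
      (.of_forall fun n => (hr n).2.2.1) hlC θs.2
      (.of_forall fun n => by rw [hzero, hl0']) (c.1.congr_right e1.symm) (c.2.congr_right e2.symm)⟩
  · rw [e1 hθ, e2 hθ]
    exact ⟨hb₁ b θ hθ, hb₂ b θ hθ⟩

end HMMFamily

/-! ### Lipschitz bounds for second derivatives -/

section LipschitzDerivatives

variable {E : Type*} [NormedAddCommGroup E] [NormedSpace ℝ E] {S : Set E} {C : ℝ≥0}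

lemma differentiableOn_fderivWithin₂ (hu : UniqueDiffOn ℝ S) {f : E → ℝ} (hf : ContDiffOn ℝ 3 f S) :
    DifferentiableOn ℝ (fderivWithin₂ f S) S := by
  have h1 : ContDiffOn ℝ 2 (fderivWithin ℝ f S) S := hf.fderivWithin hu (by norm_num)
  have h2 : ContDiffOn ℝ 1 (fderivWithin ℝ (fderivWithin ℝ f S) S) S :=
    h1.fderivWithin hu (by norm_num)
  exact h2.differentiableOn (by norm_num)

lemma norm_smulRight_self_sub_le (L N : E →L[ℝ] ℝ) :
    ‖L.smulRight L - N.smulRight N‖ ≤ (‖L‖ + ‖N‖) * ‖L - N‖ := by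
  have e : L.smulRight L - N.smulRight N = L.smulRight (L - N) + (L - N).smulRight N := by
    ext u v
    simp
    ring
  rw [e]
  have h1 := norm_smulRight_self_le L (L - N)
  have h2 := norm_smulRight_self_le (L - N) N
  refine (norm_add_le _ _).trans ?_
  linarith

/-- Bounds on the first three derivatives of `log f` make the second derivative of `f`
Lipschitz. -/
lemma QuasiconvexWith.norm_fderivWithin₂_sub_le (hS : QuasiconvexWith C S) (hu : UniqueDiffOn ℝ S)
    {f : E → ℝ} (hf : ContDiffOn ℝ 3 f S) (h0 : ∀ θ ∈ S, 0 ≤ f θ) {B G₁ G₂ G₃ : ℝ}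
    (hG₁ : 0 ≤ G₁) (hG₂ : 0 ≤ G₂) (hG₃ : 0 ≤ G₃)
    (hB : ∀ θ ∈ S, f θ ≤ B)
    (h1 : ∀ θ ∈ S, 0 < f θ → ‖fderivWithin ℝ (fun τ => Real.log (f τ)) S θ‖ ≤ G₁)
    (h2 : ∀ θ ∈ S, 0 < f θ → ‖fderivWithin₂ (fun τ => Real.log (f τ)) S θ‖ ≤ G₂)
    (h3 : ∀ θ ∈ S, 0 < f θ →
      ‖fderivWithin ℝ (fderivWithin₂ (fun τ => Real.log (f τ)) S) S θ‖ ≤ G₃)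
    {a b : E} (ha : a ∈ S) (hb : b ∈ S) :
    ‖fderivWithin₂ f S b - fderivWithin₂ f S a‖ ≤
      C * (B * (G₃ + 3 * (G₁ * G₂) + G₁ ^ 3)) * ‖b - a‖ := by
  have hf2 : ContDiffOn ℝ 2 f S := hf.of_le (by norm_num)
  have ht := tame_of_log hu hf2 h0 h1 h2
  have hB0 : 0 ≤ B := (h0 a ha).trans (hB a ha)
  -- Since `‖∇f‖ ≤ G₁ f`, a single zero forces `f` to vanish identically. Otherwise `log f` is three
  -- times continuously differentiable on all of `S`.
  by_cases hz : ∃ c ∈ S, f c = 0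
  · obtain ⟨c, hc, hfc⟩ := hz
    have hall : ∀ θ ∈ S, f θ = 0 := fun θ hθ =>
      hS.eq_zero_of_norm_deriv_le ((contDiffOn_two_iff hu).1 hf2).1 (G := G₁)
        (fun τ hτ => by
          rw [Real.norm_of_nonneg (h0 τ hτ)]
          exact ht.norm_fderivWithin_le τ hτ) hc hθ hfc
    have hd : ∀ θ ∈ S, fderivWithin₂ f S θ = 0 := fun θ hθ => by
      have := ht.norm_fderivWithin₂_le θ hθ
      rw [hall θ hθ, mul_zero] at this
      exact norm_le_zero_iff.1 this
    rw [hd a ha, hd b hb, sub_self, norm_zero]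
    positivity
  · push Not at hz
    have hpos : ∀ θ ∈ S, 0 < f θ := fun θ hθ => lt_of_le_of_ne (h0 θ hθ) (hz θ hθ).symm
    have hlog : ContDiffOn ℝ 3 (fun τ => Real.log (f τ)) S := hf.log hz
    obtain ⟨l1, l2, -⟩ := (contDiffOn_two_iff hu).1 (hlog.of_le (by norm_num : (2 : WithTop ℕ∞) ≤ 3))
    set L₁ := fderivWithin ℝ (fun τ => Real.log (f τ)) S with hL₁
    set L₂ := fderivWithin₂ (fun τ => Real.log (f τ)) S with hL₂
    have e : ∀ θ ∈ S, fderivWithin₂ f S θ = f θ • (L₂ θ + (L₁ θ).smulRight (L₁ θ)) := by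
      intro θ hθ
      have hp := hpos θ hθ
      have r1 : fderivWithin ℝ f S θ = f θ • L₁ θ := by
        rw [hL₁, fderivWithin_log_of_contDiffOn hu hf2 hθ hp.ne', smul_inv_smul₀ hp.ne']
      rw [hL₂, fderivWithin₂_log_of_contDiffOn hu hf2 hθ hp.ne', r1]
      ext u v
      simp
      field_simp
      ring
    have m0 : |f b - f a| ≤ C * (G₁ * B) * ‖b - a‖ :=
      hS.norm_image_sub_le ((contDiffOn_two_iff hu).1 hf2).1
        (fun θ hθ => (ht.norm_fderivWithin_le θ hθ).trans
          (mul_le_mul_of_nonneg_left (hB θ hθ) hG₁)) ha hb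
    have m1 : ‖L₁ b - L₁ a‖ ≤ C * G₂ * ‖b - a‖ :=
      hS.norm_image_sub_le l2 (fun θ hθ => h2 θ hθ (hpos θ hθ)) ha hb
    have m2 : ‖L₂ b - L₂ a‖ ≤ C * G₃ * ‖b - a‖ :=
      hS.norm_image_sub_le (fun θ hθ => (differentiableOn_fderivWithin₂ hu hlog θ hθ).hasFDerivWithinAt)
        (fun θ hθ => h3 θ hθ (hpos θ hθ)) ha hb
    have m3 := norm_smulRight_self_sub_le (L₁ b) (L₁ a)
    have n1 := h1 a ha (hpos a ha)
    have n1' := h1 b hb (hpos b hb)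
    have n2 := h2 a ha (hpos a ha)
    rw [e a ha, e b hb]
    have e2 : f b • (L₂ b + (L₁ b).smulRight (L₁ b)) - f a • (L₂ a + (L₁ a).smulRight (L₁ a)) =
        f b • ((L₂ b - L₂ a) + ((L₁ b).smulRight (L₁ b) - (L₁ a).smulRight (L₁ a))) +
        (f b - f a) • (L₂ a + (L₁ a).smulRight (L₁ a)) := by
      rw [sub_smul, smul_add, smul_add, smul_add, smul_add, smul_sub, smul_sub]
      abel
    rw [e2]
    set r := ‖b - a‖ with hr
    -- The increment of `L₂ + L₁ ⊗ L₁` contributes `B (G₃ + 2 G₁ G₂)`, and the increment of the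
    -- factor `f` contributes `B G₁ (G₂ + G₁²)`.
    have k1 : ‖f b • ((L₂ b - L₂ a) + ((L₁ b).smulRight (L₁ b) - (L₁ a).smulRight (L₁ a)))‖ ≤
        B * (C * G₃ * r + (G₁ + G₁) * (C * G₂ * r)) := by
      rw [norm_smul, Real.norm_of_nonneg (h0 b hb)]
      refine mul_le_mul (hB b hb) ((norm_add_le _ _).trans (add_le_add m2 (m3.trans ?_)))
        (norm_nonneg _) hB0
      exact mul_le_mul (add_le_add n1' n1) m1 (norm_nonneg _) (by positivity)
    have k2 : ‖(f b - f a) • (L₂ a + (L₁ a).smulRight (L₁ a))‖ ≤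
        (C * (G₁ * B) * r) * (G₂ + G₁ * G₁) := by
      rw [norm_smul]
      refine mul_le_mul m0 ((norm_add_le _ _).trans (add_le_add n2
        ((norm_smulRight_self_le _ _).trans ?_))) (norm_nonneg _) (by positivity)
      exact mul_le_mul n1 n1 (norm_nonneg _) hG₁
    refine (norm_add_le _ _).trans ((add_le_add k1 k2).trans (le_of_eq ?_))
    ring

end LipschitzDerivatives

/-! ### Almost everywhere quantifiers and differentiation along balls -/

section AeComm

variable {α β : Type*} [MeasurableSpace α] [MeasurableSpace β] {μ : Measure α} {ν : Measure β}
  [SFinite μ] [SFinite ν] {F : Type*} [NormedAddCommGroup F]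

/-- Exchange of the order of almost everywhere quantifiers for the convergence of a sequence. -/
lemma ae_ae_tendsto_comm {f : ℕ → α × β → F} {g : α × β → F}
    (hf : ∀ i, AEStronglyMeasurable (f i) (μ.prod ν)) (hg : AEStronglyMeasurable g (μ.prod ν))
    (h : ∀ᵐ b ∂ν, ∀ᵐ a ∂μ, Tendsto (fun i => f i (a, b)) atTop (𝓝 (g (a, b)))) :
    ∀ᵐ a ∂μ, ∀ᵐ b ∂ν, Tendsto (fun i => f i (a, b)) atTop (𝓝 (g (a, b))) := by
  have hm : ∀ i, AEMeasurable (fun p => ‖f i p - g p‖) (μ.prod ν) := fun i =>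
    ((hf i).sub hg).norm.aemeasurable
  -- Measurable versions of the distances make the set of convergence measurable, which the exchange
  -- of quantifiers requires.
  set f' : ℕ → α × β → ℝ := fun i => (hm i).mk
  have hf' : ∀ i, Measurable (f' i) := fun i => (hm i).measurable_mk
  have he : ∀ᵐ p ∂μ.prod ν, ∀ i, ‖f i p - g p‖ = f' i p := ae_all_iff.2 fun i => (hm i).ae_eq_mk
  have he1 : ∀ᵐ a ∂μ, ∀ᵐ b ∂ν, ∀ i, ‖f i (a, b) - g (a, b)‖ = f' i (a, b) :=
    Measure.ae_ae_of_ae_prod he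
  have he2 : ∀ᵐ b ∂ν, ∀ᵐ a ∂μ, ∀ i, ‖f i (a, b) - g (a, b)‖ = f' i (a, b) := by
    refine Measure.ae_ae_of_ae_prod (p := fun q : β × α =>
      ∀ i, ‖f i (q.2, q.1) - g (q.2, q.1)‖ = f' i (q.2, q.1)) ?_
    exact (Measure.measurePreserving_swap (μ := ν) (ν := μ)).quasiMeasurePreserving.ae he
  have hset : MeasurableSet {p : α × β | Tendsto (fun i => f' i p) atTop (𝓝 0)} :=
    measurableSet_tendsto (𝓝 0) hf'
  have key : ∀ᵐ b ∂ν, ∀ᵐ a ∂μ, Tendsto (fun i => f' i (a, b)) atTop (𝓝 0) := by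
    filter_upwards [h, he2] with b h1 h2
    filter_upwards [h1, h2] with a k1 k2
    exact (tendsto_iff_norm_sub_tendsto_zero.1 k1).congr k2
  have key' := (Measure.ae_ae_comm (p := fun a b => Tendsto (fun i => f' i (a, b)) atTop (𝓝 0))
    (μ := μ) (ν := ν) hset).2 key
  filter_upwards [key', he1] with a h1 h2
  filter_upwards [h1, h2] with b k1 k2
  exact tendsto_iff_norm_sub_tendsto_zero.2 (k1.congr fun i => (k2 i).symm)

end AeComm

/-- Lebesgue differentiation along closed balls for a function that is bounded near the points of
a set, with no uniformity. -/
lemma ae_tendsto_average_closedBall {m : ℕ} {ν : Measure (EuclideanSpace ℝ (Fin m))}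
    [IsFiniteMeasureOnCompacts ν] {F : Type*} [NormedAddCommGroup F] [NormedSpace ℝ F]
    [CompleteSpace F] {Φ : EuclideanSpace ℝ (Fin m) → F} (hΦ : AEStronglyMeasurable Φ ν)
    {A 𝒴 : Set (EuclideanSpace ℝ (Fin m))} (h𝒴 : ∀ᵐ y ∂ν, y ∈ 𝒴)
    {R : EuclideanSpace ℝ (Fin m) → ℝ} (hR : ∀ y ∈ A, ∀ y' ∈ 𝒴, dist y' y ≤ 1 → ‖Φ y'‖ ≤ R y) :
    ∀ᵐ y ∂ν, y ∈ A →
      Tendsto (fun ε => ⨍ y' in Metric.closedBall y ε, Φ y' ∂ν) (𝓝[>] 0) (𝓝 (Φ y)) := by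
  -- On `U N` the function is almost everywhere bounded by `N`, so its restriction is locally
  -- integrable. As a union of balls `U N` is open, hence measurable, whatever `A` and `R` are.
  set U : ℕ → Set (EuclideanSpace ℝ (Fin m)) := fun N => ⋃ y ∈ {y ∈ A | R y ≤ N}, Metric.ball y 1
    with hU
  have hUo : ∀ N, IsOpen (U N) := fun N => isOpen_biUnion fun y _ => Metric.isOpen_ball
  have hli : ∀ N, LocallyIntegrable ((U N).indicator Φ) ν := fun N => by
    refine (locallyIntegrable_const (N : ℝ)).mono (hΦ.indicator (hUo N).measurableSet) ?_
    filter_upwards [h𝒴] with y' hy'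
    by_cases h : y' ∈ U N
    · rw [Set.indicator_of_mem h]
      obtain ⟨y, hy, hd⟩ := Set.mem_iUnion₂.1 h
      exact ((hR y hy.1 y' hy' (Metric.mem_ball.1 hd).le).trans hy.2).trans (le_abs_self _)
    · rw [Set.indicator_of_notMem h, norm_zero]
      exact norm_nonneg _
  have hB : ∀ N, ∀ᵐ y ∂ν, Tendsto (fun ε => ⨍ y' in Metric.closedBall y ε, (U N).indicator Φ y' ∂ν)
      (𝓝[>] 0) (𝓝 ((U N).indicator Φ y)) := fun N => by
    filter_upwards [(Besicovitch.vitaliFamily ν).ae_tendsto_average (hli N)] with y hy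
    exact hy.comp (Besicovitch.tendsto_filterAt ν y)
  filter_upwards [ae_all_iff.2 hB] with y hy hyA
  obtain ⟨N, hN⟩ := exists_nat_ge (R y)
  -- Around `y ∈ A` the truncation is invisible in balls of radius less than 1.
  have hsub : Metric.ball y 1 ⊆ U N := fun y' hy' => Set.mem_biUnion (x := y) ⟨hyA, hN⟩ hy'
  have h1 := hy N
  rw [Set.indicator_of_mem (hsub (Metric.mem_ball_self one_pos))] at h1
  refine h1.congr' ?_
  have hlt : ∀ᶠ ε : ℝ in 𝓝[>] 0, ε < 1 := nhdsWithin_le_nhds (Iio_mem_nhds one_pos)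
  filter_upwards [hlt] with ε hε
  refine setAverage_congr_fun Metric.isClosed_closedBall.measurableSet (.of_forall fun y' hy' => ?_)
  exact Set.indicator_of_mem (hsub (Metric.closedBall_subset_ball hε hy')) _

/-! ### Convergence of the perturbed densities -/

namespace HMMFamily

variable {X : Type*} [TopologicalSpace X] [MeasurableSpace X] {d m : ℕ} {M : HMMFamily X d m}
  {C C₁ : ℝ≥0} {c₁ C₂ : ℝ}

lemma setAverage_eq_integral_pertMeasure {F : Type*} [NormedAddCommGroup F] [NormedSpace ℝ F]
    (Φ : EuclideanSpace ℝ (Fin m) → F) (y : EuclideanSpace ℝ (Fin m)) {ε : ℝ} (hε : ε ≠ 0) :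
    ⨍ y' in Metric.closedBall y ε, Φ y' ∂M.ν = ∫ y', Φ y' ∂M.pertMeasure ε y := by
  rw [pertMeasure, if_neg hε]
  rfl

/-- The Lipschitz bound in `θ` holds uniformly over the observations in the ball. It reduces joint
convergence in `(ε, θ)` to the averages at the fixed parameter `θ₀`. -/
lemma tendsto_integral_pertMeasure {F : Type*} [NormedAddCommGroup F] [NormedSpace ℝ F]
    {y : EuclideanSpace ℝ (Fin m)} {κ G₁ G₂ G₃ : ℝ}
    (hy : ∀ ε ∈ Set.Icc 0 κ, M.GoodObs ε κ G₁ G₂ G₃ y) (hκ : 0 < κ)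
    {Φ : EuclideanSpace ℝ (Fin d) → EuclideanSpace ℝ (Fin m) → F} {D : ℝ}
    {θ₀ : EuclideanSpace ℝ (Fin d)} (hθ₀ : θ₀ ∈ M.Θ)
    (hi : ∀ ε ∈ Set.Icc 0 κ, ∀ θ ∈ M.Θ, Integrable (Φ θ) (M.pertMeasure ε y))
    (hD : ∀ θ ∈ M.Θ, ∀ y' ∈ M.𝒴, dist y' y ≤ κ → ‖Φ θ y' - Φ θ₀ y'‖ ≤ D * ‖θ - θ₀‖)
    (hav : Tendsto (fun ε => ⨍ y' in Metric.closedBall y ε, Φ θ₀ y' ∂M.ν) (𝓝[>] 0)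
      (𝓝 (Φ θ₀ y))) :
    Tendsto (fun p : ℝ × EuclideanSpace ℝ (Fin d) => ∫ y', Φ p.2 y' ∂M.pertMeasure p.1 y)
      (𝓝[>] 0 ×ˢ 𝓝[M.Θ] θ₀) (𝓝 (Φ θ₀ y)) := by
  rw [tendsto_iff_norm_sub_tendsto_zero]
  have h1 : Tendsto (fun p : ℝ × EuclideanSpace ℝ (Fin d) => D * ‖p.2 - θ₀‖ +
      ‖⨍ y' in Metric.closedBall y p.1, Φ θ₀ y' ∂M.ν - Φ θ₀ y‖) (𝓝[>] 0 ×ˢ 𝓝[M.Θ] θ₀) (𝓝 0) := by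
    have a1 : Tendsto (fun p : ℝ × EuclideanSpace ℝ (Fin d) => p.2) (𝓝[>] 0 ×ˢ 𝓝[M.Θ] θ₀)
        (𝓝 θ₀) := tendsto_snd.mono_right nhdsWithin_le_nhds
    have a2 := (tendsto_iff_norm_sub_tendsto_zero.1 a1).const_mul D
    have a3 := tendsto_iff_norm_sub_tendsto_zero.1
      (hav.comp (tendsto_fst (f := 𝓝[>] (0 : ℝ)) (g := 𝓝[M.Θ] θ₀)))
    simpa using a2.add a3
  refine squeeze_zero' (.of_forall fun _ => norm_nonneg _) ?_ h1
  have e1 : ∀ᶠ p : ℝ × EuclideanSpace ℝ (Fin d) in 𝓝[>] 0 ×ˢ 𝓝[M.Θ] θ₀, p.1 ∈ Set.Ioc 0 κ :=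
    tendsto_fst.eventually (Ioc_mem_nhdsGT hκ)
  have e2 : ∀ᶠ p : ℝ × EuclideanSpace ℝ (Fin d) in 𝓝[>] 0 ×ˢ 𝓝[M.Θ] θ₀, p.2 ∈ M.Θ :=
    tendsto_snd.eventually self_mem_nhdsWithin
  filter_upwards [e1, e2] with p hp hpθ
  have hp' : p.1 ∈ Set.Icc 0 κ := ⟨hp.1.le, hp.2⟩
  have := (hy p.1 hp').isProbabilityMeasure
  have h2 : ‖∫ y', Φ p.2 y' ∂M.pertMeasure p.1 y - ∫ y', Φ θ₀ y' ∂M.pertMeasure p.1 y‖ ≤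
      D * ‖p.2 - θ₀‖ := by
    rw [← integral_sub (hi p.1 hp' p.2 hpθ) (hi p.1 hp' θ₀ hθ₀)]
    have h3 := norm_integral_le_of_norm_le_const (μ := M.pertMeasure p.1 y)
      (f := fun y' => Φ p.2 y' - Φ θ₀ y') (C := D * ‖p.2 - θ₀‖) (by
        filter_upwards [(hy p.1 hp').ae_pertMeasure] with y' hy'
        exact hD p.2 hpθ y' hy'.1 (hy'.2.trans hp.2))
    rwa [probReal_univ, mul_one] at h3
  rw [setAverage_eq_integral_pertMeasure _ _ hp.1.ne']
  have h4 := norm_add_le (∫ y', Φ p.2 y' ∂M.pertMeasure p.1 y - ∫ y', Φ θ₀ y' ∂M.pertMeasure p.1 y)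
    (∫ y', Φ θ₀ y' ∂M.pertMeasure p.1 y - Φ θ₀ y)
  rw [sub_add_sub_cancel] at h4
  linarith

lemma aestronglyMeasurable_deriv_g (hu : UniqueDiffOn ℝ M.Θ) (h2 : M.A2) {α : Type*}
    [MeasurableSpace α] {ρ : Measure α} {f : α → EuclideanSpace ℝ (Fin m)} {h : α → X}
    (hf : Measurable f) (hh : Measurable h) (hf𝒴 : ∀ᵐ a ∂ρ, f a ∈ M.𝒴)
    {θ : EuclideanSpace ℝ (Fin d)} (hθ : θ ∈ M.Θ) :
    AEStronglyMeasurable (fun a => M.g θ (f a) (h a)) ρ ∧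
    AEStronglyMeasurable (fun a => fderivWithin ℝ (fun τ => M.g τ (f a) (h a)) M.Θ θ) ρ ∧
    AEStronglyMeasurable (fun a => fderivWithin₂ (fun τ => M.g τ (f a) (h a)) M.Θ θ) ρ := by
  have hd : ∀ᵐ a ∂ρ, ContDiffOn ℝ 2 (fun τ => M.g τ (f a) (h a)) M.Θ :=
    hf𝒴.mono fun a ha => (h2.2 _ ha _).of_le (by norm_num)
  have hm0 : ∀ θ ∈ M.Θ, AEStronglyMeasurable (fun a => M.g θ (f a) (h a)) ρ := fun θ hθ => by
    have := (M.measurable_g θ hθ).comp (hf.prodMk hh)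
    exact this.aestronglyMeasurable
  have hm1 : ∀ θ ∈ M.Θ,
      AEStronglyMeasurable (fun a => fderivWithin ℝ (fun τ => M.g τ (f a) (h a)) M.Θ θ) ρ :=
    fun θ hθ => aestronglyMeasurable_fderivWithin (hu θ hθ) hθ hm0
      (hd.mono fun a ha => (((contDiffOn_two_iff hu).1 ha).1 θ hθ).differentiableWithinAt)
  exact ⟨hm0 θ hθ, hm1 θ hθ, aestronglyMeasurable_fderivWithin (hu θ hθ) hθ hm1
      (hd.mono fun a ha => (((contDiffOn_two_iff hu).1 ha).2.1 θ hθ).differentiableWithinAt)⟩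

lemma Regular.aestronglyMeasurable_deriv_gPert (hM : M.Regular C C₁ c₁ C₂) {α : Type*}
    [MeasurableSpace α] {ρ : Measure α} {f : α → EuclideanSpace ℝ (Fin m)} {h : α → X} {ε κ : ℝ}
    {G₁ G₂ G₃ : EuclideanSpace ℝ (Fin m) → ℝ}
    (hf : Measurable f) (hh : Measurable h)
    (hG : ∀ᵐ a ∂ρ, M.GoodObs ε κ (G₁ (f a)) (G₂ (f a)) (G₃ (f a)) (f a))
    {θ : EuclideanSpace ℝ (Fin d)} (hθ : θ ∈ M.Θ) :
    AEStronglyMeasurable (fun a => M.gPert ε θ (f a) (h a)) ρ ∧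
    AEStronglyMeasurable (fun a => fderivWithin ℝ (fun τ => M.gPert ε τ (f a) (h a)) M.Θ θ) ρ ∧
    AEStronglyMeasurable (fun a => fderivWithin₂ (fun τ => M.gPert ε τ (f a) (h a)) M.Θ θ) ρ := by
  have hu := hM.uniqueDiff
  have hd : ∀ᵐ a ∂ρ, ContDiffOn ℝ 2 (fun τ => M.gPert ε τ (f a) (h a)) M.Θ :=
    hG.mono fun a ha => (ha.tame_gPert hM.quasiconvex hu hM.smooth hM.g_le (h a)).1.contDiffOn
  have hm0 : ∀ θ ∈ M.Θ, AEStronglyMeasurable (fun a => M.gPert ε θ (f a) (h a)) ρ := fun θ hθ =>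
    (measurable_gPert_comp ε hθ hf hh).aestronglyMeasurable
  have hm1 : ∀ θ ∈ M.Θ,
      AEStronglyMeasurable (fun a => fderivWithin ℝ (fun τ => M.gPert ε τ (f a) (h a)) M.Θ θ) ρ :=
    fun θ hθ => aestronglyMeasurable_fderivWithin (hu θ hθ) hθ hm0
      (hd.mono fun a ha => (((contDiffOn_two_iff hu).1 ha).1 θ hθ).differentiableWithinAt)
  exact ⟨hm0 θ hθ, hm1 θ hθ, aestronglyMeasurable_fderivWithin (hu θ hθ) hθ hm1
      (hd.mono fun a ha => (((contDiffOn_two_iff hu).1 ha).2.1 θ hθ).differentiableWithinAt)⟩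

/-- The perturbed densities and their first two derivatives converge at almost every
observation. -/
theorem Regular.ae_tendsto_gPert (hM : M.Regular C C₁ c₁ C₂)
    {L : Measure (EuclideanSpace ℝ (Fin m))} (hL : L ≪ M.ν)
    {G₁ G₂ G₃ : EuclideanSpace ℝ (Fin m) → ℝ}
    (hG : ∀ᵐ y ∂L, ∀ ε ∈ Set.Icc 0 1, M.GoodObs ε 1 (G₁ y) (G₂ y) (G₃ y) y)
    {θ₀ : EuclideanSpace ℝ (Fin d)} (hθ₀ : θ₀ ∈ M.Θ) (x : X) :
    ∀ᵐ y ∂L,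
      Tendsto (fun p : ℝ × EuclideanSpace ℝ (Fin d) => M.gPert p.1 p.2 y x)
        (𝓝[>] 0 ×ˢ 𝓝[M.Θ] θ₀) (𝓝 (M.g θ₀ y x)) ∧
      Tendsto (fun p : ℝ × EuclideanSpace ℝ (Fin d) =>
        fderivWithin ℝ (fun τ => M.gPert p.1 τ y x) M.Θ p.2)
        (𝓝[>] 0 ×ˢ 𝓝[M.Θ] θ₀) (𝓝 (fderivWithin ℝ (fun τ => M.g τ y x) M.Θ θ₀)) ∧
      Tendsto (fun p : ℝ × EuclideanSpace ℝ (Fin d) =>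
        fderivWithin₂ (fun τ => M.gPert p.1 τ y x) M.Θ p.2)
        (𝓝[>] 0 ×ˢ 𝓝[M.Θ] θ₀) (𝓝 (fderivWithin₂ (fun τ => M.g τ y x) M.Θ θ₀)) := by
  have hu := hM.uniqueDiff
  have hS := hM.quasiconvex
  have h𝒴 : ∀ᵐ y ∂M.ν, y ∈ M.𝒴 := M.ν_compl_obs
  set A : Set (EuclideanSpace ℝ (Fin m)) :=
    {y | ∀ ε ∈ Set.Icc 0 1, M.GoodObs ε 1 (G₁ y) (G₂ y) (G₃ y) y} with hA
  have z1 : (0 : ℝ) ∈ Set.Icc (0 : ℝ) 1 := ⟨le_rfl, zero_le_one⟩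
  obtain ⟨m0, m1, m2⟩ := aestronglyMeasurable_deriv_g hu hM.smooth (ρ := M.ν) measurable_id
    (measurable_const (a := x)) h𝒴 hθ₀
  have htame : ∀ y ∈ A, ∀ y' ∈ M.𝒴, dist y' y ≤ 1 →
      Tame M.Θ (G₁ y) (G₂ y + G₁ y ^ 2) fun θ => M.g θ y' x := fun y hy y' hy' hd =>
    (hy 0 z1).tame_g hu hM.smooth hy' hd x
  have c0 : ∀ y ∈ A, ∀ y' ∈ M.𝒴, dist y' y ≤ 1 → ∀ θ ∈ M.Θ, ‖M.g θ y' x‖ ≤ C₁ := by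
    intro y hy y' hy' hd θ hθ
    rw [Real.norm_of_nonneg (M.g_nonneg θ hθ y' hy' x)]
    exact hM.g_le θ hθ y' hy' x
  have c1 : ∀ y ∈ A, ∀ y' ∈ M.𝒴, dist y' y ≤ 1 → ∀ θ ∈ M.Θ,
      ‖fderivWithin ℝ (fun τ => M.g τ y' x) M.Θ θ‖ ≤ G₁ y * C₁ := by
    intro y hy y' hy' hd θ hθ
    exact ((htame y hy y' hy' hd).norm_fderivWithin_le θ hθ).trans
      (mul_le_mul_of_nonneg_left (hM.g_le θ hθ y' hy' x) (hy 0 z1).G₁_nonneg)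
  have c2 : ∀ y ∈ A, ∀ y' ∈ M.𝒴, dist y' y ≤ 1 → ∀ θ ∈ M.Θ,
      ‖fderivWithin₂ (fun τ => M.g τ y' x) M.Θ θ‖ ≤ (G₂ y + G₁ y ^ 2) * C₁ := by
    intro y hy y' hy' hd θ hθ
    exact ((htame y hy y' hy' hd).norm_fderivWithin₂_le θ hθ).trans
      (mul_le_mul_of_nonneg_left (hM.g_le θ hθ y' hy' x)
        (by have := (hy 0 z1).G₂_nonneg; positivity))
  -- Differentiation is applied for fixed `x` and `θ₀` to `g` and its two derivatives, which are
  -- bounded near good observations. The exceptional set may depend on `x` and `θ₀`.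
  have a0 := ae_tendsto_average_closedBall m0 h𝒴 (A := A)
    (fun y hy y' hy' hd => c0 y hy y' hy' hd θ₀ hθ₀)
  have a1 := ae_tendsto_average_closedBall m1 h𝒴 (A := A)
    (fun y hy y' hy' hd => c1 y hy y' hy' hd θ₀ hθ₀)
  have a2 := ae_tendsto_average_closedBall m2 h𝒴 (A := A)
    (fun y hy y' hy' hd => c2 y hy y' hy' hd θ₀ hθ₀)
  filter_upwards [hL a0, hL a1, hL a2, hG] with y b0 b1 b2 hy
  have ht := fun ε hε => (hy ε hε).tame_gPert hS hu hM.smooth hM.g_le x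
  have e1 : ∀ᶠ p : ℝ × EuclideanSpace ℝ (Fin d) in 𝓝[>] 0 ×ˢ 𝓝[M.Θ] θ₀,
      p.1 ∈ Set.Icc 0 1 ∧ p.2 ∈ M.Θ := by
    filter_upwards [tendsto_fst.eventually (Ioc_mem_nhdsGT (zero_lt_one' ℝ)),
      tendsto_snd.eventually self_mem_nhdsWithin] with p h1 h2
    exact ⟨⟨h1.1.le, h1.2⟩, h2⟩
  refine ⟨?_, ?_, ?_⟩
  · simp only [gPert_eq_integral]
    refine tendsto_integral_pertMeasure hy one_pos (Φ := fun θ y' => M.g θ y' x)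
      (D := C * (G₁ y * C₁)) hθ₀
      (fun ε hε θ hθ => ((ht ε hε).2.2.2 θ hθ).1) (fun θ hθ y' hy' hd => ?_) (b0 hy)
    exact hS.norm_image_sub_le
      ((contDiffOn_two_iff hu).1 (htame y hy y' hy' hd).contDiffOn).1 (c1 y hy y' hy' hd) hθ₀ hθ
  · refine Tendsto.congr' ?_ (tendsto_integral_pertMeasure hy one_pos
      (Φ := fun θ y' => fderivWithin ℝ (fun τ => M.g τ y' x) M.Θ θ)
      (D := C * ((G₂ y + G₁ y ^ 2) * C₁)) hθ₀
      (fun ε hε θ hθ => ((ht ε hε).2.2.2 θ hθ).2.1) (fun θ hθ y' hy' hd => ?_) (b1 hy))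
    · filter_upwards [e1] with p hp
      exact ((ht p.1 hp.1).2.1 p.2 hp.2).symm
    · exact hS.norm_image_sub_le
        ((contDiffOn_two_iff hu).1 (htame y hy y' hy' hd).contDiffOn).2.1 (c2 y hy y' hy' hd) hθ₀ hθ
  · refine Tendsto.congr' ?_ (tendsto_integral_pertMeasure hy one_pos
      (Φ := fun θ y' => fderivWithin₂ (fun τ => M.g τ y' x) M.Θ θ)
      (D := C * (C₁ * (G₃ y + 3 * (G₁ y * G₂ y) + G₁ y ^ 3))) hθ₀
      (fun ε hε θ hθ => ((ht ε hε).2.2.2 θ hθ).2.2) (fun θ hθ y' hy' hd => ?_) (b2 hy))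
    · filter_upwards [e1] with p hp
      exact ((ht p.1 hp.1).2.2.1 p.2 hp.2).symm
    · have hg := hy 0 z1
      exact hS.norm_fderivWithin₂_sub_le hu (hM.smooth.2 y' hy' x)
        (fun θ hθ => M.g_nonneg θ hθ y' hy' x) hg.G₁_nonneg hg.G₂_nonneg hg.G₃_nonneg
        (fun θ hθ => hM.g_le θ hθ y' hy' x) (fun θ hθ hp => hg.first θ hθ x y' hy' hd hp)
        (fun θ hθ hp => hg.second θ hθ x y' hy' hd hp)
        (fun θ hθ hp => hg.third θ hθ x y' hy' hd hp) hθ₀ hθ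

end HMMFamily

/-! ### Convergence of values and derivatives along a sequence of parameters -/

section Jets

variable {E : Type*} [NormedAddCommGroup E] [NormedSpace ℝ E] {S : Set E} {C : ℝ≥0}
variable {ι : Type*} {l : Filter ι}

/-- The values and the first two derivatives of `f i` at `θ i` converge to those of `f₀` at
`θ₀`. -/
structure TendstoJets (S : Set E) (l : Filter ι) (θ : ι → E) (θ₀ : E) (f : ι → E → ℝ)
    (f₀ : E → ℝ) : Prop where
  zero : Tendsto (fun i => f i (θ i)) l (𝓝 (f₀ θ₀))
  one : Tendsto (fun i => fderivWithin ℝ (f i) S (θ i)) l (𝓝 (fderivWithin ℝ f₀ S θ₀))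
  two : Tendsto (fun i => fderivWithin₂ (f i) S (θ i)) l (𝓝 (fderivWithin₂ f₀ S θ₀))

variable {θ : ι → E} {θ₀ : E} {f g : ι → E → ℝ} {f₀ g₀ : E → ℝ}

lemma tendstoJets_const (hu : UniqueDiffOn ℝ S) (hf : ContDiffOn ℝ 2 f₀ S) (hθ : ∀ i, θ i ∈ S)
    (hθ₀ : θ₀ ∈ S) (h : Tendsto θ l (𝓝 θ₀)) : TendstoJets S l θ θ₀ (fun _ => f₀) f₀ := by
  obtain ⟨h0, h1, h2⟩ := (contDiffOn_two_iff hu).1 hf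
  have h' : Tendsto θ l (𝓝[S] θ₀) := tendsto_nhdsWithin_iff.2 ⟨h, .of_forall hθ⟩
  exact ⟨(h0 θ₀ hθ₀).continuousWithinAt.tendsto.comp h',
    (h1 θ₀ hθ₀).continuousWithinAt.tendsto.comp h', (h2 θ₀ hθ₀).tendsto.comp h'⟩

lemma Filter.Tendsto.smulRight {L N : ι → E →L[ℝ] ℝ} {L₀ N₀ : E →L[ℝ] ℝ}
    (hL : Tendsto L l (𝓝 L₀)) (hN : Tendsto N l (𝓝 N₀)) :
    Tendsto (fun i => (L i).smulRight (N i)) l (𝓝 (L₀.smulRight N₀)) := by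
  have h := (((ContinuousLinearMap.smulRightL ℝ E (E →L[ℝ] ℝ)).continuous₂).tendsto (L₀, N₀)).comp
    (hL.prodMk_nhds hN)
  exact h

lemma TendstoJets.mul (hu : UniqueDiffOn ℝ S) (hf : TendstoJets S l θ θ₀ f f₀)
    (hg : TendstoJets S l θ θ₀ g g₀) (hfc : ∀ i, ContDiffOn ℝ 2 (f i) S)
    (hgc : ∀ i, ContDiffOn ℝ 2 (g i) S) (hfc₀ : ContDiffOn ℝ 2 f₀ S) (hgc₀ : ContDiffOn ℝ 2 g₀ S)
    (hθ : ∀ i, θ i ∈ S) (hθ₀ : θ₀ ∈ S) :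
    TendstoJets S l θ θ₀ (fun i τ => f i τ * g i τ) fun τ => f₀ τ * g₀ τ := by
  refine ⟨hf.zero.mul hg.zero, ?_, ?_⟩
  · simp only [fun i => fderivWithin_mul_of_contDiffOn hu (hfc i) (hgc i) (hθ i),
      fderivWithin_mul_of_contDiffOn hu hfc₀ hgc₀ hθ₀]
    exact (hf.zero.smul hg.one).add (hg.zero.smul hf.one)
  · simp only [fun i => fderivWithin₂_mul_of_contDiffOn hu (hfc i) (hgc i) (hθ i),
      fderivWithin₂_mul_of_contDiffOn hu hfc₀ hgc₀ hθ₀]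
    exact ((hf.zero.smul hg.two).add (hf.one.smulRight hg.one)).add
      ((hg.zero.smul hf.two).add (hg.one.smulRight hf.one))

lemma TendstoJets.log (hu : UniqueDiffOn ℝ S) (hf : TendstoJets S l θ θ₀ f f₀)
    (hfc : ∀ i, ContDiffOn ℝ 2 (f i) S) (hfc₀ : ContDiffOn ℝ 2 f₀ S)
    (hθ : ∀ i, θ i ∈ S) (hθ₀ : θ₀ ∈ S) (h : ∀ i, f i (θ i) ≠ 0) (h₀ : f₀ θ₀ ≠ 0) :
    TendstoJets S l θ θ₀ (fun i τ => Real.log (f i τ)) fun τ => Real.log (f₀ τ) := by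
  refine ⟨hf.zero.log h₀, ?_, ?_⟩
  · simp only [fun i => fderivWithin_log_of_contDiffOn hu (hfc i) (hθ i) (h i),
      fderivWithin_log_of_contDiffOn hu hfc₀ hθ₀ h₀]
    exact (hf.zero.inv₀ h₀).smul hf.one
  · simp only [fun i => fderivWithin₂_log_of_contDiffOn hu (hfc i) (hθ i) (h i),
      fderivWithin₂_log_of_contDiffOn hu hfc₀ hθ₀ h₀]
    exact ((hf.zero.inv₀ h₀).smul hf.two).sub
      (((hf.zero.pow 2).inv₀ (pow_ne_zero 2 h₀)).smul (hf.one.smulRight hf.one))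

variable {X : Type*} [MeasurableSpace X] {μ : Measure X} [IsFiniteMeasure μ]
  [FiniteDimensional ℝ E] {α : ℝ} {b₁ b₂ : ℕ → ℝ}

/-- The bounds on the iterated integrals depend on the kernels only through their bounds. -/
lemma exists_tame_iterInt (hS : QuasiconvexWith C S) (hu : UniqueDiffOn ℝ S) {B : ℝ} (hB : 0 ≤ B)
    (μ : Measure X) [IsFiniteMeasure μ] (α : ℝ) (b₁ b₂ : ℕ → ℝ) (m j : ℕ) :
    ∃ c₁ c₂ D : ℝ, 0 ≤ D ∧ ∀ K : ℕ → E → X → X → ℝ, TameKernels S μ K α b₁ b₂ →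
      (∀ j, ∀ θ ∈ S, ∀ x z, K j θ x z ≤ B) →
      0 ≤ c₁ ∧ 0 ≤ c₂ ∧ (∀ x, Tame S c₁ c₂ fun θ => iterInt μ K m j θ x) ∧
        ∀ θ ∈ S, ∀ x, iterInt μ K m j θ x ≤ D := by
  induction m generalizing j with
  | zero =>
    exact ⟨0, 0, 1, zero_le_one, fun K _ _ => ⟨le_rfl, le_rfl, fun x => tame_const 1 zero_le_one,
      fun _ _ _ => le_rfl⟩⟩
  | succ m ih =>
    obtain ⟨c₁, c₂, D, hD, ih⟩ := ih (j + 1)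
    refine ⟨b₁ j + c₁, b₂ j + 2 * (b₁ j * c₁) + c₂, B * D * μ.real Set.univ, by positivity,
      fun K hK hKB => ?_⟩
    obtain ⟨hc₁, hc₂, ht, hle⟩ := ih K hK hKB
    have h1 := hK.b₁_nonneg j
    have h2 := hK.b₂_nonneg j
    have hp := (hK.tameIter hS hu m (j + 1)).pos
    have hle' : ∀ θ ∈ S, ∀ x z, K j θ x z * iterInt μ K m (j + 1) θ z ≤ B * D := fun θ hθ x z =>
      mul_le_mul (hKB j θ hθ x z) (hle θ hθ z) (hp θ hθ z).le hB
    refine ⟨by positivity, by positivity, fun x => (Tame.integral hS hu (μ := μ)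
      (f := fun θ z => K j θ x z * iterInt μ K m (j + 1) θ z)
      (fun θ hθ => (hK.integrable_mul hS hu m j hθ x).aestronglyMeasurable)
      (.of_forall fun z => (hK.tame j x z).mul hu (ht z)) (B := fun _ => B * D)
      (.of_forall fun z θ hθ => hle' θ hθ x z)
      (integrable_const _) (by positivity) (by positivity)).1, fun θ hθ x => ?_⟩
    have := integral_mono (hK.integrable_mul hS hu m j hθ x) (integrable_const (B * D))
      (hle' θ hθ x)
    rw [integral_const, smul_eq_mul, mul_comm] at this
    exact this

variable {K : ℕ → ℕ → E → X → X → ℝ} {K₀ : ℕ → E → X → X → ℝ} {θ : ℕ → E}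

/-- Almost everywhere convergence of the kernels implies convergence of the iterated integrals. -/
theorem tendstoJets_iterInt (hS : QuasiconvexWith C S) (hu : UniqueDiffOn ℝ S) {B : ℝ}
    (hB : 0 ≤ B) (hK : ∀ i, TameKernels S μ (K i) α b₁ b₂) (hK₀ : TameKernels S μ K₀ α b₁ b₂)
    (hKB : ∀ i j, ∀ θ ∈ S, ∀ x z, K i j θ x z ≤ B) (hKB₀ : ∀ j, ∀ θ ∈ S, ∀ x z, K₀ j θ x z ≤ B)
    (hθ : ∀ i, θ i ∈ S) (hθ₀ : θ₀ ∈ S)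
    (h : ∀ j x, ∀ᵐ z ∂μ, TendstoJets S atTop θ θ₀ (fun i τ => K i j τ x z) fun τ => K₀ j τ x z)
    (m j : ℕ) (x : X) :
    TendstoJets S atTop θ θ₀ (fun i τ => iterInt μ (K i) m j τ x)
      fun τ => iterInt μ K₀ m j τ x := by
  induction m generalizing j x with
  | zero =>
    have e' : ∀ τ, fderivWithin₂ (fun _ : E => (1 : ℝ)) S τ = 0 := fun τ => by
      have : fderivWithin ℝ (fun _ : E => (1 : ℝ)) S = fun _ => 0 := by
        funext τ; simp
      rw [fderivWithin₂, this]
      simp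
    have key : TendstoJets S atTop θ θ₀ (fun _ _ => (1 : ℝ)) fun _ => (1 : ℝ) :=
      ⟨tendsto_const_nhds, by simp, by simp [e']⟩
    exact key
  | succ m ih =>
    -- The constants do not depend on the index `i` of the kernels, so they supply dominating
    -- constants for the integrals of the values and of both derivatives.
    obtain ⟨c₁, c₂, D, hD, hc⟩ := exists_tame_iterInt hS hu hB μ α b₁ b₂ m (j + 1)
    obtain ⟨hc₁, hc₂, ht₀, hle₀⟩ := hc K₀ hK₀ hKB₀
    have ht := fun i => (hc (K i) (hK i) (hKB i)).2.2.1
    have hle := fun i => (hc (K i) (hK i) (hKB i)).2.2.2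
    have h1 := hK₀.b₁_nonneg j
    have h2 := hK₀.b₂_nonneg j
    have hprod : ∀ᵐ z ∂μ, TendstoJets S atTop θ θ₀
        (fun i τ => K i j τ x z * iterInt μ (K i) m (j + 1) τ z)
        fun τ => K₀ j τ x z * iterInt μ K₀ m (j + 1) τ z := by
      filter_upwards [h j x] with z hz
      exact hz.mul hu (ih (j + 1) z) (fun i => ((hK i).tame j x z).contDiffOn)
        (fun i => (ht i z).contDiffOn) (hK₀.tame j x z).contDiffOn (ht₀ z).contDiffOn hθ hθ₀
    have htame := fun i z => ((hK i).tame j x z).mul hu (ht i z)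
    have hbd : ∀ i z, K i j (θ i) x z * iterInt μ (K i) m (j + 1) (θ i) z ≤ B * D := fun i z =>
      mul_le_mul (hKB i j _ (hθ i) x z) (hle i _ (hθ i) z)
        (((hK i).tameIter hS hu m (j + 1)).pos _ (hθ i) z).le hB
    have e := fun i => (hK i).tame_integral hS hu m j x
    obtain ⟨e₁, e₂, -⟩ := hK₀.tame_integral hS hu m j x
    refine ⟨?_, ?_, ?_⟩
    · refine tendsto_integral_of_dominated_convergence (fun _ => B * D)
        (fun i => ((hK i).integrable_mul hS hu m j (hθ i) x).aestronglyMeasurable)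
        (integrable_const _) (fun i => .of_forall fun z => ?_) (hprod.mono fun z hz => hz.zero)
      rw [Real.norm_of_nonneg ((htame i z).nonneg _ (hθ i))]
      exact hbd i z
    · simp only [fun i => (e i).1 _ (hθ i), e₁ _ hθ₀]
      exact tendsto_integral_of_dominated_convergence (fun _ => (b₁ j + c₁) * (B * D))
        (fun i => ((e i).2.2 _ (hθ i)).1.aestronglyMeasurable) (integrable_const _)
        (fun i => .of_forall fun z => ((htame i z).norm_fderivWithin_le _ (hθ i)).trans
          (mul_le_mul_of_nonneg_left (hbd i z) (by positivity))) (hprod.mono fun z hz => hz.one)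
    · simp only [fun i => (e i).2.1 _ (hθ i), e₂ _ hθ₀]
      exact tendsto_integral_of_dominated_convergence
        (fun _ => (b₂ j + 2 * (b₁ j * c₁) + c₂) * (B * D))
        (fun i => ((e i).2.2 _ (hθ i)).2.aestronglyMeasurable) (integrable_const _)
        (fun i => .of_forall fun z => ((htame i z).norm_fderivWithin₂_le _ (hθ i)).trans
          (mul_le_mul_of_nonneg_left (hbd i z) (by positivity))) (hprod.mono fun z hz => hz.two)

/-- Almost everywhere convergence of the kernels implies convergence of the derivatives of the
logarithms of the iterated integrals. -/
theorem tendstoJets_log_iterInt (hS : QuasiconvexWith C S) (hu : UniqueDiffOn ℝ S) {B : ℝ}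
    (hB : 0 ≤ B) (hK : ∀ i, TameKernels S μ (K i) α b₁ b₂) (hK₀ : TameKernels S μ K₀ α b₁ b₂)
    (hKB : ∀ i j, ∀ θ ∈ S, ∀ x z, K i j θ x z ≤ B) (hKB₀ : ∀ j, ∀ θ ∈ S, ∀ x z, K₀ j θ x z ≤ B)
    (hθ : ∀ i, θ i ∈ S) (hθ₀ : θ₀ ∈ S)
    (h : ∀ j x, ∀ᵐ z ∂μ, TendstoJets S atTop θ θ₀ (fun i τ => K i j τ x z) fun τ => K₀ j τ x z)
    (m j : ℕ) (x : X) :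
    TendstoJets S atTop θ θ₀ (fun i τ => Real.log (iterInt μ (K i) m j τ x))
      fun τ => Real.log (iterInt μ K₀ m j τ x) := by
  have hI := fun i => (hK i).tameIter hS hu m j
  have hI₀ := hK₀.tameIter hS hu m j
  refine (tendstoJets_iterInt hS hu hB hK hK₀ hKB hKB₀ hθ hθ₀ h m j x).log hu (fun i => ?_) ?_ hθ
    hθ₀ (fun i => ((hI i).pos _ (hθ i) x).ne') (hI₀.pos _ hθ₀ x).ne'
  · obtain ⟨c₁, c₂, -, -, ht⟩ := (hI i).tame
    exact (ht x).contDiffOn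
  · obtain ⟨c₁, c₂, -, -, ht⟩ := hI₀.tame
    exact (ht x).contDiffOn

end Jets

/-! ### Vanishing perturbations -/

namespace HMMFamily

variable {X : Type*} [TopologicalSpace X] [MeasurableSpace X] {d m : ℕ} {M : HMMFamily X d m}
  {π : M.Θ → Measure (X × EuclideanSpace ℝ (Fin m))} {θs : M.Θ}
  {C C₁ : ℝ≥0} {c₁ C₂ : ℝ}

/-- Along a sequence of vanishing perturbations, the perturbed densities of almost every
observation converge at almost every hidden state. -/
lemma Regular.ae_ae_tendstoJets_gPert (hM : M.Regular C C₁ c₁ C₂)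
    {L : Measure (EuclideanSpace ℝ (Fin m))} [SFinite L] (hL : L ≪ M.ν)
    {G₁ G₂ G₃ : EuclideanSpace ℝ (Fin m) → ℝ}
    (hG : ∀ᵐ y ∂L, ∀ ε ∈ Set.Icc 0 1, M.GoodObs ε 1 (G₁ y) (G₂ y) (G₃ y) y)
    {θ₀ : EuclideanSpace ℝ (Fin d)} (hθ₀ : θ₀ ∈ M.Θ) {u : ℕ → ℝ × EuclideanSpace ℝ (Fin d)}
    (hu : Tendsto u atTop (𝓝[>] 0 ×ˢ 𝓝[M.Θ] θ₀)) (hu1 : ∀ i, (u i).1 ∈ Set.Icc 0 1)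
    (huΘ : ∀ i, (u i).2 ∈ M.Θ) :
    ∀ᵐ y ∂L, ∀ᵐ z ∂M.μ, TendstoJets M.Θ atTop (fun i => (u i).2) θ₀
      (fun i τ => M.gPert (u i).1 τ y z) fun τ => M.gPert 0 τ y z := by
  have e : ∀ y z, (fun τ => M.gPert 0 τ y z) = fun τ => M.g τ y z := fun y z => by simp [gPert]
  simp only [e]
  have hGp : ∀ᵐ p ∂L.prod M.μ, ∀ ε ∈ Set.Icc 0 1,
      M.GoodObs ε 1 (G₁ p.1) (G₂ p.1) (G₃ p.1) p.1 :=
    Measure.quasiMeasurePreserving_fst.ae hG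
  have hm := fun i => hM.aestronglyMeasurable_deriv_gPert (ρ := L.prod M.μ) measurable_fst
    measurable_snd (hGp.mono fun p hp => hp _ (hu1 i)) (huΘ i)
  have hm₀ := aestronglyMeasurable_deriv_g hM.uniqueDiff hM.smooth (ρ := L.prod M.μ)
    measurable_fst measurable_snd (hGp.mono fun p hp => (hp 0 ⟨le_rfl, zero_le_one⟩).mem) hθ₀
  -- Convergence is known for each hidden state at almost every observation. The likelihood
  -- integrals need it for almost every observation at almost every hidden state.
  have h := fun z => hM.ae_tendsto_gPert hL hG hθ₀ z
  filter_upwards [ae_ae_tendsto_comm (fun i => (hm i).1) hm₀.1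
      (.of_forall fun z => (h z).mono fun y hy => hy.1.comp hu),
    ae_ae_tendsto_comm (fun i => (hm i).2.1) hm₀.2.1
      (.of_forall fun z => (h z).mono fun y hy => hy.2.1.comp hu),
    ae_ae_tendsto_comm (fun i => (hm i).2.2) hm₀.2.2
      (.of_forall fun z => (h z).mono fun y hy => hy.2.2.comp hu)] with y h0 h1 h2
  filter_upwards [h0, h1, h2] with z k0 k1 k2 using ⟨k0, k1, k2⟩

/-- The null set depends on the sequence `u`. This suffices, since the convergence of the means is
tested along sequences. -/
lemma Regular.ae_tendsto_score (hM : M.Regular C C₁ c₁ C₂) (hπ : M.IsStationary π) (h3 : M.A3)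
    {G₁ G₂ G₃ : EuclideanSpace ℝ (Fin m) → ℝ}
    (hG : ∀ᵐ y ∂(π θs).map Prod.snd, ∀ ε ∈ Set.Icc 0 1, M.GoodObs ε 1 (G₁ y) (G₂ y) (G₃ y) y)
    {θ₀ : EuclideanSpace ℝ (Fin d)} (hθ₀ : θ₀ ∈ M.Θ) {u : ℕ → ℝ × EuclideanSpace ℝ (Fin d)}
    (hu : Tendsto u atTop (𝓝[>] 0 ×ˢ 𝓝[M.Θ] θ₀)) (hu1 : ∀ i, (u i).1 ∈ Set.Icc 0 1)
    (huΘ : ∀ i, (u i).2 ∈ M.Θ) :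
    ∀ᵐ ω ∂M.pathLaw θs (π θs), ∀ n x,
      Tendsto (fun i => M.score (u i).1 ω n (u i).2 x) atTop (𝓝 (M.score 0 ω n θ₀ x)) ∧
      Tendsto (fun i => M.hessian (u i).1 ω n (u i).2 x) atTop (𝓝 (M.hessian 0 ω n θ₀ x)) := by
  have := (hπ θs).1
  have hJ := hM.ae_ae_tendstoJets_gPert (hπ.map_snd_absolutelyContinuous θs) hG hθ₀ hu hu1 huΘ
  have hgood : ∀ᵐ ω ∂M.pathLaw θs (π θs), ∀ j, ∀ ε ∈ Set.Icc 0 1,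
      M.GoodObs ε 1 (G₁ (ω j).2) (G₂ (ω j).2) (G₃ (ω j).2) (ω j).2 := ae_all_iff.2 fun j =>
    (hπ.measurePreserving_obs h3 θs j).quasiMeasurePreserving.ae hG
  have hjets := ae_all_iff.2 fun j : ℕ =>
    (hπ.measurePreserving_obs h3 θs j).quasiMeasurePreserving.ae hJ
  have hC₁ : (0 : ℝ) ≤ C₁ := C₁.2
  have z1 : (0 : ℝ) ∈ Set.Icc (0 : ℝ) 1 := ⟨le_rfl, zero_le_one⟩
  have huθ : Tendsto (fun i => (u i).2) atTop (𝓝 θ₀) :=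
    (tendsto_snd.comp hu).mono_right nhdsWithin_le_nhds
  filter_upwards [hgood, hjets] with ω h1 h2 n x
  have hK := fun ε hε => hM.tameKernels (y := fun k => (ω k).2) fun j => h1 (j + 1) ε hε
  have hB : ∀ ε ∈ Set.Icc (0 : ℝ) 1, ∀ j, ∀ θ ∈ M.Θ, ∀ x z,
      M.pertKernel ε (fun k => (ω k).2) j θ x z ≤ C₁ * C₁ := fun ε hε j θ hθ x z =>
    mul_le_mul (hM.q_le θ hθ x z) ((h1 (j + 1) ε hε).gPert_le hM.g_le hθ z)
      ((h1 (j + 1) ε hε).gPert_nonneg hθ z) hC₁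
  have hlog := tendstoJets_log_iterInt hM.quasiconvex hM.uniqueDiff (mul_nonneg hC₁ hC₁)
    (fun i => hK _ (hu1 i)) (hK 0 z1) (fun i => hB _ (hu1 i)) (hB 0 z1) huΘ hθ₀
    (fun j x => by
      filter_upwards [h2 (j + 1)] with z hz
      have hq := (hM.smooth.1 x z).of_le (m := 2) (by norm_num)
      exact (tendstoJets_const hM.uniqueDiff hq huΘ hθ₀ huθ).mul hM.uniqueDiff hz (fun _ => hq)
        (fun i => ((h1 (j + 1) _ (hu1 i)).tame_gPert hM.quasiconvex hM.uniqueDiff hM.smooth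
          hM.g_le z).1.contDiffOn) hq
        ((h1 (j + 1) 0 z1).tame_gPert hM.quasiconvex hM.uniqueDiff hM.smooth
          hM.g_le z).1.contDiffOn huΘ hθ₀) n 0 x
  exact ⟨hlog.one, hlog.two⟩

/-- The means of the increments of the derivatives of the log-likelihoods converge as the
perturbation vanishes. -/
theorem Regular.tendsto_integral_increment (hM : M.Regular C C₁ c₁ C₂) (hπ : M.IsStationary π)
    (h3 : M.A3) {G₁ G₂ G₃ : EuclideanSpace ℝ (Fin m) → ℝ}
    (hG : ∀ᵐ y ∂(π θs).map Prod.snd, ∀ ε ∈ Set.Icc 0 1, M.GoodObs ε 1 (G₁ y) (G₂ y) (G₃ y) y)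
    {lam : ℝ} {H : (ℕ → X × EuclideanSpace ℝ (Fin m)) → ℝ}
    (hH : Integrable H (M.pathLaw θs (π θs)))
    (hF : ∀ᵐ ω ∂M.pathLaw θs (π θs), ∀ ε ∈ Set.Icc 0 1,
      ForgettingArray M.Θ lam (fun j => H (MarkovChain.shift^[j] ω)) (fun n j =>
        M.score ε (MarkovChain.shift^[j] ω) n) ∧
      ForgettingArray M.Θ lam (fun j => H (MarkovChain.shift^[j] ω)) (fun n j =>
        M.hessian ε (MarkovChain.shift^[j] ω) n))
    {θ₀ : EuclideanSpace ℝ (Fin d)} (hθ₀ : θ₀ ∈ M.Θ) (x : X) (b : ℕ) :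
    Tendsto (fun p : ℝ × EuclideanSpace ℝ (Fin d) => ∫ ω, (M.score p.1 ω (b + 1) p.2 x -
      M.score p.1 (MarkovChain.shift ω) b p.2 x) ∂M.pathLaw θs (π θs)) (𝓝[>] 0 ×ˢ 𝓝[M.Θ] θ₀)
      (𝓝 (∫ ω, (M.score 0 ω (b + 1) θ₀ x -
        M.score 0 (MarkovChain.shift ω) b θ₀ x) ∂M.pathLaw θs (π θs))) ∧
    Tendsto (fun p : ℝ × EuclideanSpace ℝ (Fin d) => ∫ ω, (M.hessian p.1 ω (b + 1) p.2 x -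
      M.hessian p.1 (MarkovChain.shift ω) b p.2 x) ∂M.pathLaw θs (π θs)) (𝓝[>] 0 ×ˢ 𝓝[M.Θ] θ₀)
      (𝓝 (∫ ω, (M.hessian 0 ω (b + 1) θ₀ x -
        M.hessian 0 (MarkovChain.shift ω) b θ₀ x) ∂M.pathLaw θs (π θs))) := by
  have hT := (hπ.ergodic h3 θs).toMeasurePreserving
  have hgood : ∀ᵐ ω ∂M.pathLaw θs (π θs), ∀ j, ∀ ε ∈ Set.Icc 0 1,
      M.GoodObs ε 1 (G₁ (ω j).2) (G₂ (ω j).2) (G₃ (ω j).2) (ω j).2 := ae_all_iff.2 fun j =>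
    (hπ.measurePreserving_obs h3 θs j).quasiMeasurePreserving.ae hG
  have hm : ∀ ε ∈ Set.Icc (0 : ℝ) 1, ∀ θ ∈ M.Θ,
      AEStronglyMeasurable (fun ω => M.score ε ω (b + 1) θ x -
        M.score ε (MarkovChain.shift ω) b θ x) (M.pathLaw θs (π θs)) ∧
      AEStronglyMeasurable (fun ω => M.hessian ε ω (b + 1) θ x -
        M.hessian ε (MarkovChain.shift ω) b θ x) (M.pathLaw θs (π θs)) := fun ε hε θ hθ => by
    have h := fun n => hM.aestronglyMeasurable_logDeriv
      (hgood.mono fun ω hω j => hω j ε hε) n 0 x hθ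
    exact ⟨(h (b + 1)).1.sub ((h b).1.comp_measurePreserving hT),
      (h (b + 1)).2.sub ((h b).2.comp_measurePreserving hT)⟩
  -- Dropping an initial segment places every term in the range where the bounds hold.
  have hseq : ∀ u : ℕ → ℝ × EuclideanSpace ℝ (Fin d),
      Tendsto u atTop (𝓝[>] 0 ×ˢ 𝓝[M.Θ] θ₀) → ∃ N, Tendsto (fun i => u (i + N)) atTop
        (𝓝[>] 0 ×ˢ 𝓝[M.Θ] θ₀) ∧ (∀ i, (u (i + N)).1 ∈ Set.Icc 0 1) ∧
        ∀ i, (u (i + N)).2 ∈ M.Θ := by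
    intro u hu
    have e1 := (tendsto_fst.comp hu).eventually (Ioc_mem_nhdsGT (zero_lt_one' ℝ))
    have e2 := (tendsto_snd.comp hu).eventually self_mem_nhdsWithin
    obtain ⟨N, hN⟩ := eventually_atTop.1 (e1.and e2)
    exact ⟨N, (tendsto_add_atTop_iff_nat N).2 hu,
      fun i => ⟨(hN _ (Nat.le_add_left N i)).1.1.le, (hN _ (Nat.le_add_left N i)).1.2⟩,
      fun i => (hN _ (Nat.le_add_left N i)).2⟩
  constructor
  · refine tendsto_of_seq_tendsto fun u hu => ?_
    obtain ⟨N, h1, h2, h3'⟩ := hseq u hu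
    refine (tendsto_add_atTop_iff_nat N).1 ?_
    have hs := hM.ae_tendsto_score hπ h3 hG hθ₀ h1 h2 h3'
    refine tendsto_integral_of_dominated_convergence H (fun i => (hm _ (h2 i) _ (h3' i)).1) hH
      (fun i => ?_) ?_
    · filter_upwards [hF] with ω hω
      exact (hω _ (h2 i)).1.step b 0 _ (h3' i) x x
    · filter_upwards [hs, hT.quasiMeasurePreserving.ae hs] with ω k1 k2
      exact (k1 (b + 1) x).1.sub (k2 b x).1
  · refine tendsto_of_seq_tendsto fun u hu => ?_
    obtain ⟨N, h1, h2, h3'⟩ := hseq u hu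
    refine (tendsto_add_atTop_iff_nat N).1 ?_
    have hs := hM.ae_tendsto_score hπ h3 hG hθ₀ h1 h2 h3'
    refine tendsto_integral_of_dominated_convergence H (fun i => (hm _ (h2 i) _ (h3' i)).2) hH
      (fun i => ?_) ?_
    · filter_upwards [hF] with ω hω
      exact (hω _ (h2 i)).2.step b 0 _ (h3' i) x x
    · filter_upwards [hs, hT.quasiMeasurePreserving.ae hs] with ω k1 k2
      exact (k1 (b + 1) x).2.sub (k2 b x).2

end HMMFamily

/-! ### Uniform convergence from approximations uniform in the perturbation -/

section UniformLimits

variable {E F : Type*} [NormedAddCommGroup E] [NormedAddCommGroup F] {S : Set E}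

/-- A limit uniform over the perturbations, of functions that converge as the perturbation
vanishes, converges as well. -/
lemma tendstoUniformlyOn_of_uniform_approximation (hS : IsCompact S) {v : ℝ → E → F}
    (hc : ContinuousOn (v 0) S) {e : ℕ → ℝ → E → F} {r : ℕ → ℝ} (hr : Tendsto r atTop (𝓝 0))
    (hv : ∀ b, ∀ ε ∈ Set.Icc (0 : ℝ) 1, ∀ θ ∈ S, ‖v ε θ - e b ε θ‖ ≤ r b)
    (he : ∀ b, ∀ θ₀ ∈ S, Tendsto (fun p : ℝ × E => e b p.1 p.2) (𝓝[>] 0 ×ˢ 𝓝[S] θ₀)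
      (𝓝 (e b 0 θ₀))) :
    TendstoUniformlyOn v (v 0) (𝓝[>] 0) S := by
  -- Three errors: replacing `v` by `e b` at `(ε, θ)` and at `(0, θ₀)`, each at most `r b`, and the
  -- convergence of `e b` for the chosen `b`.
  have hlim : ∀ θ₀ ∈ S, Tendsto (fun p : ℝ × E => v p.1 p.2) (𝓝[>] 0 ×ˢ 𝓝[S] θ₀)
      (𝓝 (v 0 θ₀)) := by
    intro θ₀ hθ₀
    rw [Metric.tendsto_nhds]
    intro η hη
    obtain ⟨b, hb⟩ := (hr.eventually (gt_mem_nhds (show (0 : ℝ) < η / 3 by positivity))).exists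
    filter_upwards [Metric.tendsto_nhds.1 (he b θ₀ hθ₀) (η / 3) (by positivity),
      tendsto_fst.eventually (Ioc_mem_nhdsGT (zero_lt_one' ℝ)),
      tendsto_snd.eventually self_mem_nhdsWithin] with p h1 h2 h3
    have k1 := hv b p.1 ⟨h2.1.le, h2.2⟩ p.2 h3
    have k2 := hv b 0 ⟨le_rfl, zero_le_one⟩ θ₀ hθ₀
    rw [← dist_eq_norm] at k1 k2
    rw [dist_comm] at k2
    linarith [dist_triangle4 (v p.1 p.2) (e b p.1 p.2) (e b 0 θ₀) (v 0 θ₀)]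
  -- Joint convergence at each point, together with continuity of `v 0`, is local uniform
  -- convergence, which compactness makes uniform.
  refine (tendstoLocallyUniformlyOn_iff_tendstoUniformlyOn_of_compact hS).1 ?_
  rw [tendstoLocallyUniformlyOn_iff_forall_tendsto]
  intro θ₀ hθ₀
  have h1 := (hc θ₀ hθ₀).tendsto.comp (tendsto_snd (f := 𝓝[>] (0 : ℝ)) (g := 𝓝[S] θ₀))
  have h2 := h1.prodMk_nhds (hlim θ₀ hθ₀)
  exact h2.mono_right (nhds_le_uniformity _)

end UniformLimits

end

/-! ### The theorem -/

theorem theorem1 {X : Type*} [TopologicalSpace X] [PolishSpace X] [CompactSpace X]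
    [MeasurableSpace X] [BorelSpace X] {d m : ℕ} (M : HMMFamily X d m)
    (π : M.Θ → Measure (X × EuclideanSpace ℝ (Fin m))) (θs : M.Θ)
    (hΘ : M.RegularParam) (hπ : M.IsStationary π)
    (h1 : M.A1 π θs) (h2 : M.A2) (h3 : M.A3) (h4 : M.A4) (h5 : M.A5) (h6 : M.A6 π θs) :
    ∃ l : ℝ → EuclideanSpace ℝ (Fin d) → ℝ,
      (∀ ε : ℝ, 0 ≤ ε →
        ContDiffOn ℝ 2 (l ε) M.Θ ∧
        ∀ x : X, ∀ᵐ ω ∂M.pathLaw θs (π θs),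
          (∀ n : ℕ, (∀ θ ∈ M.Θ, 0 < M.likelihood ε n (fun k => (ω k).2) x θ) ∧
            ContDiffOn ℝ 2 (M.likelihood ε n (fun k => (ω k).2) x) M.Θ) ∧
          TendstoC2On (fun n : ℕ => M.relLogLik θs ε n (fun k => (ω k).2) x) (l ε)
            atTop M.Θ) ∧
      TendstoC2On l (l 0) (𝓝[>] 0) M.Θ := by
  obtain ⟨C, C₁, c₁, C₂, hM⟩ := hπ.exists_regular θs hΘ h2 h3 h4 h5
  obtain ⟨x₀⟩ := hπ.nonempty θs
  obtain ⟨G₁, G₂, G₃, lam, H, hl0, hl1, hH, hL, hG⟩ := hM.exists_forgettingArray hπ h3 h6 one_pos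
  -- The approximation by increments is recorded only for `ε ≤ 1`, where `lam` and `H` are common to
  -- all perturbations; this uniformity drives the limit `ε → 0`. For `ε > 1` the moment bounds are
  -- used with radius `ε` itself.
  have key : ∀ ε : ℝ, ∃ l : EuclideanSpace ℝ (Fin d) → ℝ, 0 ≤ ε →
      ContDiffOn ℝ 2 l M.Θ ∧ l θs = 0 ∧
      (∀ x : X, ∀ᵐ ω ∂M.pathLaw θs (π θs),
        (∀ n : ℕ, (∀ θ ∈ M.Θ, 0 < M.likelihood ε n (fun k => (ω k).2) x θ) ∧
          ContDiffOn ℝ 2 (M.likelihood ε n (fun k => (ω k).2) x) M.Θ) ∧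
        TendstoC2On (fun n : ℕ => M.relLogLik θs ε n (fun k => (ω k).2) x) l atTop M.Θ) ∧
      (ε ≤ 1 → ∀ b, ∀ θ ∈ M.Θ,
        ‖fderivWithin ℝ l M.Θ θ - ∫ ω, (M.score ε ω (b + 1) θ x₀ -
          M.score ε (MarkovChain.shift ω) b θ x₀) ∂M.pathLaw θs (π θs)‖ ≤
          lam ^ b * ∫ ω, H ω ∂M.pathLaw θs (π θs) ∧
        ‖fderivWithin₂ l M.Θ θ - ∫ ω, (M.hessian ε ω (b + 1) θ x₀ -
          M.hessian ε (MarkovChain.shift ω) b θ x₀) ∂M.pathLaw θs (π θs)‖ ≤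
          lam ^ b * ∫ ω, H ω ∂M.pathLaw θs (π θs)) := by
    intro ε
    by_cases h0 : 0 ≤ ε
    swap
    · exact ⟨0, fun h => absurd h h0⟩
    rcases le_or_gt ε 1 with h | h
    · obtain ⟨l, a1, a2, a3, a4⟩ := hM.exists_limit (ε := ε) (κ := 1) hπ h3
        (G₁ := fun y => G₁ y) (G₂ := fun y => G₂ y) (G₃ := fun y => G₃ y) hl0 hl1 hH
        (hG.mono fun ω hω => hω ε ⟨h0, h⟩) x₀
      exact ⟨l, fun _ => ⟨a1, a2, a3, fun _ => a4⟩⟩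
    · obtain ⟨K₁, K₂, K₃, _, _, hl0', hl1', hH', -, hG'⟩ :=
        hM.exists_forgettingArray hπ h3 h6 (one_pos.trans h)
      obtain ⟨l, a1, a2, a3, -⟩ := hM.exists_limit (ε := ε) (κ := ε) hπ h3
        (G₁ := fun y => K₁ y) (G₂ := fun y => K₂ y) (G₃ := fun y => K₃ y) hl0' hl1' hH'
        (hG'.mono fun ω hω => hω ε ⟨h0, le_rfl⟩) x₀
      exact ⟨l, fun _ => ⟨a1, a2, a3, fun h' => absurd h' h.not_ge⟩⟩
  choose l hl using key
  refine ⟨l, fun ε hε => ⟨(hl ε hε).1, (hl ε hε).2.2.1⟩, ?_⟩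
  have hpos : ∀ᶠ ε : ℝ in 𝓝[>] 0, 0 ≤ ε :=
    eventually_mem_nhdsWithin.mono fun ε hε => (Set.mem_Ioi.1 hε).le
  have hr : Tendsto (fun b : ℕ => lam ^ b * ∫ ω, H ω ∂M.pathLaw θs (π θs)) atTop (𝓝 0) := by
    simpa using (tendsto_pow_atTop_nhds_zero_of_lt_one hl0.le hl1).mul_const
      (∫ ω, H ω ∂M.pathLaw θs (π θs))
  obtain ⟨-, d1, d2⟩ := (contDiffOn_two_iff hM.uniqueDiff).1 (hl 0 le_rfl).1
  have hinc := fun b θ₀ (hθ₀ : θ₀ ∈ M.Θ) => hM.tendsto_integral_increment hπ h3 hL hH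
    (hG.mono fun ω hω ε hε => (hω ε hε).2) hθ₀ x₀ b
  refine hM.quasiconvex.tendstoC2On hM.compact.isBounded hM.uniqueDiff
    (hpos.mono fun ε hε => (hl ε hε).1) (hl 0 le_rfl).1 θs.2
    (hpos.mono fun ε hε => by rw [(hl ε hε).2.1, (hl 0 le_rfl).2.1]) ?_ ?_
  · exact tendstoUniformlyOn_of_uniform_approximation hM.compact
      (v := fun ε => fderivWithin ℝ (l ε) M.Θ) (fun θ hθ => (d1 θ hθ).continuousWithinAt) hr
      (e := fun b ε θ => ∫ ω, (M.score ε ω (b + 1) θ x₀ -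
        M.score ε (MarkovChain.shift ω) b θ x₀) ∂M.pathLaw θs (π θs))
      (fun b ε hε θ hθ => ((hl ε hε.1).2.2.2 hε.2 b θ hθ).1) fun b θ₀ hθ₀ => (hinc b θ₀ hθ₀).1
  · exact tendstoUniformlyOn_of_uniform_approximation hM.compact
      (v := fun ε => fderivWithin₂ (l ε) M.Θ) d2 hr
      (e := fun b ε θ => ∫ ω, (M.hessian ε ω (b + 1) θ x₀ -
        M.hessian ε (MarkovChain.shift ω) b θ x₀) ∂M.pathLaw θs (π θs))
      (fun b ε hε θ hθ => ((hl ε hε.1).2.2.2 hε.2 b θ hθ).2) fun b θ₀ hθ₀ => (hinc b θ₀ hθ₀).2
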